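/- For a positive definite real $p\times p$ matrix $\Sigma$, a positive semidefinite $p\times p$ matrix $\Delta$ and $\alpha>0$, let $g_\alpha(\cdot\,;\Sigma,\Delta)$ denote the (non-central) $\Gamma_p(\alpha,\Sigma,\Delta)$ density, that is, the continuous function on $(0,\infty)^p$, unique if it exists, whose Laplace transform converges absolutely and equals $$\int_{(0,\infty)^p} e^{-\sum_j t_jx_j}\,g_\alpha(x;\Sigma,\Delta)\,dx=|I_p+\Sigma T|^{-\alpha}\exp\!\big(-\operatorname{tr}\big(T(I_p+\Sigma T)^{-1}\Delta\big)\big),\qquad T=\mathrm{diag}(t_1,\dots,t_p),\ t_j\ge 0 .$$ For $\Delta=0$ this is the $\Gamma_p(\alpha,\Sigma)$ density $g_\alpha(\cdot\,;\Sigma)$, with Laplace transform $|I_p+\Sigma T|^{-\alpha}$. **Theorem 1.** Let $p=p_1+p_2$ with $p_1,p_2\ge 1$, let $\Sigma=\begin{pmatrix}\Sigma_{11}&\Sigma_{12}\\ \Sigma_{21}&\Sigma_{22}\end{pmatrix}$ be a positive definite real $p\times p$ matrix with $p_i\times p_i$ diagonal blocks $\Sigma_{ii}$, put $\Sigma_0=\Sigma_{11}-\Sigma_{12}\Sigma_{22}^{-1}\Sigma_{21}$,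 and let $2\alpha>\max(p_1-1,p_2-1)$. Then $g_\alpha(\cdot\,;\Sigma)$ exists, $g_\alpha(\cdot\,;\Sigma_0,\Delta)$ exists for every positive semidefinite $p_1\times p_1$ matrix $\Delta$, and for all $x_1,\dots,x_p>0$, with $X=\mathrm{diag}(x_{p_1+1},\dots,x_p)$, $$g_\alpha(x_1,\dots,x_p;\Sigma)=\frac{1}{\Gamma_{p_2}(\alpha)\,|\Sigma_{22}|^{\alpha}}\int_{\mathcal C_{p_2}} g_\alpha\big(x_1,\dots,x_{p_1};\Sigma_0,\ \Sigma_{12}\Sigma_{22}^{-1}X^{1/2}CX^{1/2}\Sigma_{22}^{-1}\Sigma_{21}\big)\,|X|^{\alpha-1}|C|^{\alpha-(p_2+1)/2}\,e^{-\operatorname{tr}(\Sigma_{22}^{-1}X^{1/2}CX^{1/2})}\,dC ,$$ where the integral converges absolutely. Here $\mathcal C_{p_2}$ is the set of all $p_2\times p_2$ correlation matrices (real, symmetric, positive semidefinite, with unit diagonal), $dC=\prod_{i<j}dc_{ij}$, and $\Gamma_{p_2}(\alpha)=\pi^{p_2(p_2-1)/4}\prod_{j=1}^{p_2}\Gamma\big(\alpha-\tfrac{j-1}{2}\big)$.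 -/

import Mathlib

open MeasureTheory Matrix

noncomputable section

/-- The open positive orthant `(0, ∞)^ι`. -/
def posOrthant (ι : Type*) : Set (ι → ℝ) := {x | ∀ i, 0 < x i}

/-- The transform `|I + S T|^{-α} etr(-T (I + S T)⁻¹ D)`, with `T = diag(t)`, of the non-central
multivariate gamma distribution `Γ(α, S, D)`. For `D = 0` it is `|I + S T|^{-α}`. -/
def gammaTransform {ι : Type*} [Fintype ι] [DecidableEq ι] (α : ℝ) (S D : Matrix ι ι ℝ)
    (t : ι → ℝ) : ℝ :=
  (1 + S * diagonal t).det ^ (-α) *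
    Real.exp (-(diagonal t * (1 + S * diagonal t)⁻¹ * D).trace)

/-- `f` is the continuous version on `(0, ∞)^ι` of the `Γ(α, S, D)` density: its Laplace transform
converges absolutely and is the function above, for all `t ≥ 0`. Two such functions
agree on the whole orthant, by uniqueness of Laplace transforms and continuity. -/
def IsGammaDensity {ι : Type*} [Fintype ι] [DecidableEq ι] (α : ℝ) (S D : Matrix ι ι ℝ)
    (f : (ι → ℝ) → ℝ) : Prop :=
  ContinuousOn f (posOrthant ι) ∧
    ∀ t : ι → ℝ, (∀ i, 0 ≤ t i) →
      IntegrableOn (fun x => Real.exp (-∑ i, t i * x i) * f x) (posOrthant ι) ∧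
      ∫ x in posOrthant ι, Real.exp (-∑ i, t i * x i) * f x = gammaTransform α S D t

/-- The non-central `Γ(α, S, D)` density, as a function on `(0, ∞)^ι`. -/
def noncentralGammaDensity {ι : Type*} [Fintype ι] [DecidableEq ι] (α : ℝ)
    (S D : Matrix ι ι ℝ) : (ι → ℝ) → ℝ :=
  Classical.epsilon (IsGammaDensity α S D)

/-- The (central) `Γ(α, S)` density, with Laplace transform `|I + S T|^{-α}`. -/
def gammaDensity {ι : Type*} [Fintype ι] [DecidableEq ι] (α : ℝ) (S : Matrix ι ι ℝ) :
    (ι → ℝ) → ℝ :=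
  noncentralGammaDensity α S 0

/-- The multivariate gamma function
`Γ_q(α) = π^{q(q-1)/4} ∏_{j=1}^{q} Γ(α - (j-1)/2)`. -/
def multivariateGamma (q : ℕ) (α : ℝ) : ℝ :=
  Real.pi ^ ((q : ℝ) * ((q : ℝ) - 1) / 4) * ∏ j : Fin q, Real.Gamma (α - ((j : ℕ) : ℝ) / 2)

/-- The positions strictly above the diagonal of a `q × q` matrix. -/
abbrev UpperIndex (q : ℕ) : Type := {ij : Fin q × Fin q // ij.1 < ij.2}

/-- The symmetric matrix with unit diagonal and the given entries above the diagonal. -/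
def unitDiagMatrix {q : ℕ} (c : UpperIndex q → ℝ) : Matrix (Fin q) (Fin q) ℝ :=
  Matrix.of fun i j =>
    if h : i < j then c ⟨(i, j), h⟩ else if h' : j < i then c ⟨(j, i), h'⟩ else 1

/-- The set of all `q × q` correlation matrices, in the coordinates `c_{ij}`, `i < j`.
The measure `dC` is Lebesgue measure in these coordinates. -/
def correlationSet (q : ℕ) : Set (UpperIndex q → ℝ) :=
  {c | (unitDiagMatrix c).PosSemidef}

/-- The matrix `X^{1/2} C X^{1/2}` with `X = diag(x)`. -/
def scaleByDiag {q : ℕ} (x : Fin q → ℝ) (C : Matrix (Fin q) (Fin q) ℝ) :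
    Matrix (Fin q) (Fin q) ℝ :=
  diagonal (fun j => Real.sqrt (x j)) * C * diagonal (fun j => Real.sqrt (x j))

/-- The Schur complement `S₁₁ - S₁₂ S₂₂⁻¹ S₂₁` of a block matrix. -/
def schurComplement {m n : Type*} [Fintype n] [DecidableEq n]
    (S : Matrix (m ⊕ n) (m ⊕ n) ℝ) : Matrix m m ℝ :=
  S.toBlocks₁₁ - S.toBlocks₁₂ * S.toBlocks₂₂⁻¹ * S.toBlocks₂₁

/-- The integrand over the correlation matrices `C`, at the point `x = (x₁, x₂)`:
the non-central density at `x₁` with non-centrality matrix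
`S₁₂ S₂₂⁻¹ X^{1/2} C X^{1/2} S₂₂⁻¹ S₂₁`, times
`|X|^{α-1} |C|^{α-(p₂+1)/2} etr(-S₂₂⁻¹ X^{1/2} C X^{1/2})`, where `X = diag(x₂)`. -/
def correlationIntegrand {p₁ p₂ : ℕ} (α : ℝ)
    (S : Matrix (Fin p₁ ⊕ Fin p₂) (Fin p₁ ⊕ Fin p₂) ℝ) (x : Fin p₁ ⊕ Fin p₂ → ℝ)
    (C : Matrix (Fin p₂) (Fin p₂) ℝ) : ℝ :=
  noncentralGammaDensity α (schurComplement S)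
      (S.toBlocks₁₂ * S.toBlocks₂₂⁻¹ * scaleByDiag (fun j => x (Sum.inr j)) C *
        S.toBlocks₂₂⁻¹ * S.toBlocks₂₁)
      (fun i => x (Sum.inl i)) *
    (∏ j : Fin p₂, x (Sum.inr j)) ^ (α - 1) *
    C.det ^ (α - ((p₂ : ℝ) + 1) / 2) *
    Real.exp (-(S.toBlocks₂₂⁻¹ * scaleByDiag (fun j => x (Sum.inr j)) C).trace)

end

/-!
The identity is proved on the level of Laplace transforms. Write `T = diag(t)` in block form
`T₁, T₂`, let `P = S₁₂ S₂₂⁻¹` and let `R` be the Schur complement `S₁₁ - S₁₂ S₂₂⁻¹ S₂₁`. The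
right-hand side, transformed in `x₁` for fixed `(x₂, C)` with `M = X^{1/2} C X^{1/2}`, becomes
`|1 + R T₁|^{-α} etr(-T₁ (1 + R T₁)⁻¹ P M Pᵀ)`. Since `e^{-t₂ · x₂} = etr(-T₂ M)`, what is left is
the integral of a Wishart density in `M` with parameter `S₂₂⁻¹ + T₂ + Pᵀ T₁ (1 + R T₁)⁻¹ P`
(`integral_corrWishart`, in the coordinates `x₂, C` of a positive definite matrix `M`). The outcome
is `|1 + S T|^{-α}` by block elimination (`det_one_add_mul_diagonal`). Uniqueness of Laplace
transforms of continuous functions (`eqOn_of_laplace_eq`) then gives the identity at every point,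
as the right-hand side is continuous in `x` (`continuousOn_mixture`).

Existence of the densities (`exists_gammaDensity_family`) asks for a continuous function with a
given transform, not for positivity, and it holds for every `α > 0`. Choose `l` so large that
`l - S⁻¹` has norm less than `l`. In the variables `uᵢ = 1/(l + tᵢ)` the transform is
`∏ uᵢ^α f(u)`, where `f` is holomorphic on a polydisc of radius `ρ > 1/l` (`gammaTransform_eq`).
Cauchy's formula writes `f(u)` as the average of `f(z) ∏ (1 - uᵢ/zᵢ)⁻¹` over the torus `|zᵢ| = ρ`,
and `u^α (1 - u/z)⁻¹` is the Laplace transform of `x^{α-1} e^{-l x} E(x/z)` with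
`E(z) = ∑ zⁿ/Γ(α + n)`. Averaging these functions against `f` gives the density
(`torusDensity_laplace`). The construction also yields joint continuity in `x` and the
non-centrality matrix `D`, and a bound `K(x) e^{κ ‖D‖}`. As `‖P M Pᵀ‖` grows at most linearly in
`x₂`, this bound makes the transform of the mixture converge absolutely for large `t₂`, and
equality of transforms on such a translated orthant is enough for uniqueness.

The Wishart integral (`lintegral_wishartWeight`) is computed by induction on the size: for a fixed
principal block, the Schur complement of the remaining diagonal entry is integrated against a gamma
density and the remaining column against a Gaussian. The passage to `(x, C)` is a diagonal linear
substitution for each fixed diagonal (`lintegral_wishartWeight_fiber`).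
-/

/-! ### Uniqueness of Laplace transforms on the orthant -/

theorem posOrthant_eq_pi (ι : Type*) :
    posOrthant ι = Set.pi Set.univ fun _ => Set.Ioi (0 : ℝ) := by
  ext x
  simp [posOrthant]

theorem isOpen_posOrthant {ι : Type*} [Finite ι] : IsOpen (posOrthant ι) := by
  rw [posOrthant_eq_pi]
  exact isOpen_set_pi Set.finite_univ fun _ _ => isOpen_Ioi

/-- The bounded function `x ↦ exp (-∑ tᵢ xᵢ)` on the open orthant, for `t ≥ 0`, as a monoid
homomorphism in `t`. -/
noncomputable def expNegHom (ι : Type*) [Fintype ι] :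
    Multiplicative (ι → NNReal) →* BoundedContinuousFunction (posOrthant ι) ℝ where
  toFun t := BoundedContinuousFunction.ofNormedAddCommGroup
    (fun x => Real.exp (-∑ i, (t.toAdd i : ℝ) * x.1 i))
    (Real.continuous_exp.comp (continuous_finsetSum _ fun i _ => continuous_const.mul
      ((continuous_apply i).comp continuous_subtype_val)).neg) 1 (by
      intro x
      rw [Real.norm_eq_abs, Real.abs_exp, Real.exp_le_one_iff, neg_nonpos]
      exact Finset.sum_nonneg fun i _ => mul_nonneg (t.toAdd i).2 (x.2 i).le)
  map_one' := by
    ext x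
    change Real.exp _ = 1
    simp
  map_mul' s t := by
    ext x
    change Real.exp _ = Real.exp _ * Real.exp _
    rw [← Real.exp_add, ← neg_add, ← Finset.sum_add_distrib]
    congr 2
    refine Finset.sum_congr rfl fun i _ => ?_
    rw [toAdd_mul, Pi.add_apply, NNReal.coe_add, add_mul]

theorem expNegHom_apply {ι : Type*} [Fintype ι] (t : Multiplicative (ι → NNReal))
    (x : posOrthant ι) :
    expNegHom ι t x = Real.exp (-∑ i, (t.toAdd i : ℝ) * x.1 i) := rfl

/-- A finite measure on the orthant is determined by its Laplace transform: the functions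
`x ↦ exp (-t · x)` span an algebra that separates points. -/
theorem measure_posOrthant_ext {ι : Type*} [Fintype ι] {P Q : Measure (posOrthant ι)}
    [IsFiniteMeasure P] [IsFiniteMeasure Q]
    (h : ∀ t : ι → ℝ, (∀ i, 0 ≤ t i) →
      ∫ x, Real.exp (-∑ i, t i * x.1 i) ∂P = ∫ x, Real.exp (-∑ i, t i * x.1 i) ∂Q) :
    P = Q := by
  have : PolishSpace (posOrthant ι) := isOpen_posOrthant.polishSpace
  let A : StarSubalgebra ℝ (BoundedContinuousFunction (posOrthant ι) ℝ) :=
    { Algebra.adjoin ℝ (Set.range (expNegHom ι)) with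
      star_mem' := by
        intro a ha
        have : star a = a := by ext x; simp
        rwa [this] }
  refine ext_of_forall_mem_subalgebra_integral_eq_of_polish (A := A) ?_ ?_
  · intro x y hxy
    obtain ⟨i, hi⟩ := Function.ne_iff.1 fun h => hxy (Subtype.ext h)
    classical
    let t : ι → NNReal := Pi.single i 1
    refine ⟨expNegHom ι (Multiplicative.ofAdd t), ⟨_, ⟨expNegHom ι (Multiplicative.ofAdd t),
      Algebra.subset_adjoin ⟨_, rfl⟩, rfl⟩, rfl⟩, ?_⟩
    have key : ∀ z : posOrthant ι, ∑ j, (t j : ℝ) * z.1 j = z.1 i := by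
      intro z
      rw [Finset.sum_eq_single i]
      · simp [t]
      · intro j _ hj; simp [t, hj]
      · simp
    simpa [expNegHom_apply, key] using hi
  · intro g hg
    have hg' : g ∈ Subalgebra.toSubmodule (Algebra.adjoin ℝ (Set.range (expNegHom ι))) := hg
    clear hg
    rw [Algebra.adjoin_eq_span, ← MonoidHom.coe_mrange, Submonoid.closure_eq] at hg'
    induction hg' using Submodule.span_induction with
    | mem x hx =>
      obtain ⟨t, rfl⟩ := hx
      simpa [expNegHom_apply] using h (fun i => t.toAdd i) fun i => (t.toAdd i).2
    | zero => simp
    | add x y _ _ hx hy =>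
      simp only [BoundedContinuousFunction.coe_add, Pi.add_apply]
      rw [integral_add (x.integrable _) (y.integrable _),
        integral_add (x.integrable _) (y.integrable _), hx, hy]
    | smul a x _ hx =>
      simp only [BoundedContinuousFunction.coe_smul, integral_smul]
      rw [hx]

/-- Uniqueness of Laplace transforms for continuous, possibly signed, functions on the orthant. The
transforms need to agree only on a translate `t ≥ t₀` of the closed orthant. -/
theorem eqOn_of_laplace_eq {ι : Type*} [Fintype ι] {f g : (ι → ℝ) → ℝ}
    (hf : ContinuousOn f (posOrthant ι)) (hg : ContinuousOn g (posOrthant ι)) (t₀ : ι → ℝ)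
    (hfi : ∀ t : ι → ℝ, (∀ i, t₀ i ≤ t i) →
      IntegrableOn (fun x => Real.exp (-∑ i, t i * x i) * f x) (posOrthant ι))
    (hgi : ∀ t : ι → ℝ, (∀ i, t₀ i ≤ t i) →
      IntegrableOn (fun x => Real.exp (-∑ i, t i * x i) * g x) (posOrthant ι))
    (h : ∀ t : ι → ℝ, (∀ i, t₀ i ≤ t i) →
      ∫ x in posOrthant ι, Real.exp (-∑ i, t i * x i) * f x =
        ∫ x in posOrthant ι, Real.exp (-∑ i, t i * x i) * g x) :
    Set.EqOn f g (posOrthant ι) := by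
  have hO : IsOpen (posOrthant ι) := isOpen_posOrthant
  let μ : Measure (posOrthant ι) := Measure.comap Subtype.val volume
  have : μ.IsOpenPosMeasure := by
    refine ⟨fun U hU hne => ?_⟩
    rw [(MeasurableEmbedding.subtype_coe hO.measurableSet).comap_apply]
    exact (hO.isOpenMap_subtype_val U hU).measure_ne_zero volume (hne.image _)
  -- The positive and negative parts of the integrable function `w` define finite measures with the
  -- same Laplace transform.
  let w : posOrthant ι → ℝ := fun x => Real.exp (-∑ i, t₀ i * x.1 i) * (f x.1 - g x.1)
  have hwc : Continuous w := by
    refine Continuous.mul ?_ ?_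
    · exact (Real.continuous_exp.comp (continuous_finsetSum _ fun i _ => continuous_const.mul
        ((continuous_apply i).comp continuous_subtype_val)).neg)
    · exact (continuousOn_iff_continuous_domRestrict.1 hf).sub
        (continuousOn_iff_continuous_domRestrict.1 hg)
  have hwi : Integrable w μ := by
    have h1 := ((hfi t₀ fun _ => le_rfl).sub (hgi t₀ fun _ => le_rfl))
    rw [integrableOn_iff_comap_subtypeVal hO.measurableSet] at h1
    refine h1.congr (Filter.Eventually.of_forall fun x => ?_)
    simp [w, mul_sub]
  have hfin : ∀ v : posOrthant ι → ℝ, Integrable v μ →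
      IsFiniteMeasure (μ.withDensity fun x => ENNReal.ofReal (v x)) := fun v hv =>
    isFiniteMeasure_withDensity_ofReal hv.2
  have := hfin w hwi
  have := hfin (-w) hwi.neg
  have hzero : ∀ t : ι → ℝ, (∀ i, 0 ≤ t i) →
      ∫ x, Real.exp (-∑ i, t i * x.1 i) * w x ∂μ = 0 := by
    intro t ht
    have ht' : ∀ i, t₀ i ≤ (t + t₀) i := fun i => by simp [ht i]
    have h1 := sub_eq_zero.2 (h (t + t₀) ht')
    rw [← integral_sub (hfi _ ht') (hgi _ ht'),
      ← integral_subtype_comap hO.measurableSet] at h1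
    rw [← h1]
    refine integral_congr_ae (Filter.Eventually.of_forall fun x => ?_)
    simp only [w, Pi.add_apply, add_mul, Finset.sum_add_distrib, neg_add, Real.exp_add]
    ring
  have hPQ : (μ.withDensity fun x => ENNReal.ofReal (w x)) =
      μ.withDensity fun x => ENNReal.ofReal ((-w) x) := by
    refine measure_posOrthant_ext fun t ht => ?_
    have hmeas : ∀ v : posOrthant ι → ℝ, Continuous v →
        ∫ x, Real.exp (-∑ i, t i * x.1 i) ∂(μ.withDensity fun x => ENNReal.ofReal (v x)) =
          ∫ x, Real.exp (-∑ i, t i * x.1 i) * max (v x) 0 ∂μ := by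
      intro v hv
      rw [integral_withDensity_eq_integral_toReal_smul hv.measurable.ennreal_ofReal
        (Filter.Eventually.of_forall fun x => ENNReal.ofReal_lt_top)]
      refine integral_congr_ae (Filter.Eventually.of_forall fun x => ?_)
      simp [ENNReal.toReal_ofReal', mul_comm]
    have hint : ∀ v : posOrthant ι → ℝ, Integrable v μ →
        Integrable (fun x => Real.exp (-∑ i, t i * x.1 i) * v x) μ := by
      intro v hv
      refine hv.bdd_mul (c := 1) ?_ (Filter.Eventually.of_forall fun x => ?_)
      · exact (Real.continuous_exp.comp (continuous_finsetSum _ fun i _ => continuous_const.mul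
          ((continuous_apply i).comp continuous_subtype_val)).neg).aestronglyMeasurable
      · rw [Real.norm_eq_abs, Real.abs_exp, Real.exp_le_one_iff, neg_nonpos]
        exact Finset.sum_nonneg fun i _ => mul_nonneg (ht i) (x.2 i).le
    rw [hmeas w hwc, hmeas (-w) hwc.neg, ← sub_eq_zero,
      ← integral_sub (hint _ hwi.pos_part) (hint _ hwi.neg.pos_part)]
    refine (integral_congr_ae (Filter.Eventually.of_forall fun x => ?_)).trans (hzero t ht)
    simp only [Pi.neg_apply, ← mul_sub]
    rw [max_zero_sub_max_neg_zero_eq_self]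
  have hae := (withDensity_eq_iff hwc.measurable.ennreal_ofReal.aemeasurable
    hwc.neg.measurable.ennreal_ofReal.aemeasurable
    (hwi.lintegral_lt_top.ne)).1 hPQ
  have hw0 : w = 0 := by
    refine (hwc.ae_eq_iff_eq μ continuous_const).1 ?_
    filter_upwards [hae] with x hx
    rcases le_total 0 (w x) with h0 | h0
    · have : ENNReal.ofReal ((-w) x) = 0 := ENNReal.ofReal_eq_zero.2 (by simpa using h0)
      rw [this, ENNReal.ofReal_eq_zero] at hx
      exact le_antisymm hx h0
    · rw [ENNReal.ofReal_eq_zero.2 h0] at hx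
      exact le_antisymm h0 (neg_nonpos.1 (ENNReal.ofReal_eq_zero.1 hx.symm))
  intro x hx
  have := congrFun hw0 ⟨x, hx⟩
  simpa [w, sub_eq_zero] using this

/-! ### A Mittag-Leffler function and its Laplace transform -/

/-- The Mittag-Leffler function `E_{1,α}(z) = ∑ zⁿ / Γ(α + n)`. -/
noncomputable def mittagLeffler (α : ℝ) (z : ℂ) : ℂ :=
  ∑' n : ℕ, z ^ n / (Real.Gamma (α + n) : ℂ)

theorem factorial_mul_Gamma_le {α : ℝ} (hα : 0 < α) (n : ℕ) :
    (n.factorial : ℝ) * Real.Gamma (α + 1) ≤ Real.Gamma (α + (n + 1 : ℕ)) := by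
  induction n with
  | zero => simp
  | succ n ih =>
    have h1 : 0 < α + (n + 1 : ℕ) := by positivity
    have h2 : α + (n + 1 + 1 : ℕ) = (α + (n + 1 : ℕ)) + 1 := by push_cast; ring
    rw [h2, Real.Gamma_add_one h1.ne', Nat.factorial_succ]
    have h3 := Real.Gamma_pos_of_pos h1
    calc ((n + 1) * n.factorial : ℕ) * Real.Gamma (α + 1)
        = (n + 1 : ℕ) * (n.factorial * Real.Gamma (α + 1)) := by push_cast; ring
      _ ≤ (n + 1 : ℕ) * Real.Gamma (α + (n + 1 : ℕ)) := by gcongr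
      _ ≤ _ := by gcongr; linarith

theorem summable_pow_div_Gamma {α : ℝ} (hα : 0 < α) {r : ℝ} (hr : 0 ≤ r) :
    Summable fun n : ℕ => r ^ n / Real.Gamma (α + n) := by
  rw [← summable_nat_add_iff 1]
  refine Summable.of_nonneg_of_le (f := fun n : ℕ => r / Real.Gamma (α + 1) *
    (r ^ n / n.factorial)) (fun n => ?_) (fun n => ?_)
    ((Real.summable_pow_div_factorial r).mul_left _)
  · have : 0 < Real.Gamma (α + (n + 1 : ℕ)) := Real.Gamma_pos_of_pos (by positivity)
    positivity
  · have h1 : 0 < Real.Gamma (α + 1) := Real.Gamma_pos_of_pos (by positivity)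
    calc r ^ (n + 1) / Real.Gamma (α + (n + 1 : ℕ))
        ≤ r ^ (n + 1) / (n.factorial * Real.Gamma (α + 1)) := by
          gcongr
          exact factorial_mul_Gamma_le hα n
      _ = _ := by rw [pow_succ]; field_simp

theorem norm_pow_div_Gamma {α : ℝ} (hα : 0 < α) (z : ℂ) (n : ℕ) :
    ‖z ^ n / (Real.Gamma (α + n) : ℂ)‖ = ‖z‖ ^ n / Real.Gamma (α + n) := by
  have : 0 < Real.Gamma (α + n) := Real.Gamma_pos_of_pos (by positivity)
  rw [norm_div, norm_pow, Complex.norm_real, Real.norm_of_nonneg this.le]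

theorem continuous_mittagLeffler {α : ℝ} (hα : 0 < α) : Continuous (mittagLeffler α) := by
  rw [continuous_iff_continuousAt]
  intro z
  refine ContinuousOn.continuousAt (s := Metric.ball 0 (‖z‖ + 1)) ?_
    (Metric.isOpen_ball.mem_nhds (by simp))
  refine continuousOn_tsum (u := fun n : ℕ => (‖z‖ + 1) ^ n / Real.Gamma (α + n))
    (fun n => by fun_prop) (summable_pow_div_Gamma hα (by positivity)) fun n w hw => ?_
  rw [norm_pow_div_Gamma hα]
  have : 0 < Real.Gamma (α + n) := Real.Gamma_pos_of_pos (by positivity)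
  have : ‖w‖ ≤ ‖z‖ + 1 := by simpa using (Metric.mem_ball.1 hw).le
  gcongr

theorem norm_mittagLeffler_le {α : ℝ} (hα : 0 < α) (z : ℂ) :
    ‖mittagLeffler α z‖ ≤ (mittagLeffler α (‖z‖ : ℂ)).re := by
  have hs := summable_pow_div_Gamma hα (norm_nonneg z)
  have h1 : mittagLeffler α (‖z‖ : ℂ) =
      ((∑' n : ℕ, ‖z‖ ^ n / Real.Gamma (α + n) : ℝ) : ℂ) := by
    rw [mittagLeffler, Complex.ofReal_tsum]
    simp
  rw [h1, Complex.ofReal_re]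
  exact tsum_of_norm_bounded hs.hasSum fun n => (norm_pow_div_Gamma hα z n).le

theorem integrableOn_rpow_mul_exp {α : ℝ} (hα : 0 < α) {l : ℝ} (hl : 0 < l) (n : ℕ) :
    IntegrableOn (fun x : ℝ => x ^ (α + n - 1) * Real.exp (-(l * x))) (Set.Ioi 0) := by
  have h := integrableOn_rpow_mul_exp_neg_mul_rpow (p := 1) (s := α + n - 1) (b := l)
    (by have : (0 : ℝ) ≤ n := n.cast_nonneg
        linarith) one_pos hl
  simpa using h

/-- Integration of the series term by term: the function `x^(α-1) e^(-l x) E(x z)` has integral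
`l^(-α) ∑ (z/l)ⁿ`. -/
theorem mittagLeffler_laplace {α : ℝ} (hα : 0 < α) {l : ℝ} (hl : 0 < l) {z : ℂ} (hz : ‖z‖ < l) :
    IntegrableOn (fun x : ℝ => ((x ^ (α - 1) * Real.exp (-(l * x)) : ℝ) : ℂ) *
      mittagLeffler α (x * z)) (Set.Ioi 0) ∧
    ∫ x in Set.Ioi (0 : ℝ), ((x ^ (α - 1) * Real.exp (-(l * x)) : ℝ) : ℂ) *
      mittagLeffler α (x * z) = ((l ^ (-α) : ℝ) : ℂ) * (1 - z / l)⁻¹ := by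
  let F : ℕ → ℝ → ℂ := fun n x =>
    (z ^ n / (Real.Gamma (α + n) : ℂ)) * ((x ^ (α + n - 1) * Real.exp (-(l * x)) : ℝ) : ℂ)
  have hG : ∀ n : ℕ, 0 < Real.Gamma (α + n) := fun n => Real.Gamma_pos_of_pos (by positivity)
  have hFi : ∀ n, IntegrableOn (F n) (Set.Ioi 0) := fun n =>
    ((integrableOn_rpow_mul_exp hα hl n).ofReal).const_mul _
  have hI : ∀ n : ℕ, ∫ x in Set.Ioi (0 : ℝ), x ^ (α + n - 1) * Real.exp (-(l * x)) =
      l ^ (-α) * (l ^ n)⁻¹ * Real.Gamma (α + n) := by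
    intro n
    rw [Real.integral_rpow_mul_exp_neg_mul_Ioi (by positivity) hl, one_div,
      Real.rpow_add (by positivity), Real.rpow_natCast, Real.inv_rpow hl.le, Real.rpow_neg hl.le,
      inv_pow]
  have hint : ∀ n, ∫ x in Set.Ioi (0 : ℝ), F n x = ((l ^ (-α) : ℝ) : ℂ) * (z / l) ^ n := by
    intro n
    have hne : (Real.Gamma (α + n) : ℂ) ≠ 0 := by exact_mod_cast (hG n).ne'
    simp only [F]
    rw [integral_const_mul, integral_complex_ofReal, hI]
    push_cast
    rw [div_pow]
    field_simp
  have hnorm : ∀ n, ∫ x in Set.Ioi (0 : ℝ), ‖F n x‖ = l ^ (-α) * (‖z‖ / l) ^ n := by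
    intro n
    have : ∀ x ∈ Set.Ioi (0 : ℝ), ‖F n x‖ = (‖z‖ ^ n / Real.Gamma (α + n)) *
        (x ^ (α + n - 1) * Real.exp (-(l * x))) := by
      intro x hx
      have hx' : (0 : ℝ) < x := hx
      rw [norm_mul, norm_pow_div_Gamma hα, Complex.norm_real, Real.norm_of_nonneg (by positivity)]
    rw [setIntegral_congr_fun measurableSet_Ioi this, integral_const_mul, hI]
    have := hG n
    rw [div_pow]
    field_simp
  have hsum : Summable fun n => ∫ x in Set.Ioi (0 : ℝ), ‖F n x‖ := by
    simp_rw [hnorm]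
    exact (summable_geometric_of_lt_one (by positivity) ((div_lt_one hl).2 hz)).mul_left _
  have hF : ∀ x ∈ Set.Ioi (0 : ℝ), ((x ^ (α - 1) * Real.exp (-(l * x)) : ℝ) : ℂ) *
      mittagLeffler α (x * z) = ∑' n, F n x := by
    intro x hx
    have hx' : (0 : ℝ) < x := hx
    rw [mittagLeffler, ← tsum_mul_left]
    refine tsum_congr fun n => ?_
    simp only [F]
    rw [show α + n - 1 = α - 1 + n by ring, Real.rpow_add hx', Real.rpow_natCast]
    push_cast
    ring
  have hz' : ‖z / l‖ < 1 := by
    rw [norm_div, Complex.norm_real, Real.norm_of_nonneg hl.le]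
    exact (div_lt_one hl).2 hz
  have hval : ∫ x in Set.Ioi (0 : ℝ), ((x ^ (α - 1) * Real.exp (-(l * x)) : ℝ) : ℂ) *
      mittagLeffler α (x * z) = ((l ^ (-α) : ℝ) : ℂ) * (1 - z / l)⁻¹ := by
    rw [setIntegral_congr_fun measurableSet_Ioi hF,
      ← (hasSum_integral_of_summable_integral_norm hFi hsum).tsum_eq]
    simp_rw [hint]
    rw [tsum_mul_left, tsum_geometric_of_norm_lt_one hz']
  refine ⟨not_imp_comm.1 integral_undef ?_, hval⟩
  -- a nonzero Bochner integral belongs to an integrable function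
  rw [hval]
  refine mul_ne_zero (by exact_mod_cast (Real.rpow_pos_of_pos hl _).ne') (inv_ne_zero ?_)
  intro h0
  rw [← sub_eq_zero.1 h0] at hz'
  simp at hz'

/-! ### Cauchy's formula on a polydisc as a torus average -/

/-- The uniform probability measure on the angles `(0, 2π]`. -/
noncomputable def angleMeasure : Measure ℝ :=
  (ENNReal.ofReal (2 * Real.pi))⁻¹ • volume.restrict (Set.Ioc 0 (2 * Real.pi))

instance : IsProbabilityMeasure angleMeasure := by
  refine ⟨?_⟩
  have h := Real.two_pi_pos
  simp only [angleMeasure, Measure.smul_apply, Measure.restrict_apply_univ, Real.volume_Ioc,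
    sub_zero, smul_eq_mul]
  exact ENNReal.inv_mul_cancel (by simpa using h) ENNReal.ofReal_ne_top

theorem integral_angleMeasure (f : ℝ → ℂ) :
    ∫ θ, f θ ∂angleMeasure = (2 * Real.pi : ℂ)⁻¹ * ∫ θ in (0 : ℝ)..2 * Real.pi, f θ := by
  have h := Real.two_pi_pos
  rw [angleMeasure, integral_smul_measure, intervalIntegral.integral_of_le h.le,
    ENNReal.toReal_inv, ENNReal.toReal_ofReal h.le, Complex.real_smul]
  push_cast
  rfl

theorem ae_angleMeasure_mem {ι : Type*} [Fintype ι] :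
    ∀ᵐ θ ∂Measure.pi (fun _ : ι => angleMeasure),
      θ ∈ Set.pi Set.univ fun _ : ι => Set.Icc (0 : ℝ) (2 * Real.pi) := by
  simp only [Set.mem_univ_pi]
  refine Filter.eventually_all.2 fun i => ?_
  refine (Measure.tendsto_eval_ae_ae (μ := fun _ : ι => angleMeasure) (i := i)).eventually
    (p := fun x => x ∈ Set.Icc (0 : ℝ) (2 * Real.pi)) ?_
  refine Measure.ae_smul_measure ?_ _
  filter_upwards [ae_restrict_mem measurableSet_Ioc] with x hx using Set.Ioc_subset_Icc_self hx

theorem integrable_angleMeasure {ι : Type*} [Fintype ι] {f : (ι → ℝ) → ℂ} (hf : Continuous f) :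
    Integrable f (Measure.pi fun _ : ι => angleMeasure) := by
  obtain ⟨C, hC⟩ := (isCompact_univ_pi fun _ : ι => isCompact_Icc (a := (0 : ℝ))
    (b := 2 * Real.pi)).exists_bound_of_continuousOn hf.continuousOn
  exact Integrable.of_bound hf.aestronglyMeasurable C (ae_angleMeasure_mem.mono hC)

theorem one_sub_div_circleMap_ne_zero {ρ : ℝ} {u : ℂ} (hu : ‖u‖ < ρ) (θ : ℝ) :
    1 - u / circleMap 0 ρ θ ≠ 0 := by
  have hρ : 0 < ρ := (norm_nonneg u).trans_lt hu
  intro h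
  have h1 : ‖u / circleMap 0 ρ θ‖ = 1 := by rw [← sub_eq_zero.1 h]; simp
  rw [norm_div, norm_circleMap_zero, abs_of_pos hρ, div_eq_one_iff_eq hρ.ne'] at h1
  exact hu.ne h1

/-- Cauchy's integral formula on a disc, written as an average over angles. -/
theorem integral_cauchy_disc {ρ : ℝ} {f : ℂ → ℂ} (hc : ContinuousOn f (Metric.closedBall 0 ρ))
    (hd : DifferentiableOn ℂ f (Metric.ball 0 ρ)) {u : ℂ} (hu : ‖u‖ < ρ) :
    ∫ θ, f (circleMap 0 ρ θ) * (1 - u / circleMap 0 ρ θ)⁻¹ ∂angleMeasure = f u := by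
  have hρ : 0 < ρ := (norm_nonneg u).trans_lt hu
  have h := Complex.two_pi_I_inv_smul_circleIntegral_sub_inv_smul_of_differentiable_on_off_countable
    Set.countable_empty (c := 0) (w := u) (by simpa using hu) hc
    (fun x hx => hd.differentiableAt (Metric.isOpen_ball.mem_nhds hx.1))
  rw [integral_angleMeasure, ← h, circleIntegral]
  simp only [smul_eq_mul, mul_inv, mul_assoc]
  rw [← intervalIntegral.integral_const_mul Complex.I⁻¹]
  congr 2
  refine intervalIntegral.integral_congr fun θ _ => ?_
  have h0 : circleMap 0 ρ θ ≠ 0 := circleMap_ne_center hρ.ne'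
  have h1 := one_sub_div_circleMap_ne_zero hu θ
  have h2 : circleMap 0 ρ θ - u ≠ 0 := by
    intro h
    rw [sub_eq_zero.1 h] at h1 h0
    simp [h0] at h1
  simp only [deriv_circleMap]
  field_simp

/-- Induction on the number of variables, slicing off the first one. -/
theorem integral_cauchy_polydisc_fin {ρ : ℝ} (n : ℕ) {f : (Fin n → ℂ) → ℂ}
    (hc : ContinuousOn f {z | ∀ i, ‖z i‖ ≤ ρ})
    (hd : ∀ z : Fin n → ℂ, (∀ i, ‖z i‖ ≤ ρ) → ∀ i,
      DifferentiableOn ℂ (fun w => f (Function.update z i w)) (Metric.ball 0 ρ))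
    {u : Fin n → ℂ} (hu : ∀ i, ‖u i‖ < ρ) :
    ∫ θ : Fin n → ℝ, f (fun i => circleMap 0 ρ (θ i)) * ∏ i, (1 - u i / circleMap 0 ρ (θ i))⁻¹
      ∂(Measure.pi fun _ => angleMeasure) = f u := by
  induction n with
  | zero =>
    simp only [Finset.univ_eq_empty, Finset.prod_empty, mul_one]
    rw [integral_congr_ae (g := fun _ => f u)
      (Filter.Eventually.of_forall fun θ => congrArg f (Subsingleton.elim _ _))]
    simp
  | succ n ih =>
    have hρ : 0 < ρ := (norm_nonneg (u 0)).trans_lt (hu 0)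
    have hcirc : ∀ θ, ‖circleMap 0 ρ θ‖ ≤ ρ := fun θ => by
      rw [norm_circleMap_zero, abs_of_pos hρ]
    have hcontF : Continuous fun θ : Fin (n + 1) → ℝ => f (fun i => circleMap 0 ρ (θ i)) *
        ∏ i, (1 - u i / circleMap 0 ρ (θ i))⁻¹ := by
      refine Continuous.mul ?_ (continuous_finsetProd _ fun i _ => Continuous.inv₀ ?_ fun θ =>
        one_sub_div_circleMap_ne_zero (hu i) _)
      · refine hc.comp_continuous (continuous_pi fun i => (continuous_circleMap 0 ρ).comp
          (continuous_apply i)) fun θ i => hcirc _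
      · exact continuous_const.sub (continuous_const.div ((continuous_circleMap 0 ρ).comp
          (continuous_apply i)) fun θ => circleMap_ne_center hρ.ne')
    have hmp := (measurePreserving_piFinSuccAbove (fun _ : Fin (n + 1) => angleMeasure) 0).symm
    rw [← hmp.integral_comp', integral_prod]
    swap
    · exact (hmp.integrable_comp_emb (MeasurableEquiv.measurableEmbedding _)).2
        (integrable_angleMeasure hcontF)
    have hslice : ∀ w : ℂ, ‖w‖ ≤ ρ → ∀ z : Fin n → ℂ, (∀ i, ‖z i‖ ≤ ρ) →
        ∀ i, ‖(Fin.cons w z : Fin (n + 1) → ℂ) i‖ ≤ ρ := by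
      intro w hw z hz i
      refine Fin.cases ?_ (fun j => ?_) i
      · simpa using hw
      · simpa using hz j
    have hinner : ∀ θ : ℝ, ∫ y : Fin n → ℝ, f (fun i => circleMap 0 ρ ((Fin.cons θ y :
        Fin (n + 1) → ℝ) i)) * ∏ i, (1 - u i / circleMap 0 ρ ((Fin.cons θ y :
        Fin (n + 1) → ℝ) i))⁻¹ ∂(Measure.pi fun _ => angleMeasure) =
        f (Fin.cons (circleMap 0 ρ θ) (Fin.tail u)) * (1 - u 0 / circleMap 0 ρ θ)⁻¹ := by
      intro θ
      rw [← ih (f := fun z => f (Fin.cons (circleMap 0 ρ θ) z)) (u := Fin.tail u) ?_ ?_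
        fun i => hu i.succ, ← integral_mul_const]
      · refine integral_congr_ae (Filter.Eventually.of_forall fun y => ?_)
        have : (fun i => circleMap 0 ρ ((Fin.cons θ y : Fin (n + 1) → ℝ) i)) =
            Fin.cons (circleMap 0 ρ θ) fun i => circleMap 0 ρ (y i) := by
          funext i
          refine Fin.cases ?_ (fun j => ?_) i <;> simp
        simp only [this, Fin.prod_univ_succ, Fin.cons_zero, Fin.cons_succ, Fin.tail]
        ring
      · refine hc.comp (Continuous.continuousOn ?_) fun z hz => hslice _ (hcirc θ) z hz
        fun_prop
      · intro z hz i
        have := hd (Fin.cons (circleMap 0 ρ θ) z) (hslice _ (hcirc θ) z hz) i.succ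
        simpa [← Fin.cons_update] using this
    have hsymm : ∀ (a : ℝ) (y : Fin n → ℝ),
        (MeasurableEquiv.piFinSuccAbove (fun _ => ℝ) 0).symm (a, y) =
          (Fin.cons a y : Fin (n + 1) → ℝ) := fun a y => by
      simp only [MeasurableEquiv.piFinSuccAbove, Fin.insertNthEquiv_zero]
      rfl
    simp only [hsymm, hinner]
    have h1 := integral_cauchy_disc (ρ := ρ) (f := fun w => f (Fin.cons w (Fin.tail u)))
      (hc.comp (Continuous.continuousOn (by fun_prop)) fun w hw =>
        hslice w (by simpa using hw) _ fun i => (hu i.succ).le) (by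
          have := hd u (fun i => (hu i).le) 0
          have h2 : ∀ w, Function.update u 0 w = Fin.cons w (Fin.tail u) := by
            intro w
            conv_lhs => rw [← Fin.cons_self_tail u]
            rw [Fin.update_cons_zero]
          simpa only [h2] using this) (hu 0)
    rw [h1, Fin.cons_self_tail]

/-- Cauchy's integral formula on a polydisc, written as an average over the torus. -/
theorem integral_cauchy_polydisc {ι : Type*} [Fintype ι] [DecidableEq ι] {ρ : ℝ}
    {f : (ι → ℂ) → ℂ}
    (hc : ContinuousOn f {z | ∀ i, ‖z i‖ ≤ ρ})
    (hd : ∀ z : ι → ℂ, (∀ i, ‖z i‖ ≤ ρ) → ∀ i,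
      DifferentiableOn ℂ (fun w => f (Function.update z i w)) (Metric.ball 0 ρ))
    {u : ι → ℂ} (hu : ∀ i, ‖u i‖ < ρ) :
    ∫ θ : ι → ℝ, f (fun i => circleMap 0 ρ (θ i)) * ∏ i, (1 - u i / circleMap 0 ρ (θ i))⁻¹
      ∂(Measure.pi fun _ => angleMeasure) = f u := by
  let e := (Fintype.equivFin ι)
  have hmp := measurePreserving_piCongrLeft (fun _ : ι => angleMeasure) e.symm
  rw [← hmp.integral_comp']
  have h := integral_cauchy_polydisc_fin (ρ := ρ) (Fintype.card ι)
    (f := fun z => f (fun i => z (e i))) (u := fun j => u (e.symm j))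
    (hc.comp (Continuous.continuousOn (by fun_prop)) fun z hz i => hz _) ?_ fun i => hu _
  · simp only [Equiv.symm_apply_apply] at h
    rw [← h]
    refine integral_congr_ae (Filter.Eventually.of_forall fun θ => ?_)
    have key : ∀ i, (MeasurableEquiv.piCongrLeft (fun _ : ι => ℝ) e.symm) θ i = θ (e i) := by
      intro i
      have := MeasurableEquiv.piCongrLeft_apply_apply e.symm (β := fun _ => ℝ) θ (e i)
      simpa using this
    simp only [key]
    congr 1
    exact Fintype.prod_equiv e _ _ fun i => by simp
  · intro z hz j
    have := hd (fun i => z (e i)) (fun i => hz _) (e.symm j)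
    have h2 : ∀ w, (fun i => Function.update z j w (e i)) =
        Function.update (fun i => z (e i)) (e.symm j) w := by
      intro w
      funext i
      by_cases hi : e i = j
      · have : i = e.symm j := by rw [← hi]; simp
        subst this
        simp
      · have : i ≠ e.symm j := fun h => hi (by rw [h]; simp)
        rw [Function.update_of_ne hi, Function.update_of_ne this]
    simpa only [h2] using this

/-! ### Eigenvalues and the logarithm of a determinant -/

section
open scoped Matrix.Norms.L2Operator

variable {ι : Type*} [Fintype ι] [DecidableEq ι]

theorem exists_orthogonal_diagonalization {M : Matrix ι ι ℝ} (hM : M.IsHermitian) :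
    ∃ (V : Matrix ι ι ℝ) (d : ι → ℝ), Vᵀ * V = 1 ∧ M = V * diagonal d * Vᵀ ∧
      d = hM.eigenvalues := by
  refine ⟨hM.eigenvectorUnitary, hM.eigenvalues, ?_, ?_, rfl⟩
  · have := (Matrix.mem_unitaryGroup_iff').1 hM.eigenvectorUnitary.2
    rwa [star_eq_conjTranspose, conjTranspose_eq_transpose_of_trivial] at this
  · have := hM.spectral_theorem
    rw [Unitary.conjStarAlgAut_apply, star_eq_conjTranspose,
      conjTranspose_eq_transpose_of_trivial] at this
    exact this

omit [DecidableEq ι] in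
theorem map_ofReal_mul (A B : Matrix ι ι ℝ) :
    (A * B).map Complex.ofReal = A.map Complex.ofReal * B.map Complex.ofReal :=
  Matrix.map_mul (f := Complex.ofRealHom)

omit [Fintype ι] [DecidableEq ι] in
theorem conjTranspose_map_ofReal (V : Matrix ι ι ℝ) :
    (V.map Complex.ofReal)ᴴ = Vᵀ.map Complex.ofReal := by
  ext i j
  simp

/-- The complexification of a real symmetric matrix has the largest absolute eigenvalue as its
operator norm. -/
theorem norm_map_ofReal_diagonalization {V : Matrix ι ι ℝ} (hV : Vᵀ * V = 1) (d : ι → ℝ) :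
    ‖(V * diagonal d * Vᵀ).map Complex.ofReal‖ = ‖fun i => (d i : ℂ)‖ := by
  have hVV : (V.map Complex.ofReal) ∈ unitary (Matrix ι ι ℂ) := by
    refine (Matrix.mem_unitaryGroup_iff' (A := V.map Complex.ofReal)).2 ?_
    rw [star_eq_conjTranspose, conjTranspose_map_ofReal]
    have := congrArg (Complex.ofRealHom.mapMatrix) hV
    rwa [map_mul, map_one] at this
  have h1 : (V * diagonal d * Vᵀ).map Complex.ofReal =
      (V.map Complex.ofReal) * diagonal (fun i => (d i : ℂ)) * star (V.map Complex.ofReal) := by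
    rw [map_ofReal_mul, map_ofReal_mul, diagonal_map Complex.ofReal_zero, star_eq_conjTranspose,
      conjTranspose_map_ofReal]
  rw [h1, CStarRing.norm_mul_mem_unitary _ (Unitary.star_mem hVV),
    CStarRing.norm_mem_unitary_mul _ hVV, l2_opNorm_diagonal]

theorem trace_pow_diagonalization {V : Matrix ι ι ℝ} (hV : Vᵀ * V = 1) (d : ι → ℝ) (k : ℕ) :
    ((V * diagonal d * Vᵀ) ^ k).trace = ∑ i, d i ^ k := by
  have : (V * diagonal d * Vᵀ) ^ k = V * diagonal (d ^ k) * Vᵀ := by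
    induction k with
    | zero => simp [mul_eq_one_comm.1 hV]
    | succ k ih =>
      rw [pow_succ, ih]
      calc V * diagonal (d ^ k) * Vᵀ * (V * diagonal d * Vᵀ)
          = V * diagonal (d ^ k) * (Vᵀ * V) * diagonal d * Vᵀ := by simp only [Matrix.mul_assoc]
        _ = _ := by rw [hV, Matrix.mul_one, Matrix.mul_assoc V, diagonal_mul_diagonal']; rfl
  rw [this, Matrix.mul_assoc, trace_mul_comm, Matrix.mul_assoc, hV, Matrix.mul_one, trace_diagonal]
  rfl

theorem trace_mul_pow_comm (A B : Matrix ι ι ℝ) (k : ℕ) :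
    ((A * B) ^ k).trace = ((B * A) ^ k).trace := by
  cases k with
  | zero => simp
  | succ k =>
    have h : (A * B) ^ (k + 1) = A * (B * A) ^ k * B := by
      induction k with
      | zero => simp
      | succ k ih => rw [pow_succ, ih, pow_succ (B * A)]; simp only [Matrix.mul_assoc]
    rw [h, trace_mul_comm, ← Matrix.mul_assoc, ← pow_succ']

/-- The series `∑ tr(N^(k+1))/(k+1) = -log det (1 - N)` for `N = R diag(u)`. With
`R` symmetric and `u ≥ 0`, the matrix `N` shares traces of powers and `det (1 - ·)` with the
symmetric matrix `diag(√u) R diag(√u)`, so that the claim reduces to the scalar logarithm series at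
the eigenvalues. -/
theorem det_pos_and_hasSum_trace_pow {R : Matrix ι ι ℝ} (hR : R.IsHermitian) {u : ι → ℝ}
    (hu : ∀ i, 0 ≤ u i) {r : ℝ} (hr : 0 ≤ r) (hur : ∀ i, u i ≤ r)
    (h : ‖R.map Complex.ofReal‖ * r < 1) :
    0 < (1 - R * diagonal u).det ∧
    HasSum (fun k : ℕ => ((R * diagonal u) ^ (k + 1)).trace / (k + 1))
      (-Real.log (1 - R * diagonal u).det) := by
  let W : Matrix ι ι ℝ := diagonal fun i => √(u i)
  have hWW : W * W = diagonal u := by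
    simp only [W, diagonal_mul_diagonal, Real.mul_self_sqrt (hu _)]
  have hN : (W * (R * W)).IsHermitian := by
    have : Wᴴ = W := by
      ext i j
      simp [W, diagonal_apply, eq_comm]
      split_ifs with h1
      · rw [h1]
      · rfl
    rw [IsHermitian, conjTranspose_mul, conjTranspose_mul, this, hR.eq, Matrix.mul_assoc]
  obtain ⟨V, d, hV, hVd, -⟩ := exists_orthogonal_diagonalization hN
  have hWn : ‖W.map Complex.ofReal‖ ≤ √r := by
    have : W.map Complex.ofReal = diagonal fun i => ((√(u i) : ℝ) : ℂ) := by
      simp only [W]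
      rw [diagonal_map Complex.ofReal_zero]
    rw [this, l2_opNorm_diagonal, pi_norm_le_iff_of_nonneg (Real.sqrt_nonneg _)]
    intro i
    rw [Complex.norm_real, Real.norm_of_nonneg (Real.sqrt_nonneg _)]
    exact Real.sqrt_le_sqrt (hur i)
  have hdn : ∀ i, |d i| < 1 := by
    intro i
    have h1 := norm_map_ofReal_diagonalization hV d
    rw [← hVd] at h1
    have h2 : (W * (R * W)).map Complex.ofReal =
        W.map Complex.ofReal * (R.map Complex.ofReal * W.map Complex.ofReal) := by
      rw [map_ofReal_mul, map_ofReal_mul]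
    rw [h2] at h1
    calc |d i| = ‖(d i : ℂ)‖ := by simp
      _ ≤ ‖fun i => (d i : ℂ)‖ := norm_le_pi_norm (fun i => (d i : ℂ)) i
      _ ≤ ‖W.map Complex.ofReal‖ * (‖R.map Complex.ofReal‖ * ‖W.map Complex.ofReal‖) := by
        rw [← h1]
        exact (norm_mul_le _ _).trans (by gcongr; exact norm_mul_le _ _)
      _ ≤ √r * (‖R.map Complex.ofReal‖ * √r) := by gcongr
      _ = ‖R.map Complex.ofReal‖ * (√r * √r) := by ring
      _ < 1 := by rwa [Real.mul_self_sqrt hr]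
  have hdet : (1 - R * diagonal u).det = ∏ i, (1 - d i) := by
    have h3 : (1 : Matrix ι ι ℝ) - V * diagonal d * Vᵀ = V * diagonal (fun i => 1 - d i) * Vᵀ := by
      have : (diagonal fun i => 1 - d i : Matrix ι ι ℝ) = 1 - diagonal d := by
        rw [← diagonal_one, diagonal_sub]
      rw [this, Matrix.mul_sub, Matrix.sub_mul, Matrix.mul_one, mul_eq_one_comm.1 hV]
    rw [← hWW, ← Matrix.mul_assoc, det_one_sub_mul_comm, hVd, h3, det_mul, det_mul, mul_comm,
      ← mul_assoc, ← det_mul, hV, det_one, one_mul, det_diagonal]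
  have hpos : ∀ i, 0 < 1 - d i := fun i => by linarith [(abs_lt.1 (hdn i)).2]
  refine ⟨hdet ▸ Finset.prod_pos fun i _ => hpos i, ?_⟩
  rw [hdet, Real.log_prod fun i _ => (hpos i).ne', ← Finset.sum_neg_distrib]
  convert! hasSum_sum fun i (_ : i ∈ Finset.univ) =>
    Real.hasSum_pow_div_log_of_abs_lt_one (hdn i) using 2 with k
  rw [← hWW, ← Matrix.mul_assoc, trace_mul_pow_comm, hVd, trace_pow_diagonalization hV,
    Finset.sum_div]

/-- A large multiple of the identity dominates a positive definite matrix in such a way that the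
difference has smaller norm. -/
theorem exists_norm_smul_one_sub_lt {B : Matrix ι ι ℝ} (hB : B.PosDef) :
    ∃ l : ℝ, 0 < l ∧ ‖(l • (1 : Matrix ι ι ℝ) - B).map Complex.ofReal‖ < l := by
  obtain ⟨V, d, hV, hVd, hd⟩ := exists_orthogonal_diagonalization hB.1
  have hdpos : ∀ i, 0 < d i := fun i => hd ▸ hB.eigenvalues_pos i
  let l : ℝ := 1 + ∑ i, d i
  have hl : 0 < l := by
    have := Finset.sum_nonneg fun i (_ : i ∈ Finset.univ) => (hdpos i).le
    positivity
  have hdl : ∀ i, d i < l := fun i => by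
    have := Finset.single_le_sum (fun i _ => (hdpos i).le) (Finset.mem_univ i)
    simp only [l]
    linarith
  refine ⟨l, hl, ?_⟩
  have h1 : l • (1 : Matrix ι ι ℝ) - B = V * diagonal (fun i => l - d i) * Vᵀ := by
    have : (diagonal fun i => l - d i : Matrix ι ι ℝ) = l • 1 - diagonal d := by
      rw [smul_one_eq_diagonal, diagonal_sub]
    rw [this, Matrix.mul_sub, Matrix.sub_mul, Matrix.mul_smul, Matrix.smul_mul, Matrix.mul_one,
      mul_eq_one_comm.1 hV, ← hVd]
  rw [h1, norm_map_ofReal_diagonalization hV, pi_norm_lt_iff hl]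
  intro i
  rw [Complex.norm_real, Real.norm_of_nonneg (by linarith [hdl i])]
  linarith [hdpos i]
end

/-! ### Holomorphic extension of the transform -/

section
open scoped Matrix.Norms.L2Operator

variable {ι : Type*} [Fintype ι] [DecidableEq ι]

/-- The series `∑ tr((R U)^(k+1))/(k+1)` with `U = diag(u)`: a holomorphic branch of
`-log det (1 - R U)` on the polydisc `‖R‖ |uᵢ| < 1`. -/
noncomputable def negLogDet (R : Matrix ι ι ℂ) (u : ι → ℂ) : ℂ :=
  ∑' k : ℕ, ((R * diagonal u) ^ (k + 1)).trace / (k + 1)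

theorem norm_mul_diagonal_le {R : Matrix ι ι ℂ} {ρ : ℝ} (hρ : 0 ≤ ρ) {u : ι → ℂ}
    (hu : ∀ i, ‖u i‖ ≤ ρ) : ‖R * diagonal u‖ ≤ ‖R‖ * ρ := by
  refine (norm_mul_le _ _).trans ?_
  rw [l2_opNorm_diagonal]
  gcongr
  exact (pi_norm_le_iff_of_nonneg hρ).2 hu

theorem exists_norm_trace_le : ∃ C : ℝ, ∀ A : Matrix ι ι ℂ, ‖A.trace‖ ≤ C * ‖A‖ := by
  let T := LinearMap.toContinuousLinearMap (Matrix.traceLinearMap ι ℂ ℂ)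
  exact ⟨‖T‖, fun A => T.le_opNorm A⟩

theorem exists_summable_bound_trace_pow {R : Matrix ι ι ℂ} {ρ : ℝ} (hρ : 0 ≤ ρ)
    (h : ‖R‖ * ρ < 1) :
    ∃ b : ℕ → ℝ, Summable b ∧ ∀ (k : ℕ) (u : ι → ℂ), (∀ i, ‖u i‖ ≤ ρ) →
      ‖((R * diagonal u) ^ (k + 1)).trace / (k + 1)‖ ≤ b k := by
  obtain ⟨C, hC⟩ := exists_norm_trace_le (ι := ι)
  have h0 : 0 ≤ ‖R‖ * ρ := by positivity
  refine ⟨fun k => |C| * (‖R‖ * ρ) ^ (k + 1), ?_, fun k u hu => ?_⟩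
  · exact ((summable_nat_add_iff 1).2 (summable_geometric_of_lt_one h0 h)).mul_left _
  · have hk : (1 : ℝ) ≤ ‖(k + 1 : ℂ)‖ := by
      have : ‖(k + 1 : ℂ)‖ = k + 1 := by
        rw [← Nat.cast_add_one, Complex.norm_natCast, Nat.cast_add_one]
      rw [this]
      linarith [Nat.cast_nonneg (α := ℝ) k]
    rw [norm_div]
    calc _ ≤ ‖((R * diagonal u) ^ (k + 1)).trace‖ / 1 := by gcongr
      _ ≤ |C| * ‖(R * diagonal u) ^ (k + 1)‖ := by
        rw [div_one]
        exact (hC _).trans (by gcongr; exact le_abs_self C)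
      _ ≤ |C| * (‖R‖ * ρ) ^ (k + 1) := by
        gcongr
        exact (norm_pow_le' _ k.succ_pos).trans (by gcongr; exact norm_mul_diagonal_le hρ hu)

theorem continuous_mul_diagonal (R : Matrix ι ι ℂ) :
    Continuous fun u : ι → ℂ => R * diagonal u := by
  fun_prop

theorem differentiable_mul_diagonal_update (R : Matrix ι ι ℂ) (z : ι → ℂ) (i : ι) :
    Differentiable ℂ fun w : ℂ => R * diagonal (Function.update z i w) := by
  let T : (ι → ℂ) →L[ℂ] Matrix ι ι ℂ := LinearMap.toContinuousLinearMap
    ((LinearMap.mulLeft ℂ R).comp (Matrix.diagonalLinearMap ι ℂ ℂ))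
  exact T.differentiable.comp (hasDerivAt_update z i · |>.differentiableAt)

omit [DecidableEq ι] in
theorem differentiable_trace : Differentiable ℂ (Matrix.trace : Matrix ι ι ℂ → ℂ) :=
  (LinearMap.toContinuousLinearMap (Matrix.traceLinearMap ι ℂ ℂ)).differentiable

omit [Fintype ι] in
theorem norm_update_le {ρ : ℝ} {z : ι → ℂ} (hz : ∀ i, ‖z i‖ ≤ ρ) (i : ι) {w : ℂ}
    (hw : w ∈ Metric.ball (0 : ℂ) ρ) (j : ι) : ‖Function.update z i w j‖ ≤ ρ := by
  by_cases h : j = i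
  · subst h
    simpa using (mem_ball_zero_iff.1 hw).le
  · simpa [h] using hz j

theorem continuousOn_negLogDet {R : Matrix ι ι ℂ} {ρ : ℝ} (hρ : 0 ≤ ρ) (h : ‖R‖ * ρ < 1) :
    ContinuousOn (negLogDet R) {z | ∀ i, ‖z i‖ ≤ ρ} := by
  obtain ⟨b, hb, hbound⟩ := exists_summable_bound_trace_pow hρ h
  refine continuousOn_tsum (fun k => Continuous.continuousOn ?_) hb fun k u hu => hbound k u hu
  exact (((continuous_mul_diagonal R).pow _).matrix_trace).div_const _

theorem differentiableOn_negLogDet {R : Matrix ι ι ℂ} {ρ : ℝ} (hρ : 0 ≤ ρ) (h : ‖R‖ * ρ < 1)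
    {z : ι → ℂ} (hz : ∀ i, ‖z i‖ ≤ ρ) (i : ι) :
    DifferentiableOn ℂ (fun w => negLogDet R (Function.update z i w)) (Metric.ball 0 ρ) := by
  obtain ⟨b, hb, hbound⟩ := exists_summable_bound_trace_pow hρ h
  refine Complex.differentiableOn_tsum_of_summable_norm hb
    (fun k => Differentiable.differentiableOn ?_) Metric.isOpen_ball
    fun k w hw => hbound k _ (norm_update_le hz i hw)
  exact (differentiable_trace.comp ((differentiable_mul_diagonal_update R z i).pow _)).div_const _

theorem isUnit_one_sub_mul_diagonal {R : Matrix ι ι ℂ} {ρ : ℝ} (hρ : 0 ≤ ρ) (h : ‖R‖ * ρ < 1)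
    {u : ι → ℂ} (hu : ∀ i, ‖u i‖ ≤ ρ) : IsUnit (1 - R * diagonal u) :=
  isUnit_one_sub_of_norm_lt_one ((norm_mul_diagonal_le hρ hu).trans_lt h)

/-- `B U (1 - R U)⁻¹ B - B` with `U = diag(u)`, the matrix pairing with the non-centrality
parameter in the exponent of the transform. -/
noncomputable def noncentralityKernel (B R : Matrix ι ι ℂ) (u : ι → ℂ) : Matrix ι ι ℂ :=
  B * diagonal u * (1 - R * diagonal u)⁻¹ * B - B

theorem continuousOn_noncentralityKernel (B : Matrix ι ι ℂ) {R : Matrix ι ι ℂ} {ρ : ℝ}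
    (hρ : 0 ≤ ρ) (h : ‖R‖ * ρ < 1) :
    ContinuousOn (noncentralityKernel B R) {z | ∀ i, ‖z i‖ ≤ ρ} := by
  unfold noncentralityKernel
  refine ContinuousOn.sub (ContinuousOn.mul (ContinuousOn.mul
    (continuous_mul_diagonal B).continuousOn ?_) continuousOn_const) continuousOn_const
  simp_rw [nonsing_inv_eq_ringInverse]
  intro u hu
  have h1 := (differentiableAt_inverse (𝕜 := ℂ)
    (isUnit_one_sub_mul_diagonal hρ h hu)).continuousAt
  have h2 : Continuous fun u : ι → ℂ => 1 - R * diagonal u :=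
    continuous_const.sub (continuous_mul_diagonal R)
  exact (ContinuousAt.comp (f := fun u : ι → ℂ => 1 - R * diagonal u) h1
    h2.continuousAt).continuousWithinAt

theorem differentiableOn_noncentralityKernel (B : Matrix ι ι ℂ) {R : Matrix ι ι ℂ} {ρ : ℝ}
    (hρ : 0 ≤ ρ) (h : ‖R‖ * ρ < 1) {z : ι → ℂ} (hz : ∀ i, ‖z i‖ ≤ ρ) (i : ι) :
    DifferentiableOn ℂ (fun w => noncentralityKernel B R (Function.update z i w))
      (Metric.ball 0 ρ) := by
  unfold noncentralityKernel
  refine DifferentiableOn.sub (DifferentiableOn.mul (DifferentiableOn.mul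
    (differentiable_mul_diagonal_update B z i).differentiableOn ?_)
    (differentiableOn_const _)) (differentiableOn_const _)
  simp_rw [nonsing_inv_eq_ringInverse]
  exact DifferentiableOn.inverse ((differentiableOn_const _).sub
    (differentiable_mul_diagonal_update R z i).differentiableOn)
    fun w hw => isUnit_one_sub_mul_diagonal hρ h (norm_update_le hz i hw)

omit [Fintype ι] in
theorem map_ofReal_diagonal (u : ι → ℝ) :
    (diagonal u).map Complex.ofReal = diagonal fun i => (u i : ℂ) :=
  diagonal_map Complex.ofReal_zero

theorem map_ofReal_pow (A : Matrix ι ι ℝ) (k : ℕ) :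
    (A ^ k).map Complex.ofReal = (A.map Complex.ofReal) ^ k :=
  map_pow Complex.ofRealHom.mapMatrix A k

theorem map_ofReal_inv (A : Matrix ι ι ℝ) (hA : A.det ≠ 0) :
    (A⁻¹).map Complex.ofReal = (A.map Complex.ofReal)⁻¹ := by
  symm
  refine Matrix.inv_eq_left_inv ?_
  rw [← map_ofReal_mul, nonsing_inv_mul _ (isUnit_iff_ne_zero.2 hA)]
  exact map_one Complex.ofRealHom.mapMatrix

theorem map_ofReal_sub (A B : Matrix ι ι ℝ) :
    (A - B).map Complex.ofReal = A.map Complex.ofReal - B.map Complex.ofReal :=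
  map_sub Complex.ofRealHom.mapMatrix A B

theorem map_ofReal_one : (1 : Matrix ι ι ℝ).map Complex.ofReal = 1 :=
  map_one Complex.ofRealHom.mapMatrix

omit [DecidableEq ι] in
theorem trace_map_ofReal (A : Matrix ι ι ℝ) :
    (A.map Complex.ofReal).trace = (A.trace : ℂ) := by
  simp [trace]

/-- In the variables `uᵢ = 1/(l + tᵢ)` the transform is `∏ uᵢ^α` times a function that extends
holomorphically to the polydisc `‖l - S⁻¹‖ |uᵢ| < 1`. With `R = l - S⁻¹` and `U = diag(u)`, this is
`S⁻¹ + T = (1 - R U) U⁻¹`, whence `|1 + S T| = |S| |1 - R U| |U|⁻¹`. -/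
theorem gammaTransform_eq {S : Matrix ι ι ℝ} (hS : S.PosDef) (α : ℝ) (D : Matrix ι ι ℝ)
    {l : ℝ} (hl : 0 < l) (hR : ‖(l • (1 : Matrix ι ι ℝ) - S⁻¹).map Complex.ofReal‖ < l)
    {t : ι → ℝ} (ht : ∀ i, 0 ≤ t i) :
    ((gammaTransform α S D t : ℝ) : ℂ) = ((∏ i, (l + t i) ^ (-α) : ℝ) : ℂ) *
      Complex.exp (-(α * Real.log S.det : ℝ) +
        α * negLogDet ((l • (1 : Matrix ι ι ℝ) - S⁻¹).map Complex.ofReal)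
          (fun i => ((l + t i)⁻¹ : ℝ)) +
        (noncentralityKernel (S⁻¹.map Complex.ofReal)
          ((l • (1 : Matrix ι ι ℝ) - S⁻¹).map Complex.ofReal)
          (fun i => ((l + t i)⁻¹ : ℝ)) * D.map Complex.ofReal).trace) := by
  set B := S⁻¹ with hB
  set R := l • (1 : Matrix ι ι ℝ) - B with hRdef
  have hlt : ∀ i, 0 < l + t i := fun i => by linarith [ht i]
  set u : ι → ℝ := fun i => (l + t i)⁻¹ with hu
  have hSu : IsUnit S.det := isUnit_iff_ne_zero.2 hS.det_pos.ne'
  have hRh : R.IsHermitian := by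
    refine IsHermitian.sub ?_ hS.inv.1
    rw [IsHermitian, conjTranspose_smul, conjTranspose_one]
    rfl
  obtain ⟨hdet, hsum⟩ := det_pos_and_hasSum_trace_pow hRh (u := u) (r := l⁻¹)
    (fun i => (inv_pos.2 (hlt i)).le) (inv_pos.2 hl).le
    (fun i => inv_anti₀ hl (by linarith [ht i])) (by
      rw [← div_eq_mul_inv]; exact (div_lt_one hl).2 hR)
  set N := 1 - R * diagonal u with hN
  have hudiag : diagonal u * diagonal (fun i => l + t i) = 1 := by
    rw [diagonal_mul_diagonal, ← diagonal_one]
    congr 1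
    funext i
    exact inv_mul_cancel₀ (hlt i).ne'
  -- `S⁻¹ + T = (1 - R U) U⁻¹`
  have hBT : B + diagonal t = N * diagonal (fun i => l + t i) := by
    rw [hN, Matrix.sub_mul, Matrix.mul_assoc, hudiag, hRdef, Matrix.one_mul, Matrix.mul_one,
      smul_one_eq_diagonal, ← sub_eq_zero]
    have : (diagonal fun i => l + t i : Matrix ι ι ℝ) = diagonal (fun _ => l) + diagonal t := by
      rw [diagonal_add]
    rw [this]
    abel
  have hfac : 1 + S * diagonal t = S * (N * diagonal (fun i => l + t i)) := by
    rw [← hBT, Matrix.mul_add, hB, mul_nonsing_inv _ hSu]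
  have hdetfac : (1 + S * diagonal t).det = S.det * (N.det * ∏ i, (l + t i)) := by
    rw [hfac, det_mul, det_mul, det_diagonal]
  have hP : 0 < ∏ i, (l + t i) := Finset.prod_pos fun i _ => hlt i
  have hinv : (N * diagonal (fun i => l + t i))⁻¹ = diagonal u * N⁻¹ := by
    refine Matrix.inv_eq_left_inv ?_
    rw [Matrix.mul_assoc, ← Matrix.mul_assoc N⁻¹, nonsing_inv_mul _
      (isUnit_iff_ne_zero.2 hdet.ne'), Matrix.one_mul, hudiag]
  have hkernel : diagonal t * (1 + S * diagonal t)⁻¹ = B - B * diagonal u * N⁻¹ * B := by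
    have h1 : diagonal t = N * diagonal (fun i => l + t i) - B := by rw [← hBT]; abel
    rw [hfac, Matrix.mul_inv_rev, hinv, ← hB]
    conv_lhs => rw [h1]
    rw [Matrix.sub_mul, ← Matrix.mul_assoc (N * _), ← hinv, mul_nonsing_inv, Matrix.one_mul, hinv]
    · simp only [Matrix.mul_assoc]
    · rw [det_mul, det_diagonal]
      exact isUnit_iff_ne_zero.2 (mul_pos hdet hP).ne'
  have hq : (noncentralityKernel (B.map Complex.ofReal) (R.map Complex.ofReal)
      (fun i => ((u i : ℝ) : ℂ)) * D.map Complex.ofReal).trace =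
      ((-(diagonal t * (1 + S * diagonal t)⁻¹ * D).trace : ℝ) : ℂ) := by
    rw [noncentralityKernel, ← map_ofReal_diagonal, ← map_ofReal_mul, ← map_ofReal_one,
      ← map_ofReal_mul, ← map_ofReal_sub, ← hN, ← map_ofReal_inv _ hdet.ne', ← map_ofReal_mul,
      ← map_ofReal_mul, ← map_ofReal_sub, ← map_ofReal_mul, trace_map_ofReal, hkernel,
      ← trace_neg, ← Matrix.neg_mul, neg_sub]
  have hs : negLogDet (R.map Complex.ofReal) (fun i => ((u i : ℝ) : ℂ)) =
      ((-Real.log N.det : ℝ) : ℂ) := by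
    rw [← hsum.tsum_eq, Complex.ofReal_tsum, negLogDet]
    refine tsum_congr fun k => ?_
    rw [← map_ofReal_diagonal, ← map_ofReal_mul, ← map_ofReal_pow, trace_map_ofReal]
    push_cast
    rfl
  rw [hq, hs, gammaTransform, hdetfac, Real.mul_rpow hS.det_pos.le (mul_pos hdet hP).le,
    Real.mul_rpow hdet.le hP.le, Real.finsetProd_rpow _ _ fun i _ => (hlt i).le,
    Real.rpow_def_of_pos hS.det_pos, Real.rpow_def_of_pos hdet]
  norm_cast
  rw [Real.exp_add, Real.exp_add]
  ring_nf

end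

/-! ### Densities as torus averages -/

section
variable {ι : Type*} [Fintype ι]

theorem volume_restrict_posOrthant : (volume : Measure (ι → ℝ)).restrict (posOrthant ι) =
    Measure.pi fun _ => volume.restrict (Set.Ioi 0) := by
  rw [posOrthant_eq_pi, volume_pi, Measure.restrict_pi_pi]

/-- The function with Laplace transform `∏ (l + tᵢ)^(-α) f((l + t)⁻¹)` for `f` holomorphic on a
polydisc of radius `ρ > 1/l`: the torus average that Cauchy's formula yields when each factor
`(1 - u / z)⁻¹` is replaced by the Mittag-Leffler function whose transform it is. -/
noncomputable def torusDensity (α l ρ : ℝ) (f : (ι → ℂ) → ℂ) (x : ι → ℝ) : ℝ :=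
  (∏ i, x i ^ (α - 1) * Real.exp (-(l * x i))) *
    (∫ θ : ι → ℝ, f (fun i => circleMap 0 ρ (θ i)) *
      ∏ i, mittagLeffler α (x i / circleMap 0 ρ (θ i)) ∂(Measure.pi fun _ => angleMeasure)).re

/-- The common one-dimensional majorant of the factors of `torusDensity`. -/
noncomputable def majorant (α l ρ : ℝ) (y : ℝ) : ℝ :=
  y ^ (α - 1) * Real.exp (-(l * y)) * (mittagLeffler α ((y / ρ : ℝ) : ℂ)).re

theorem continuousOn_rpow_mul_exp (α l : ℝ) :
    ContinuousOn (fun y : ℝ => y ^ (α - 1) * Real.exp (-(l * y))) (Set.Ioi 0) :=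
  (continuousOn_id.rpow_const fun y hy => Or.inl (ne_of_gt hy)).mul (by fun_prop)

theorem norm_kernel_le_majorant {α : ℝ} (hα : 0 < α) {l l' ρ y : ℝ} (hl : l ≤ l')
    (hy : 0 < y) {z : ℂ} (hz : ‖z‖ = ρ) :
    ‖((y ^ (α - 1) * Real.exp (-(l' * y)) : ℝ) : ℂ) * mittagLeffler α (y / z)‖ ≤
      majorant α l ρ y := by
  rw [norm_mul, Complex.norm_real, Real.norm_of_nonneg (by positivity), majorant]
  have h := norm_mittagLeffler_le hα (y / z)
  have h2 : ‖(y / z : ℂ)‖ = y / ρ := by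
    rw [norm_div, hz, Complex.norm_real, Real.norm_of_nonneg hy.le]
  rw [h2] at h
  gcongr

theorem integrableOn_majorant {α : ℝ} (hα : 0 < α) {l ρ : ℝ} (hl : 0 < l) (hρ : l⁻¹ < ρ) :
    IntegrableOn (majorant α l ρ) (Set.Ioi 0) := by
  have hρ0 : 0 < ρ := (inv_pos.2 hl).trans hρ
  have h := (mittagLeffler_laplace hα hl (z := ((ρ⁻¹ : ℝ) : ℂ)) (by
    rw [Complex.norm_real, Real.norm_of_nonneg (inv_pos.2 hρ0).le]
    exact inv_lt_of_inv_lt₀ hl hρ)).1.re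
  refine h.congr (Filter.Eventually.of_forall fun y => ?_)
  simp only [majorant, RCLike.re_to_complex]
  rw [Complex.re_ofReal_mul, div_eq_mul_inv, Complex.ofReal_mul]

omit [Fintype ι] in
theorem continuous_circleMap_pi (ρ : ℝ) :
    Continuous fun θ : ι → ℝ => fun i => circleMap 0 ρ (θ i) :=
  continuous_pi fun i => (continuous_circleMap 0 ρ).comp (continuous_apply i)

theorem norm_circleMap_of_pos {ρ : ℝ} (hρ : 0 < ρ) (θ : ℝ) : ‖circleMap 0 ρ θ‖ = ρ := by
  rw [norm_circleMap_zero, abs_of_pos hρ]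

theorem continuous_prod_mittagLeffler {α : ℝ} (hα : 0 < α) {ρ : ℝ} (hρ : 0 < ρ) :
    Continuous fun p : (ι → ℝ) × (ι → ℝ) =>
      ∏ i, mittagLeffler α (p.1 i / circleMap 0 ρ (p.2 i)) := by
  refine continuous_finsetProd _ fun i _ => (continuous_mittagLeffler hα).comp ?_
  refine Continuous.div (by fun_prop) ((continuous_circleMap 0 ρ).comp (by fun_prop))
    fun p => circleMap_ne_center hρ.ne'

theorem abs_torusDensity_le {α l ρ : ℝ} (hα : 0 < α) (hρ : 0 < ρ) {f : (ι → ℂ) → ℂ} {M : ℝ}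
    (hM : ∀ z : ι → ℂ, (∀ i, ‖z i‖ ≤ ρ) → ‖f z‖ ≤ M) {x : ι → ℝ} (hx : x ∈ posOrthant ι) :
    |torusDensity α l ρ f x| ≤ M * ∏ i, majorant α l ρ (x i) := by
  have h1 : ‖∫ θ : ι → ℝ, f (fun i => circleMap 0 ρ (θ i)) *
      ∏ i, mittagLeffler α (x i / circleMap 0 ρ (θ i)) ∂(Measure.pi fun _ => angleMeasure)‖ ≤
      M * ∏ i, (mittagLeffler α ((x i / ρ : ℝ) : ℂ)).re := by
    refine (norm_integral_le_of_norm_le_const (C := M * ∏ i,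
      (mittagLeffler α ((x i / ρ : ℝ) : ℂ)).re) (Filter.Eventually.of_forall fun θ => ?_)).trans ?_
    · rw [norm_mul, norm_prod]
      have hM0 : 0 ≤ M := (norm_nonneg _).trans
        (hM (fun i => circleMap 0 ρ (θ i)) fun i => (norm_circleMap_of_pos hρ _).le)
      gcongr with i
      · exact hM _ fun i => (norm_circleMap_of_pos hρ _).le
      · have h2 : ‖(x i / circleMap 0 ρ (θ i) : ℂ)‖ = x i / ρ := by
          rw [norm_div, norm_circleMap_of_pos hρ, Complex.norm_real,
            Real.norm_of_nonneg (hx i).le]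
        have := norm_mittagLeffler_le hα (x i / circleMap 0 ρ (θ i))
        rwa [h2] at this
    · simp
  have h0 : 0 ≤ ∏ i, x i ^ (α - 1) * Real.exp (-(l * x i)) :=
    Finset.prod_nonneg fun i _ => mul_nonneg (Real.rpow_nonneg (hx i).le _) (Real.exp_pos _).le
  rw [torusDensity, abs_mul, abs_of_nonneg h0]
  calc _ ≤ (∏ i, x i ^ (α - 1) * Real.exp (-(l * x i))) *
        (M * ∏ i, (mittagLeffler α ((x i / ρ : ℝ) : ℂ)).re) := by
        gcongr
        exact (Complex.abs_re_le_norm _).trans h1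
    _ = _ := by
      simp only [majorant, Finset.prod_mul_distrib]
      ring

/-- Joint continuity of `torusDensity` in the point and in a parameter of the function `f`. -/
theorem continuousOn_torusDensity {P : Type*} [TopologicalSpace P] [FirstCountableTopology P]
    [LocallyCompactSpace P] {α ρ : ℝ} (hα : 0 < α) (l : ℝ) (hρ : 0 < ρ) {f : P → (ι → ℂ) → ℂ}
    (hf : Continuous fun p : P × (ι → ℝ) => f p.1 fun i => circleMap 0 ρ (p.2 i)) :
    ContinuousOn (fun p : (ι → ℝ) × P => torusDensity α l ρ (f p.2) p.1)
      (posOrthant ι ×ˢ Set.univ) := by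
  refine ContinuousOn.mul (continuousOn_finsetProd _ fun i _ => ?_)
    (Complex.continuous_re.comp ?_).continuousOn
  · exact (continuousOn_rpow_mul_exp α l).comp (by fun_prop) fun p hp => hp.1 i
  · let box : Set (ι → ℝ) := Set.pi Set.univ fun _ : ι => Set.Icc (0 : ℝ) (2 * Real.pi)
    have hbox : IsCompact box := isCompact_univ_pi fun _ => isCompact_Icc
    have hres : (Measure.pi fun _ : ι => angleMeasure).restrict box =
        Measure.pi fun _ : ι => angleMeasure :=
      Measure.restrict_eq_self_of_ae_mem ae_angleMeasure_mem
    rw [← hres]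
    refine continuous_parametric_integral_of_continuous
      (f := fun (p : (ι → ℝ) × P) (θ : ι → ℝ) => f p.2 (fun i => circleMap 0 ρ (θ i)) *
        ∏ i, mittagLeffler α (p.1 i / circleMap 0 ρ (θ i))) (Continuous.mul ?_ ?_) hbox
    · exact hf.comp (f := fun q : ((ι → ℝ) × P) × (ι → ℝ) => (q.1.2, q.2)) (by fun_prop)
    · exact (continuous_prod_mittagLeffler hα hρ).comp
        (f := fun q : ((ι → ℝ) × P) × (ι → ℝ) => (q.1.1, q.2)) (by fun_prop)

theorem integrableOn_prod_majorant {α : ℝ} (hα : 0 < α) {l ρ : ℝ} (hl : 0 < l) (hρ : l⁻¹ < ρ) :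
    IntegrableOn (fun x : ι → ℝ => ∏ i, majorant α l ρ (x i)) (posOrthant ι) := by
  rw [IntegrableOn, volume_restrict_posOrthant]
  exact Integrable.fintype_prod fun _ => integrableOn_majorant hα hl hρ

omit [Fintype ι] in
theorem isCompact_polydisc (ρ : ℝ) : IsCompact {z : ι → ℂ | ∀ i, ‖z i‖ ≤ ρ} := by
  convert! isCompact_univ_pi fun _ : ι => isCompact_closedBall (0 : ℂ) ρ using 1
  ext z
  simp

/-- By Fubini, the Laplace transform of the torus average is the torus average of the Laplace
transforms of the Mittag-Leffler factors, to which Cauchy's formula applies. -/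
theorem torusDensity_laplace [DecidableEq ι] {α : ℝ} (hα : 0 < α) {l ρ : ℝ} (hl : 0 < l)
    (hρ : l⁻¹ < ρ)
    {f : (ι → ℂ) → ℂ} (hc : ContinuousOn f {z | ∀ i, ‖z i‖ ≤ ρ})
    (hd : ∀ z : ι → ℂ, (∀ i, ‖z i‖ ≤ ρ) → ∀ i,
      DifferentiableOn ℂ (fun w => f (Function.update z i w)) (Metric.ball 0 ρ))
    {t : ι → ℝ} (ht : ∀ i, 0 ≤ t i) :
    IntegrableOn (fun x => Real.exp (-∑ i, t i * x i) * torusDensity α l ρ f x) (posOrthant ι) ∧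
    ∫ x in posOrthant ι, Real.exp (-∑ i, t i * x i) * torusDensity α l ρ f x =
      (((∏ i, (l + t i) ^ (-α) : ℝ) : ℂ) * f (fun i => (((l + t i)⁻¹ : ℝ) : ℂ))).re := by
  have hρ0 : 0 < ρ := (inv_pos.2 hl).trans hρ
  set τ : Measure (ι → ℝ) := Measure.pi fun _ => angleMeasure with hτ
  set μ : Measure (ι → ℝ) := volume.restrict (posOrthant ι) with hμ
  let c : (ι → ℝ) → ι → ℂ := fun θ i => circleMap 0 ρ (θ i)
  have hcc : Continuous c := continuous_circleMap_pi ρ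
  have hcn : ∀ θ i, ‖c θ i‖ = ρ := fun θ i => norm_circleMap_of_pos hρ0 _
  let k : ι → (ι → ℝ) → ℝ → ℂ := fun i θ y =>
    ((y ^ (α - 1) * Real.exp (-((l + t i) * y)) : ℝ) : ℂ) * mittagLeffler α (y / c θ i)
  let Φ : (ι → ℝ) × (ι → ℝ) → ℂ := fun p => f (c p.2) * ∏ i, k i p.2 (p.1 i)
  have hfc : Continuous fun θ => f (c θ) := hc.comp_continuous hcc fun θ i => (hcn θ i).le
  obtain ⟨M, hM⟩ : ∃ M, ∀ z : ι → ℂ, (∀ i, ‖z i‖ ≤ ρ) → ‖f z‖ ≤ M :=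
    (isCompact_polydisc ρ).exists_bound_of_continuousOn hc
  have hΦm : AEStronglyMeasurable Φ (μ.prod τ) := by
    have : μ.prod τ = (volume.prod τ).restrict (posOrthant ι ×ˢ Set.univ) := by
      rw [← Measure.prod_restrict, Measure.restrict_univ]
    rw [this]
    refine ContinuousOn.aestronglyMeasurable ?_
      (isOpen_posOrthant.measurableSet.prod MeasurableSet.univ)
    refine ContinuousOn.mul (hfc.comp continuous_snd).continuousOn
      (continuousOn_finsetProd _ fun i _ => ContinuousOn.mul ?_ (Continuous.continuousOn ?_))
    · exact (Complex.continuous_ofReal.comp_continuousOn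
        (continuousOn_rpow_mul_exp α (l + t i))).comp
        (f := fun p : (ι → ℝ) × (ι → ℝ) => p.1 i) (by fun_prop) fun p hp => hp.1 i
    · refine (continuous_mittagLeffler hα).comp (Continuous.div (by fun_prop) ?_ fun p => ?_)
      · exact (continuous_apply i).comp (hcc.comp continuous_snd)
      · exact circleMap_ne_center hρ0.ne'
  have hΦb : ∀ x ∈ posOrthant ι, ∀ θ, ‖Φ (x, θ)‖ ≤ M * ∏ i, majorant α l ρ (x i) := by
    intro x hx θ
    have hM0 : 0 ≤ M := (norm_nonneg _).trans (hM (c θ) fun i => (hcn _ i).le)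
    simp only [Φ]
    rw [norm_mul, norm_prod]
    gcongr with i
    · exact hM _ fun i => (hcn _ i).le
    · exact norm_kernel_le_majorant hα (by linarith [ht i]) (hx i) (hcn θ i)
  have hΦi : Integrable Φ (μ.prod τ) := by
    refine Integrable.mono' (((integrableOn_prod_majorant hα hl hρ).const_mul M).comp_fst τ) hΦm ?_
    have : ∀ᵐ p ∂μ.prod τ, p.1 ∈ posOrthant ι :=
      Measure.quasiMeasurePreserving_fst.ae (ae_restrict_mem isOpen_posOrthant.measurableSet)
    filter_upwards [this] with p hp using hΦb p.1 hp p.2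
  have hpt : ∀ x ∈ posOrthant ι, Real.exp (-∑ i, t i * x i) * torusDensity α l ρ f x =
      (∫ θ, Φ (x, θ) ∂τ).re := by
    intro x hx
    have h1 : ∀ θ, Φ (x, θ) = ((Real.exp (-∑ i, t i * x i) *
        ∏ i, x i ^ (α - 1) * Real.exp (-(l * x i)) : ℝ) : ℂ) *
        (f (c θ) * ∏ i, mittagLeffler α (x i / c θ i)) := by
      intro θ
      have h2 : Real.exp (-∑ i, t i * x i) * ∏ i, x i ^ (α - 1) * Real.exp (-(l * x i)) =
          ∏ i, x i ^ (α - 1) * Real.exp (-((l + t i) * x i)) := by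
        rw [← Finset.sum_neg_distrib, Real.exp_sum, ← Finset.prod_mul_distrib]
        refine Finset.prod_congr rfl fun i _ => ?_
        rw [add_mul, neg_add, Real.exp_add]
        ring
      rw [h2]
      simp only [Φ, k]
      rw [Finset.prod_mul_distrib, Complex.ofReal_prod]
      ring
    simp_rw [h1]
    rw [integral_const_mul, Complex.re_ofReal_mul, torusDensity, mul_assoc]
  have hI1 : Integrable (fun x => ∫ θ, Φ (x, θ) ∂τ) μ := hΦi.integral_prod_left
  have hmem := ae_restrict_mem (μ := volume) (isOpen_posOrthant (ι := ι)).measurableSet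
  constructor
  · refine hI1.re.congr ?_
    filter_upwards [hmem] with x hx
    exact (hpt x hx).symm
  · have h2 : ∫ x, Real.exp (-∑ i, t i * x i) * torusDensity α l ρ f x ∂μ =
        ∫ x, (∫ θ, Φ (x, θ) ∂τ).re ∂μ := by
      refine integral_congr_ae ?_
      filter_upwards [hmem] with x hx using hpt x hx
    have h3 := integral_re hI1
    simp only [RCLike.re_to_complex] at h3
    rw [h2, h3, integral_integral_swap hΦi]
    congr 1
    have h4 : ∀ θ, ∫ x, Φ (x, θ) ∂μ = ((∏ i, (l + t i) ^ (-α) : ℝ) : ℂ) *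
        (f (c θ) * ∏ i, (1 - (((l + t i)⁻¹ : ℝ) : ℂ) / c θ i)⁻¹) := by
      intro θ
      simp only [Φ]
      rw [integral_const_mul, hμ, volume_restrict_posOrthant,
        integral_fintype_prod_eq_prod (f := fun i => k i θ)]
      have h5 : ∀ i, ∫ y in Set.Ioi 0, k i θ y = (((l + t i) ^ (-α) : ℝ) : ℂ) *
          (1 - (((l + t i)⁻¹ : ℝ) : ℂ) / c θ i)⁻¹ := by
        intro i
        have hlt : 0 < l + t i := by linarith [ht i]
        have h6 := (mittagLeffler_laplace hα hlt (z := (c θ i)⁻¹) (by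
          rw [norm_inv, hcn]
          exact (inv_lt_of_inv_lt₀ hl hρ).trans_le (by linarith [ht i]))).2
        simp only [k, div_eq_mul_inv (_ : ℂ) (c θ i)]
        rw [h6]
        push_cast
        congr 3
        rw [div_eq_mul_inv, mul_comm]
      simp_rw [h5]
      rw [Finset.prod_mul_distrib]
      push_cast
      ring
    simp_rw [h4]
    rw [integral_const_mul, integral_cauchy_polydisc hc hd]
    intro i
    have hlt : 0 < l + t i := by linarith [ht i]
    rw [Complex.norm_real, Real.norm_of_nonneg (inv_pos.2 hlt).le]
    exact (inv_anti₀ hl (by linarith [ht i])).trans_lt hρ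

end

/-! ### Existence of the gamma densities -/

section
open scoped Matrix.Norms.L2Operator

variable {ι : Type*} [Fintype ι] [DecidableEq ι]

theorem exists_norm_trace_mul_map_le :
    ∃ C : ℝ, 0 ≤ C ∧ ∀ (A : Matrix ι ι ℂ) (D : Matrix ι ι ℝ),
      ‖(A * D.map Complex.ofReal).trace‖ ≤ C * ‖A‖ * ‖D‖ := by
  obtain ⟨C, hC⟩ := exists_norm_trace_le (ι := ι)
  let T : Matrix ι ι ℝ →L[ℝ] Matrix ι ι ℂ := LinearMap.toContinuousLinearMap
    (Complex.ofRealCLM.toLinearMap.mapMatrix)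
  refine ⟨|C| * ‖T‖, by positivity, fun A D => ?_⟩
  calc ‖(A * D.map Complex.ofReal).trace‖ ≤ C * ‖A * D.map Complex.ofReal‖ := hC _
    _ ≤ |C| * (‖A‖ * ‖D.map Complex.ofReal‖) := by
      gcongr
      · exact le_abs_self C
      · exact norm_mul_le _ _
    _ ≤ |C| * (‖A‖ * (‖T‖ * ‖D‖)) := by
      gcongr
      exact T.le_opNorm D
    _ = _ := by ring

/-- For every `α > 0` the (possibly signed) non-central gamma densities exist. They can be chosen
jointly continuous in the point and the non-centrality matrix, with a bound separating the two.
Here `‖D‖` is the `L²` operator norm. -/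
theorem exists_gammaDensity_family {S : Matrix ι ι ℝ} (hS : S.PosDef) {α : ℝ} (hα : 0 < α) :
    ∃ (G : (ι → ℝ) → Matrix ι ι ℝ → ℝ) (K : (ι → ℝ) → ℝ) (κ : ℝ), 0 ≤ κ ∧
      ContinuousOn (fun p : (ι → ℝ) × Matrix ι ι ℝ => G p.1 p.2) (posOrthant ι ×ˢ Set.univ) ∧
      IntegrableOn K (posOrthant ι) ∧
      (∀ x ∈ posOrthant ι, ∀ D, |G x D| ≤ K x * Real.exp (κ * ‖D‖)) ∧
      ∀ D, IsGammaDensity α S D fun x => G x D := by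
  obtain ⟨l, hl, hR⟩ := exists_norm_smul_one_sub_lt hS.inv
  -- a radius `ρ = 1/m` with `1/l < ρ < 1/‖l - S⁻¹‖`
  obtain ⟨m, hRm, hml⟩ := exists_between hR
  set R : Matrix ι ι ℂ := (l • (1 : Matrix ι ι ℝ) - S⁻¹).map Complex.ofReal with hRdef
  set B : Matrix ι ι ℂ := S⁻¹.map Complex.ofReal
  have hm : 0 < m := (norm_nonneg _).trans_lt hRm
  set ρ : ℝ := m⁻¹ with hρdef
  have hρ : l⁻¹ < ρ := inv_strictAnti₀ hm hml
  have hρ0 : 0 < ρ := inv_pos.2 hm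
  have hRρ : ‖R‖ * ρ < 1 := by
    rw [hρdef, ← div_eq_mul_inv]
    exact (div_lt_one hm).2 hRm
  let a : (ι → ℂ) → ℂ := fun z => -(α * Real.log S.det : ℝ) + α * negLogDet R z
  let q : (ι → ℂ) → Matrix ι ι ℂ := noncentralityKernel B R
  let f : Matrix ι ι ℝ → (ι → ℂ) → ℂ := fun D z =>
    Complex.exp (a z + (q z * D.map Complex.ofReal).trace)
  have ha : ContinuousOn a {z | ∀ i, ‖z i‖ ≤ ρ} :=
    continuousOn_const.add (continuousOn_const.mul (continuousOn_negLogDet hρ0.le hRρ))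
  have hq : ContinuousOn q {z | ∀ i, ‖z i‖ ≤ ρ} :=
    continuousOn_noncentralityKernel B hρ0.le hRρ
  have hf : ContinuousOn (fun p : Matrix ι ι ℝ × (ι → ℂ) => f p.1 p.2)
      (Set.univ ×ˢ {z | ∀ i, ‖z i‖ ≤ ρ}) := by
    refine Complex.continuous_exp.comp_continuousOn (ContinuousOn.add
      (ha.comp continuousOn_snd fun p hp => hp.2) ?_)
    refine continuous_id.matrix_trace.comp_continuousOn (ContinuousOn.mul
      (hq.comp continuousOn_snd fun p hp => hp.2) (Continuous.continuousOn ?_))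
    exact continuous_fst.matrix_map Complex.continuous_ofReal
  obtain ⟨Ma, hMa⟩ := (isCompact_polydisc ρ).exists_bound_of_continuousOn ha
  obtain ⟨Mq, hMq⟩ := (isCompact_polydisc ρ).exists_bound_of_continuousOn hq
  obtain ⟨C, hC0, hC⟩ := exists_norm_trace_mul_map_le (ι := ι)
  have hfb : ∀ D (z : ι → ℂ), (∀ i, ‖z i‖ ≤ ρ) →
      ‖f D z‖ ≤ Real.exp Ma * Real.exp (C * |Mq| * ‖D‖) := by
    intro D z hz
    rw [Complex.norm_exp, ← Real.exp_add, Real.exp_le_exp]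
    calc (a z + (q z * D.map Complex.ofReal).trace).re
        ≤ ‖a z + (q z * D.map Complex.ofReal).trace‖ := Complex.re_le_norm _
      _ ≤ ‖a z‖ + ‖(q z * D.map Complex.ofReal).trace‖ := norm_add_le _ _
      _ ≤ Ma + C * ‖q z‖ * ‖D‖ := add_le_add (hMa z hz) (hC _ _)
      _ ≤ _ := by
        gcongr
        exact (hMq z hz).trans (le_abs_self _)
  refine ⟨fun x D => torusDensity α l ρ (f D) x,
    fun x => Real.exp Ma * ∏ i, majorant α l ρ (x i), C * |Mq|, by positivity, ?_, ?_, ?_, ?_⟩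
  · refine continuousOn_torusDensity hα l hρ0 ?_
    refine hf.comp_continuous (f := fun p : Matrix ι ι ℝ × (ι → ℝ) =>
      (p.1, fun i => circleMap 0 ρ (p.2 i))) ?_ fun p => ⟨trivial, fun i =>
        (norm_circleMap_of_pos hρ0 _).le⟩
    exact continuous_fst.prodMk ((continuous_circleMap_pi ρ).comp continuous_snd)
  · exact (integrableOn_prod_majorant hα hl hρ).const_mul _
  · intro x hx D
    refine (abs_torusDensity_le hα hρ0 (hfb D) hx).trans (le_of_eq ?_)
    ring
  · intro D
    have hfD : ContinuousOn (f D) {z | ∀ i, ‖z i‖ ≤ ρ} :=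
      hf.comp (f := fun z : ι → ℂ => (D, z)) (by fun_prop) fun z hz => ⟨trivial, hz⟩
    have hcont : Continuous fun p : Unit × (ι → ℝ) =>
        f D fun i => circleMap 0 ρ (p.2 i) :=
      hfD.comp_continuous ((continuous_circleMap_pi ρ).comp continuous_snd) fun p i =>
        (norm_circleMap_of_pos hρ0 _).le
    refine ⟨(continuousOn_torusDensity (P := Unit) (f := fun _ => f D) hα l hρ0 hcont).comp
      (f := fun x : ι → ℝ => (x, ())) (by fun_prop) fun x hx => ⟨hx, trivial⟩, fun t ht => ?_⟩
    have hd : ∀ z : ι → ℂ, (∀ i, ‖z i‖ ≤ ρ) → ∀ i,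
        DifferentiableOn ℂ (fun w => f D (Function.update z i w)) (Metric.ball 0 ρ) := by
      intro z hz i
      have h3 : DifferentiableOn ℂ (fun w => (q (Function.update z i w) *
          D.map Complex.ofReal).trace) (Metric.ball 0 ρ) :=
        differentiable_trace.comp_differentiableOn (f := fun w => q (Function.update z i w) *
          D.map Complex.ofReal) (DifferentiableOn.mul
          (differentiableOn_noncentralityKernel B hρ0.le hRρ hz i) (differentiableOn_const _))
      exact DifferentiableOn.cexp (((differentiableOn_const _).add
        ((differentiableOn_const _).mul (differentiableOn_negLogDet hρ0.le hRρ hz i))).add h3)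
    obtain ⟨h1, h2⟩ := torusDensity_laplace hα hl hρ hfD hd ht
    refine ⟨h1, h2.trans ?_⟩
    rw [← gammaTransform_eq hS α D hl hR ht, Complex.ofReal_re]

end

/-! ### Gaussian integrals and bordered matrices -/

section
variable {n : Type*} [Fintype n] [DecidableEq n]

theorem exists_eq_mul_transpose {W : Matrix n n ℝ} (hW : W.PosDef) :
    ∃ L : Matrix n n ℝ, W = L * Lᵀ := by
  obtain ⟨V, d, hV, hVd, hd⟩ := exists_orthogonal_diagonalization hW.1
  refine ⟨V * diagonal fun i => √(d i), ?_⟩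
  have hdpos : ∀ i, 0 ≤ d i := fun i => (hd ▸ hW.eigenvalues_pos i).le
  have h : diagonal (fun i => √(d i)) * diagonal (fun i => √(d i)) = diagonal d := by
    rw [diagonal_mul_diagonal]
    simp only [Real.mul_self_sqrt (hdpos _)]
  rw [transpose_mul, diagonal_transpose, ← Matrix.mul_assoc, Matrix.mul_assoc V, h, ← hVd]

theorem integral_gaussian_linear {a : ℝ} (ha : 0 < a) (m : ℝ) :
    Integrable (fun z : ℝ => Real.exp (-(a * z ^ 2 + 2 * m * z))) ∧
    ∫ z : ℝ, Real.exp (-(a * z ^ 2 + 2 * m * z)) = √(Real.pi / a) * Real.exp (m ^ 2 / a) := by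
  have h : ∀ z : ℝ, Real.exp (-(a * z ^ 2 + 2 * m * z)) =
      Real.exp (-a * (z + m / a) ^ 2) * Real.exp (m ^ 2 / a) := by
    intro z
    rw [← Real.exp_add]
    congr 1
    field_simp
    ring
  simp_rw [h]
  refine ⟨((integrable_exp_neg_mul_sq ha).comp_add_right (m / a)).mul_const _, ?_⟩
  rw [integral_mul_const, integral_add_right_eq_self (fun z => Real.exp (-a * z ^ 2)),
    integral_gaussian]

/-- The Gaussian integral with covariance `W` and a linear term, by the substitution `w = L z`
with `W = L Lᵀ`. -/
theorem lintegral_gaussian {W : Matrix n n ℝ} (hW : W.PosDef) {a : ℝ} (ha : 0 < a) (b : n → ℝ) :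
    ∫⁻ w : n → ℝ, ENNReal.ofReal (Real.exp (-(a * (w ⬝ᵥ W⁻¹ *ᵥ w) + 2 * (b ⬝ᵥ w)))) =
      ENNReal.ofReal (√W.det * √(Real.pi / a) ^ Fintype.card n *
        Real.exp (b ⬝ᵥ W *ᵥ b / a)) := by
  obtain ⟨L, hL⟩ := exists_eq_mul_transpose hW
  have hdet : L.det * L.det = W.det := by rw [hL, det_mul, det_transpose]
  have hL0 : L.det ≠ 0 := by
    intro h
    rw [h, mul_zero] at hdet
    exact hW.det_pos.ne hdet
  have hLu : IsUnit L.det := isUnit_iff_ne_zero.2 hL0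
  have habs : |L.det| = √W.det := by rw [← hdet, Real.sqrt_mul_self_eq_abs]
  have hmap := Real.map_matrix_volume_pi_eq_smul_volume_pi hL0
  have hvol : (volume : Measure (n → ℝ)) =
      ENNReal.ofReal |L.det| • Measure.map (toLin' L) volume := by
    rw [hmap, smul_smul, ← ENNReal.ofReal_mul (abs_nonneg _), abs_inv,
      mul_inv_cancel₀ (abs_ne_zero.2 hL0), ENNReal.ofReal_one, one_smul]
  have hmeas : Measurable fun w : n → ℝ =>
      ENNReal.ofReal (Real.exp (-(a * (w ⬝ᵥ W⁻¹ *ᵥ w) + 2 * (b ⬝ᵥ w)))) := by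
    refine Measurable.ennreal_ofReal (Continuous.measurable ?_)
    fun_prop
  have hLm : Measurable (toLin' L) := (LinearMap.continuous_of_finiteDimensional _).measurable
  rw [hvol, lintegral_smul_measure, lintegral_map hmeas hLm]
  set c : n → ℝ := Lᵀ *ᵥ b with hc
  have hq : ∀ z : n → ℝ, Real.exp (-(a * ((toLin' L z) ⬝ᵥ W⁻¹ *ᵥ (toLin' L z)) +
      2 * (b ⬝ᵥ (toLin' L z)))) = ∏ i, Real.exp (-(a * z i ^ 2 + 2 * c i * z i)) := by
    intro z
    rw [← Real.exp_sum]
    congr 1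
    rw [Finset.sum_neg_distrib, Finset.sum_add_distrib]
    have h1 : (toLin' L z) ⬝ᵥ W⁻¹ *ᵥ (toLin' L z) = z ⬝ᵥ z := by
      have h3 : W⁻¹ * L = (Lᵀ)⁻¹ := by
        rw [hL, Matrix.mul_inv_rev, Matrix.mul_assoc, nonsing_inv_mul _ hLu, Matrix.mul_one]
      rw [toLin'_apply, mulVec_mulVec, h3, dotProduct_comm, dotProduct_mulVec, ← mulVec_transpose,
        mulVec_mulVec, mul_nonsing_inv _ (by rwa [det_transpose]), one_mulVec]
    have h2 : b ⬝ᵥ (toLin' L z) = c ⬝ᵥ z := by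
      rw [toLin'_apply, dotProduct_mulVec, hc, mulVec_transpose]
    rw [h1, h2, dotProduct, dotProduct, Finset.mul_sum, Finset.mul_sum]
    congr 2
    · exact Finset.sum_congr rfl fun i _ => by ring
    · exact Finset.sum_congr rfl fun i _ => by ring
  simp_rw [hq]
  have h1 := fun i => integral_gaussian_linear ha (c i)
  rw [volume_pi, ← ofReal_integral_eq_lintegral_ofReal (Integrable.fintype_prod fun i => (h1 i).1)
    (Filter.Eventually.of_forall fun z => Finset.prod_nonneg fun i _ => (Real.exp_pos _).le),
    integral_fintype_prod_eq_prod
      (f := fun i z => Real.exp (-(a * z ^ 2 + 2 * c i * z)))]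
  simp_rw [(h1 _).2]
  rw [Finset.prod_mul_distrib, ← Real.exp_sum, Finset.prod_const, Finset.card_univ, smul_eq_mul,
    ← ENNReal.ofReal_mul (abs_nonneg _), habs, ← mul_assoc, ← Finset.sum_div]
  congr 4
  rw [hL, ← mulVec_mulVec, dotProduct_mulVec, ← mulVec_transpose, ← hc, dotProduct]
  exact Finset.sum_congr rfl fun i _ => by ring

/-- The symmetric matrix obtained from `W` by adding a last row and column `(w, y)`. -/
def bordered (W : Matrix n n ℝ) (w : n → ℝ) (y : ℝ) : Matrix (n ⊕ Unit) (n ⊕ Unit) ℝ :=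
  fromBlocks W (replicateCol Unit w) (replicateRow Unit w) (of fun _ _ => y)

theorem det_bordered {W : Matrix n n ℝ} (hW : W.PosDef) (w : n → ℝ) (y : ℝ) :
    (bordered W w y).det = W.det * (y - w ⬝ᵥ W⁻¹ *ᵥ w) := by
  have := hW.isUnit.invertible
  rw [bordered, det_fromBlocks₁₁, det_unique (n := Unit), invOf_eq_nonsing_inv, Matrix.mul_assoc,
    ← replicateCol_mulVec]
  simp [Matrix.mul_apply, dotProduct]

theorem posDef_bordered_iff {W : Matrix n n ℝ} (hW : W.PosDef) (w : n → ℝ) (y : ℝ) :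
    (bordered W w y).PosDef ↔ 0 < y - w ⬝ᵥ W⁻¹ *ᵥ w := by
  have hdet := det_bordered hW w y
  constructor
  · intro h
    have := h.det_pos
    rw [hdet] at this
    exact (mul_pos_iff_of_pos_left hW.det_pos).1 this
  · intro h
    have := hW.isUnit.invertible
    have hpsd : (bordered W w y).PosSemidef := by
      have h1 := (PosDef.fromBlocks₁₁ (replicateCol Unit w) (of fun _ _ => y) hW).2 (by
        have : (of fun _ _ => y : Matrix Unit Unit ℝ) -
            (replicateCol Unit w)ᴴ * W⁻¹ * replicateCol Unit w =
            diagonal fun _ => y - w ⬝ᵥ W⁻¹ *ᵥ w := by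
          ext i j
          rw [Matrix.mul_assoc, ← replicateCol_mulVec]
          simp [Matrix.mul_apply, dotProduct]
        rw [this]
        exact PosSemidef.diagonal fun _ => h.le)
      exact h1
    refine hpsd.posDef_iff_det_ne_zero.2 ?_
    rw [hdet]
    exact (mul_pos hW.det_pos h).ne'

omit [Fintype n] [DecidableEq n] in
theorem posDef_of_bordered {W : Matrix n n ℝ} {w : n → ℝ} {y : ℝ} (h : (bordered W w y).PosDef) :
    W.PosDef :=
  h.submatrix (e := Sum.inl) Sum.inl_injective

/-- The Schur complement of the corner entry. -/
theorem bordered_schur {A : Matrix n n ℝ} {a : n → ℝ} {a₀ : ℝ} (h : (bordered A a a₀).PosDef) :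
    0 < a₀ ∧ (A - a₀⁻¹ • vecMulVec a a).PosDef ∧
      (bordered A a a₀).det = a₀ * (A - a₀⁻¹ • vecMulVec a a).det := by
  have h0 : 0 < a₀ := h.diag_pos (i := Sum.inr ())
  have hD : (of fun _ _ => a₀ : Matrix Unit Unit ℝ).PosDef :=
    h.submatrix (e := Sum.inr) Sum.inr_injective
  have := hD.isUnit.invertible
  have hinv : (of fun _ _ => a₀ : Matrix Unit Unit ℝ)⁻¹ = of fun _ _ => a₀⁻¹ := by
    refine Matrix.inv_eq_left_inv ?_
    ext i j
    simp [Matrix.mul_apply, h0.ne']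
  have hS : A - replicateCol Unit a * (of fun _ _ => a₀ : Matrix Unit Unit ℝ)⁻¹ *
      replicateRow Unit a = A - a₀⁻¹ • vecMulVec a a := by
    rw [hinv]
    ext i j
    simp [Matrix.mul_apply, vecMulVec_apply]
    ring
  have hdet : (bordered A a a₀).det = a₀ * (A - a₀⁻¹ • vecMulVec a a).det := by
    rw [bordered, det_fromBlocks₂₂, det_unique, invOf_eq_nonsing_inv, hS]
    rfl
  have hpsd : (A - a₀⁻¹ • vecMulVec a a).PosSemidef := by
    rw [← hS]
    exact (PosDef.fromBlocks₂₂ A (replicateCol Unit a) hD).1 h.posSemidef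
  refine ⟨h0, hpsd.posDef_iff_det_ne_zero.2 fun hz => ?_, hdet⟩
  have := h.det_pos
  rw [hdet, hz, mul_zero] at this
  exact this.false

omit [DecidableEq n] in
theorem trace_bordered_mul (A W : Matrix n n ℝ) (a w : n → ℝ) (a₀ y : ℝ) :
    (bordered A a a₀ * bordered W w y).trace = (A * W).trace + 2 * (a ⬝ᵥ w) + a₀ * y := by
  rw [bordered, bordered, fromBlocks_multiply]
  simp only [trace, diag_apply, Fintype.sum_sum_type, fromBlocks_apply₁₁, fromBlocks_apply₂₂,
    Matrix.add_apply]
  simp [Matrix.mul_apply, dotProduct, Finset.sum_add_distrib]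
  ring

end

/-! ### The Wishart integral -/

theorem measurePreserving_prodProdProdComm {α β γ δ : Type*} [MeasurableSpace α]
    [MeasurableSpace β] [MeasurableSpace γ] [MeasurableSpace δ] (μ : Measure α) (ν : Measure β)
    (ρ : Measure γ) (σ : Measure δ) [SFinite μ] [SFinite ν] [SFinite ρ] [SFinite σ] :
    MeasurePreserving (fun p : (α × β) × (γ × δ) => ((p.1.1, p.2.1), (p.1.2, p.2.2)))
      ((μ.prod ν).prod (ρ.prod σ)) ((μ.prod ρ).prod (ν.prod σ)) := by
  have h1 := measurePreserving_prodAssoc μ ν (ρ.prod σ)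
  have h2 := (MeasurePreserving.id μ).prod ((measurePreserving_prodAssoc ν ρ σ).symm)
  have h3 := (MeasurePreserving.id μ).prod
    ((Measure.measurePreserving_swap (μ := ν) (ν := ρ)).prod (MeasurePreserving.id σ))
  have h4 := (MeasurePreserving.id μ).prod (measurePreserving_prodAssoc ρ ν σ)
  have h5 := (measurePreserving_prodAssoc μ ρ (ν.prod σ)).symm
  exact h5.comp (h4.comp (h3.comp (h2.comp h1)))

/-- Coordinates of a symmetric `q × q` matrix: its diagonal and its entries above the diagonal. -/
abbrev SymmCoord (q : ℕ) : Type := (Fin q → ℝ) × (UpperIndex q → ℝ)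

/-- The symmetric matrix with given coordinates. -/
def symmMatrix {q : ℕ} (v : SymmCoord q) : Matrix (Fin q) (Fin q) ℝ :=
  Matrix.of fun i j =>
    if h : i < j then v.2 ⟨(i, j), h⟩ else if h' : j < i then v.2 ⟨(j, i), h'⟩ else v.1 i

theorem symmMatrix_isHermitian {q : ℕ} (v : SymmCoord q) : (symmMatrix v).IsHermitian := by
  ext i j
  rcases lt_trichotomy i j with h | h | h
  · simp [symmMatrix, h, h.not_gt]
  · simp [symmMatrix, h]
  · simp [symmMatrix, h, h.not_gt]

theorem continuous_symmMatrix (q : ℕ) : Continuous (symmMatrix (q := q)) := by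
  refine continuous_matrix fun i j => ?_
  rcases lt_trichotomy i j with h | h | h
  · simp only [symmMatrix, of_apply, h, dite_true]
    fun_prop
  · simp only [symmMatrix, of_apply, h, lt_irrefl, dite_false]
    fun_prop
  · simp only [symmMatrix, of_apply, h, h.not_gt, dite_true, dite_false]
    fun_prop

section
variable {n : Type*} [Fintype n] [DecidableEq n]

open Classical in
/-- The unnormalized Wishart density `etr(-A M) |M|^β` on positive definite matrices `M`,
extended by zero to all matrices. -/
noncomputable def wishartWeight (A : Matrix n n ℝ) (β : ℝ) (M : Matrix n n ℝ) : ENNReal :=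
  if M.PosDef then ENNReal.ofReal (Real.exp (-(A * M).trace) * M.det ^ β) else 0

omit [Fintype n] [DecidableEq n] in
theorem posDef_submatrix_equiv {m : Type*} (M : Matrix n n ℝ)
    (e : m ≃ n) : (M.submatrix e e).PosDef ↔ M.PosDef := by
  refine ⟨fun h => ?_, fun h => h.submatrix e.injective⟩
  have := h.submatrix e.symm.injective
  simpa using this

theorem wishartWeight_submatrix {m : Type*} [Fintype m] [DecidableEq m] (A : Matrix n n ℝ) (β : ℝ)
    (M : Matrix n n ℝ) (e : m ≃ n) :
    wishartWeight (A.submatrix e e) β (M.submatrix e e) = wishartWeight A β M := by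
  have htr : (A.submatrix e e * M.submatrix e e).trace = (A * M).trace := by
    rw [submatrix_mul_equiv, trace, trace]
    exact Fintype.sum_equiv e _ _ fun i => rfl
  rw [wishartWeight, wishartWeight, htr, det_submatrix_equiv_self]
  by_cases h : M.PosDef
  · rw [if_pos h, if_pos ((posDef_submatrix_equiv M e).2 h)]
  · rw [if_neg h, if_neg fun h' => h ((posDef_submatrix_equiv M e).1 h')]

end

theorem isClosed_posSemidef_of_continuous {X n : Type*} [TopologicalSpace X] [Fintype n]
    {M : X → Matrix n n ℝ} (hM : Continuous M) (hh : ∀ x, (M x).IsHermitian) :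
    IsClosed {x | (M x).PosSemidef} := by
  have : {x | (M x).PosSemidef} = ⋂ v : n → ℝ, {x | 0 ≤ star v ⬝ᵥ M x *ᵥ v} := by
    ext x
    rw [Set.mem_ofPred_eq, posSemidef_iff_dotProduct_mulVec, and_iff_right (hh x), Set.mem_iInter]
    rfl
  rw [this]
  exact isClosed_iInter fun v => isClosed_le continuous_const (by fun_prop)

theorem measurable_wishartWeight {q : ℕ} (A : Matrix (Fin q) (Fin q) ℝ) (β : ℝ) :
    Measurable fun v : SymmCoord q => wishartWeight A β (symmMatrix v) := by
  have hc := continuous_symmMatrix q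
  refine Measurable.ite ?_ ?_ measurable_const
  · have : {v : SymmCoord q | (symmMatrix v).PosDef} =
        {v | (symmMatrix v).PosSemidef} ∩ {v | (symmMatrix v).det = 0}ᶜ := by
      ext v
      exact ⟨fun h => ⟨h.posSemidef, h.det_pos.ne'⟩, fun h => h.1.posDef_iff_det_ne_zero.2 h.2⟩
    rw [this]
    exact (isClosed_posSemidef_of_continuous hc symmMatrix_isHermitian).measurableSet.inter
      (isClosed_eq hc.matrix_det continuous_const).measurableSet.compl
  · refine ENNReal.measurable_ofReal.comp (Measurable.mul ?_ ?_)
    · exact (Real.continuous_exp.comp (continuous_const.mul hc).matrix_trace.neg).measurable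
    · exact (hc.matrix_det).measurable.pow_const _

theorem lintegral_rpow_mul_exp {β a : ℝ} (hβ : -1 < β) (ha : 0 < a) :
    ∫⁻ s : ℝ, (Set.Ioi 0).indicator (fun s => ENNReal.ofReal (Real.exp (-(a * s)) * s ^ β)) s =
      ENNReal.ofReal (Real.Gamma (β + 1) * a ^ (-(β + 1))) := by
  have hα : 0 < β + 1 := by linarith
  have h1 := integrableOn_rpow_mul_exp hα ha 0
  have h2 := Real.integral_rpow_mul_exp_neg_mul_Ioi hα ha
  simp only [Nat.cast_zero, add_zero, add_sub_cancel_right] at h1 h2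
  rw [lintegral_indicator measurableSet_Ioi, ← ofReal_integral_eq_lintegral_ofReal]
  · simp_rw [mul_comm (Real.exp _)]
    rw [h2, one_div, Real.inv_rpow ha.le, Real.rpow_neg ha.le, mul_comm]
  · simp_rw [mul_comm (Real.exp _)]
    exact h1
  · filter_upwards [ae_restrict_mem measurableSet_Ioi] with s hs
    have : (0 : ℝ) < s := hs
    positivity

/-- Integrating the Wishart density over the last row and column: the Schur complement has a gamma
density and the remaining column a Gaussian density. -/
theorem lintegral_wishartWeight_bordered {n : Type*} [Fintype n] [DecidableEq n]
    {A : Matrix n n ℝ} {a : n → ℝ} {a₀ : ℝ} (ha₀ : 0 < a₀) {β : ℝ} (hβ : -1 < β)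
    (W : Matrix n n ℝ) :
    ∫⁻ w : n → ℝ, ∫⁻ y : ℝ, wishartWeight (bordered A a a₀) β (bordered W w y) =
      ENNReal.ofReal (Real.Gamma (β + 1) * a₀ ^ (-(β + 1)) * √(Real.pi / a₀) ^ Fintype.card n) *
        wishartWeight (A - a₀⁻¹ • vecMulVec a a) (β + 1 / 2) W := by
  by_cases hW : W.PosDef
  swap
  · have : ∀ w y, wishartWeight (bordered A a a₀) β (bordered W w y) = 0 := fun w y =>
      if_neg fun h => hW (posDef_of_bordered h)
    simp_rw [this]
    simp [wishartWeight, hW]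
  have hinner : ∀ w : n → ℝ, ∫⁻ y : ℝ, wishartWeight (bordered A a a₀) β (bordered W w y) =
      ENNReal.ofReal (Real.exp (-(A * W).trace) * W.det ^ β *
        (Real.Gamma (β + 1) * a₀ ^ (-(β + 1)))) *
      ENNReal.ofReal (Real.exp (-(a₀ * (w ⬝ᵥ W⁻¹ *ᵥ w) + 2 * (a ⬝ᵥ w)))) := by
    intro w
    rw [← lintegral_add_right_eq_self _ (w ⬝ᵥ W⁻¹ *ᵥ w)]
    have hy : ∀ s : ℝ, wishartWeight (bordered A a a₀) β (bordered W w (s + w ⬝ᵥ W⁻¹ *ᵥ w)) =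
        ENNReal.ofReal (Real.exp (-(A * W).trace) * W.det ^ β *
          Real.exp (-(a₀ * (w ⬝ᵥ W⁻¹ *ᵥ w) + 2 * (a ⬝ᵥ w)))) *
        (Set.Ioi 0).indicator (fun s => ENNReal.ofReal (Real.exp (-(a₀ * s)) * s ^ β)) s := by
      intro s
      rw [wishartWeight, posDef_bordered_iff hW, add_sub_cancel_right]
      by_cases hs : 0 < s
      · rw [if_pos hs, Set.indicator_of_mem (Set.mem_Ioi.2 hs), det_bordered hW,
          add_sub_cancel_right, trace_bordered_mul, Real.mul_rpow hW.det_pos.le hs.le,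
          ← ENNReal.ofReal_mul (by have := hW.det_pos; positivity)]
        congr 1
        rw [show -((A * W).trace + 2 * a ⬝ᵥ w + a₀ * (s + w ⬝ᵥ W⁻¹ *ᵥ w)) =
          -(A * W).trace + (-(a₀ * w ⬝ᵥ W⁻¹ *ᵥ w + 2 * a ⬝ᵥ w)) + -(a₀ * s) by ring,
          Real.exp_add, Real.exp_add]
        ring
      · rw [if_neg hs, Set.indicator_of_notMem (by simpa using hs), mul_zero]
    simp_rw [hy]
    rw [lintegral_const_mul' _ _ ENNReal.ofReal_ne_top, lintegral_rpow_mul_exp hβ ha₀]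
    have h1 := hW.det_pos
    have h2 : 0 < Real.Gamma (β + 1) := Real.Gamma_pos_of_pos (by linarith)
    rw [← ENNReal.ofReal_mul (by positivity), ← ENNReal.ofReal_mul (by positivity)]
    congr 1
    ring
  simp_rw [hinner]
  rw [lintegral_const_mul' _ _ ENNReal.ofReal_ne_top, lintegral_gaussian hW ha₀]
  have h1 := hW.det_pos
  have h2 : 0 < Real.Gamma (β + 1) := Real.Gamma_pos_of_pos (by linarith)
  rw [wishartWeight, if_pos hW, ← ENNReal.ofReal_mul (by positivity),
    ← ENNReal.ofReal_mul (by positivity)]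
  congr 1
  have htr : ((A - a₀⁻¹ • vecMulVec a a) * W).trace = (A * W).trace - a ⬝ᵥ W *ᵥ a / a₀ := by
    rw [Matrix.sub_mul, trace_sub, Matrix.smul_mul, trace_smul, trace_mul_comm (vecMulVec a a),
      mul_vecMulVec, trace_vecMulVec, dotProduct_comm, smul_eq_mul]
    ring
  rw [htr, Real.rpow_add h1, ← Real.sqrt_eq_rpow, neg_sub, sub_eq_add_neg, Real.exp_add]
  ring

/-- The position `(0, j + 1)` in the first row or `(i + 1, j + 1)` in the remaining block. -/
def upperIndexSucc (q : ℕ) : Fin q ⊕ UpperIndex q → UpperIndex (q + 1) :=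
  Sum.elim (fun j => ⟨(0, j.succ), j.succ_pos⟩)
    fun ij => ⟨(ij.1.1.succ, ij.1.2.succ), Fin.succ_lt_succ_iff.2 ij.2⟩

theorem bijective_upperIndexSucc (q : ℕ) : Function.Bijective (upperIndexSucc q) := by
  constructor
  · rintro (i | ⟨⟨i, j⟩, h⟩) (i' | ⟨⟨i', j'⟩, h'⟩) heq
    · simpa [upperIndexSucc] using heq
    · simp [upperIndexSucc, Fin.ext_iff] at heq
    · simp [upperIndexSucc, Fin.ext_iff] at heq
    · simpa [upperIndexSucc] using heq
  · rintro ⟨⟨i, j⟩, h⟩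
    obtain ⟨j, rfl⟩ := Fin.exists_succ_eq.2 (Fin.ne_zero_of_lt h)
    rcases Fin.eq_zero_or_eq_succ i with rfl | ⟨i, rfl⟩
    · exact ⟨Sum.inl j, rfl⟩
    · exact ⟨Sum.inr ⟨(i, j), Fin.succ_lt_succ_iff.1 h⟩, rfl⟩

/-- The rows of a `(q + 1) × (q + 1)` matrix with the first row moved to the end. -/
def finSuccEquivSum (q : ℕ) : Fin q ⊕ Unit ≃ Fin (q + 1) :=
  ((finSuccEquiv q).trans (Equiv.optionEquivSumPUnit (Fin q))).symm

@[simp]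
theorem finSuccEquivSum_inl {q : ℕ} (i : Fin q) : finSuccEquivSum q (Sum.inl i) = i.succ := by
  simp [finSuccEquivSum]

@[simp]
theorem finSuccEquivSum_inr {q : ℕ} (u : Unit) : finSuccEquivSum q (Sum.inr u) = 0 := by
  simp [finSuccEquivSum]

/-- Measure-preserving coordinates for symmetric matrices that split off the first row. -/
theorem exists_measurePreserving_symmCoord (q : ℕ) :
    ∃ Ψ : (ℝ × (Fin q → ℝ)) × SymmCoord q → SymmCoord (q + 1),
      MeasurePreserving Ψ volume volume ∧
      ∀ y w v, (symmMatrix (Ψ ((y, w), v))).submatrix (finSuccEquivSum q) (finSuccEquivSum q) =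
        bordered (symmMatrix v) w y := by
  let u := Equiv.ofBijective _ (bijective_upperIndexSucc q)
  have h1 := (volume_preserving_piFinSuccAbove (fun _ : Fin (q + 1) => ℝ) 0).symm
  have h2 := volume_measurePreserving_sumPiEquivProdPi_symm (fun _ : Fin q ⊕ UpperIndex q => ℝ)
  have h3 := volume_measurePreserving_piCongrLeft (fun _ : UpperIndex (q + 1) => ℝ) u
  have h4 := measurePreserving_prodProdProdComm (volume : Measure ℝ)
    (volume : Measure (Fin q → ℝ)) (volume : Measure (Fin q → ℝ))
    (volume : Measure (UpperIndex q → ℝ))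
  refine ⟨_, (h1.prod (h3.comp h2)).comp h4, fun y w v => ?_⟩
  set p : SymmCoord (q + 1) := ((MeasurableEquiv.piFinSuccAbove (fun _ => ℝ) 0).symm (y, v.1),
    (MeasurableEquiv.piCongrLeft (fun _ => ℝ) u)
      ((MeasurableEquiv.sumPiEquivProdPi (fun _ : Fin q ⊕ UpperIndex q => ℝ)).symm (w, v.2)))
    with hp
  change (symmMatrix p).submatrix _ _ = _
  have hp0 : p.1 0 = y := by simp [hp, MeasurableEquiv.piFinSuccAbove]
  have hp1 : ∀ i, p.1 (Fin.succ i) = v.1 i := fun i => by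
    simp [hp, MeasurableEquiv.piFinSuccAbove]
  have hcomp : ∀ s, p.2 (u s) = Sum.elim w v.2 s := by
    intro s
    have := MeasurableEquiv.piCongrLeft_apply_apply u (β := fun _ => ℝ)
      ((MeasurableEquiv.sumPiEquivProdPi (fun _ : Fin q ⊕ UpperIndex q => ℝ)).symm (w, v.2)) s
    refine this.trans ?_
    cases s <;> rfl
  have hp2 : ∀ j : Fin q, p.2 ⟨(0, j.succ), j.succ_pos⟩ = w j := fun j => hcomp (Sum.inl j)
  have hp3 : ∀ (i j : Fin q) (h : i < j), p.2 ⟨(i.succ, j.succ), Fin.succ_lt_succ_iff.2 h⟩ =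
      v.2 ⟨(i, j), h⟩ := fun i j h => hcomp (Sum.inr ⟨(i, j), h⟩)
  ext (i | i) (j | j)
  · rcases lt_trichotomy i j with h | h | h
    · simp [symmMatrix, bordered, h, hp3 i j h]
    · simp [symmMatrix, bordered, h, hp1]
    · simp [symmMatrix, bordered, h, h.not_gt, hp3 j i h]
  · simp [symmMatrix, bordered, hp2]
  · simp [symmMatrix, bordered, hp2]
  · simp [symmMatrix, bordered, hp0]

theorem multivariateGamma_succ (q : ℕ) (α : ℝ) :
    multivariateGamma (q + 1) α =
      Real.Gamma (α - q / 2) * √Real.pi ^ q * multivariateGamma q α := by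
  have h : √Real.pi ^ q = Real.pi ^ ((q : ℝ) / 2) := by
    rw [Real.sqrt_eq_rpow, ← Real.rpow_natCast, ← Real.rpow_mul Real.pi_pos.le]
    congr 1
    ring
  rw [multivariateGamma, multivariateGamma, Fin.prod_univ_castSucc, h,
    show ((q + 1 : ℕ) : ℝ) * (((q + 1 : ℕ) : ℝ) - 1) / 4 = q / 2 + q * (q - 1) / 4 by
      push_cast; ring, Real.rpow_add Real.pi_pos]
  simp only [Fin.val_castSucc, Fin.val_last]
  ring

theorem multivariateGamma_pos {q : ℕ} {α : ℝ} (hα : (q : ℝ) - 1 < 2 * α) :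
    0 < multivariateGamma q α := by
  refine mul_pos (Real.rpow_pos_of_pos Real.pi_pos _) (Finset.prod_pos fun j _ =>
    Real.Gamma_pos_of_pos ?_)
  have : ((j : ℕ) : ℝ) + 1 ≤ q := by exact_mod_cast j.2
  linarith

/-- The integral of the Wishart density over positive definite matrices, by induction on the size.
Integrating out a column of length `q` contributes `|W|^(1/2)`, which turns the exponent
`α - (q+2)/2` for size `q + 1` into the exponent `α - (q+1)/2` for size `q`. -/
theorem lintegral_wishartWeight (q : ℕ) {A : Matrix (Fin q) (Fin q) ℝ} (hA : A.PosDef) {α : ℝ}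
    (hα : (q : ℝ) - 1 < 2 * α) :
    ∫⁻ v : SymmCoord q, wishartWeight A (α - (q + 1) / 2) (symmMatrix v) =
      ENNReal.ofReal (multivariateGamma q α * A.det ^ (-α)) := by
  induction q with
  | zero =>
    have : ∀ v : SymmCoord 0, wishartWeight A (α - ((0 : ℕ) + 1) / 2) (symmMatrix v) = 1 := by
      intro v
      have : (symmMatrix v).PosDef := by
        rw [Subsingleton.elim (symmMatrix v) 1]
        exact PosDef.one
      rw [wishartWeight, if_pos this]
      simp [trace]
    simp_rw [this]
    rw [lintegral_one, Measure.volume_eq_prod, ← Set.univ_prod_univ, Measure.prod_prod, volume_pi,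
      volume_pi, Measure.pi_univ, Measure.pi_univ]
    simp [multivariateGamma]
  | succ q ih =>
    obtain ⟨Ψ, hΨ, hmat⟩ := exists_measurePreserving_symmCoord q
    set β : ℝ := α - ((q + 1 : ℕ) + 1) / 2 with hβdef
    have hm := measurable_wishartWeight A β
    rw [← hΨ.lintegral_comp hm, Measure.volume_eq_prod, lintegral_prod_symm'
      (fun z => wishartWeight A β (symmMatrix (Ψ z))) (hm.comp hΨ.measurable)]
    set A' : Matrix (Fin q) (Fin q) ℝ := of fun i j => A i.succ j.succ
    set a : Fin q → ℝ := fun j => A 0 j.succ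
    set a₀ : ℝ := A 0 0
    have hAsub : A.submatrix (finSuccEquivSum q) (finSuccEquivSum q) = bordered A' a a₀ := by
      have hsymm : ∀ i j, A i j = A j i := fun i j => by
        conv_lhs => rw [← hA.1]
        simp
      ext (i | i) (j | j)
      · simp [bordered, A']
      · simp [bordered, a, hsymm i.succ 0]
      · simp [bordered, a]
      · simp [bordered, a₀]
    have hbord : (bordered A' a a₀).PosDef := hAsub ▸ (posDef_submatrix_equiv A _).2 hA
    obtain ⟨ha₀, hschur, hdet⟩ := bordered_schur hbord
    rw [← hAsub, det_submatrix_equiv_self] at hdet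
    have hinner : ∀ v : SymmCoord q, ∫⁻ z : ℝ × (Fin q → ℝ), wishartWeight A β
        (symmMatrix (Ψ (z, v))) = ENNReal.ofReal (Real.Gamma (β + 1) * a₀ ^ (-(β + 1)) *
        √(Real.pi / a₀) ^ Fintype.card (Fin q)) *
        wishartWeight (A' - a₀⁻¹ • vecMulVec a a) (β + 1 / 2) (symmMatrix v) := by
      intro v
      rw [← lintegral_wishartWeight_bordered ha₀ (by rw [hβdef]; push_cast at hα ⊢; linarith),
        Measure.volume_eq_prod, lintegral_prod_symm'
        (fun z => wishartWeight A β (symmMatrix (Ψ (z, v))))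
        (hm.comp (hΨ.measurable.comp measurable_prodMk_right))]
      refine lintegral_congr fun w => lintegral_congr fun y => ?_
      rw [← hmat, ← hAsub, wishartWeight_submatrix]
    simp_rw [hinner]
    have hβ2 : β + 1 / 2 = α - ((q : ℝ) + 1) / 2 := by rw [hβdef]; push_cast; ring
    have hβ1 : β + 1 = α - q / 2 := by rw [hβdef]; push_cast; ring
    have hG : 0 < Real.Gamma (α - q / 2) :=
      Real.Gamma_pos_of_pos (by push_cast at hα; linarith)
    rw [lintegral_const_mul' _ _ ENNReal.ofReal_ne_top, hβ2,
      ih hschur (by push_cast at hα; linarith), hβ1, ← ENNReal.ofReal_mul (by positivity),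
      multivariateGamma_succ, hdet, Real.mul_rpow ha₀.le hschur.det_pos.le, Fintype.card_fin]
    congr 1
    have h1 : a₀ ^ (-(α - q / 2)) * √(Real.pi / a₀) ^ q = √Real.pi ^ q * a₀ ^ (-α) := by
      rw [Real.sqrt_div Real.pi_pos.le, div_pow, Real.sqrt_eq_rpow a₀, ← Real.rpow_natCast (a₀ ^ _),
        ← Real.rpow_mul ha₀.le, mul_div_assoc', mul_comm, mul_div_assoc, ← Real.rpow_sub ha₀]
      congr 2
      ring
    linear_combination (Real.Gamma (α - q / 2) * multivariateGamma q α *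
      (A' - a₀⁻¹ • vecMulVec a a).det ^ (-α)) * h1

/-! ### Correlation coordinates -/

theorem continuous_unitDiagMatrix (q : ℕ) : Continuous (unitDiagMatrix (q := q)) :=
  (continuous_symmMatrix q).comp (f := fun c => ((1 : Fin q → ℝ), c)) (by fun_prop)

theorem unitDiagMatrix_isHermitian {q : ℕ} (c : UpperIndex q → ℝ) :
    (unitDiagMatrix c).IsHermitian := symmMatrix_isHermitian (1, c)

theorem unitDiagMatrix_affine {q : ℕ} (c c' : UpperIndex q → ℝ) {a b : ℝ} (hab : a + b = 1) :
    unitDiagMatrix (a • c + b • c') = a • unitDiagMatrix c + b • unitDiagMatrix c' := by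
  ext i j
  rcases lt_trichotomy i j with h | h | h
  · simp [unitDiagMatrix, h]
  · simp [unitDiagMatrix, h, hab]
  · simp [unitDiagMatrix, h, h.not_gt]

theorem isClosed_correlationSet (q : ℕ) : IsClosed (correlationSet q) :=
  isClosed_posSemidef_of_continuous (continuous_unitDiagMatrix q) unitDiagMatrix_isHermitian

theorem convex_correlationSet (q : ℕ) : Convex ℝ (correlationSet q) := by
  intro c hc c' hc' a b ha hb hab
  change (unitDiagMatrix _).PosSemidef
  rw [unitDiagMatrix_affine c c' hab]
  exact (PosSemidef.smul hc ha).add (PosSemidef.smul hc' hb)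

theorem unitDiagMatrix_zero (q : ℕ) : unitDiagMatrix (0 : UpperIndex q → ℝ) = 1 := by
  ext i j
  rcases lt_trichotomy i j with h | h | h
  · simp [unitDiagMatrix, h, h.ne]
  · subst h
    simp [unitDiagMatrix]
  · simp [unitDiagMatrix, h, h.not_gt, h.ne']

/-- A point in the interior of the set of correlation matrices can be pushed slightly away from the
identity matrix, so it is a proper convex combination with the identity. -/
theorem posDef_unitDiagMatrix_of_mem_interior {q : ℕ} {c : UpperIndex q → ℝ}
    (hc : c ∈ interior (correlationSet q)) : (unitDiagMatrix c).PosDef := by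
  have h1 : Filter.Tendsto (fun r : ℝ => r • c) (nhdsWithin 1 (Set.Ioi 1)) (nhds c) := by
    have : Continuous fun r : ℝ => r • c := by fun_prop
    simpa using (this.tendsto 1).mono_left nhdsWithin_le_nhds
  have h2 := h1.eventually (mem_interior_iff_mem_nhds.1 hc)
  obtain ⟨r, hr, hr1⟩ := (h2.and self_mem_nhdsWithin).exists
  have hr1' : 1 < r := hr1
  have hr0 : 0 < r := by linarith
  -- `c` lies strictly between the correlation matrix `r c` and the identity matrix
  have h3 : c = r⁻¹ • (r • c) + (1 - r⁻¹) • (0 : UpperIndex q → ℝ) := by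
    rw [smul_smul, inv_mul_cancel₀ hr0.ne', one_smul, smul_zero, add_zero]
  rw [h3, unitDiagMatrix_affine _ _ (by ring), unitDiagMatrix_zero]
  refine PosDef.posSemidef_add (PosSemidef.smul hr (inv_pos.2 hr0).le) (PosDef.smul PosDef.one ?_)
  rw [sub_pos]
  exact inv_lt_one_of_one_lt₀ hr1'

/-- The singular correlation matrices lie on the frontier of a convex set, which is null. -/
theorem ae_mem_correlationSet_iff (q : ℕ) :
    ∀ᵐ c : UpperIndex q → ℝ, c ∈ correlationSet q ↔ (unitDiagMatrix c).PosDef := by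
  have h := (convex_correlationSet q).addHaar_frontier volume
  filter_upwards [measure_eq_zero_iff_ae_notMem.1 h] with c hc
  refine ⟨fun h1 => posDef_unitDiagMatrix_of_mem_interior ?_, fun h1 => h1.posSemidef⟩
  by_contra h2
  exact hc ⟨subset_closure h1, h2⟩

/-- Every index occurs in `q - 1` of the pairs `i < j`. The extra factor avoids truncated
subtraction at `q = 0`. -/
theorem prod_upperIndex_mul (q : ℕ) (a : Fin q → ℝ) :
    (∏ p : UpperIndex q, a p.1.1 * a p.1.2) * ∏ i, a i = (∏ i, a i) ^ q := by
  induction q with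
  | zero => simp
  | succ q ih =>
    have h1 : ∏ p : UpperIndex (q + 1), a p.1.1 * a p.1.2 =
        (∏ j : Fin q, a 0 * a j.succ) * ∏ p : UpperIndex q, a p.1.1.succ * a p.1.2.succ := by
      rw [← (bijective_upperIndexSucc q).prod_comp, Fintype.prod_sum_type]
      rfl
    have h2 := ih fun i => a i.succ
    rw [h1, Fin.prod_univ_succ, Finset.prod_mul_distrib, Finset.prod_const, Finset.card_univ,
      Fintype.card_fin]
    linear_combination (a 0 ^ (q + 1) * ∏ i : Fin q, a i.succ) * h2

theorem scaleByDiag_eq_symmMatrix {q : ℕ} {x : Fin q → ℝ} (hx : x ∈ posOrthant (Fin q))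
    (c : UpperIndex q → ℝ) :
    scaleByDiag x (unitDiagMatrix c) =
      symmMatrix (x, fun p => √(x p.1.1) * √(x p.1.2) * c p) := by
  ext i j
  rw [scaleByDiag, mul_diagonal, diagonal_mul]
  rcases lt_trichotomy i j with h | h | h
  · simp [unitDiagMatrix, symmMatrix, h]
    ring
  · subst h
    simp [unitDiagMatrix, symmMatrix, Real.mul_self_sqrt (hx i).le]
  · simp [unitDiagMatrix, symmMatrix, h, h.not_gt]
    ring

theorem det_scaleByDiag {q : ℕ} {x : Fin q → ℝ} (hx : x ∈ posOrthant (Fin q))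
    (C : Matrix (Fin q) (Fin q) ℝ) : (scaleByDiag x C).det = (∏ i, x i) * C.det := by
  rw [scaleByDiag, det_mul, det_mul, det_diagonal, mul_right_comm, ← Finset.prod_mul_distrib]
  simp_rw [Real.mul_self_sqrt (hx _).le]

theorem posDef_scaleByDiag_iff {q : ℕ} {x : Fin q → ℝ} (hx : x ∈ posOrthant (Fin q))
    (C : Matrix (Fin q) (Fin q) ℝ) : (scaleByDiag x C).PosDef ↔ C.PosDef := by
  have hU : IsUnit (diagonal fun j => √(x j)) := by
    rw [isUnit_iff_isUnit_det, det_diagonal, isUnit_iff_ne_zero]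
    exact (Finset.prod_pos fun i _ => Real.sqrt_pos.2 (hx i)).ne'
  have h := IsUnit.posDef_star_right_conjugate_iff (x := C) hU
  rwa [star_eq_conjTranspose, diagonal_conjTranspose, star_trivial] at h

/-- The Wishart density `etr(-A M) |M|^{α-(q+1)/2} dM` in the coordinates `(x, C)` with
`M = X^{1/2} C X^{1/2}`. The exponent of `|X|` includes the Jacobian `|X|^{(q-1)/2}`. -/
noncomputable def corrWishart {q : ℕ} (A : Matrix (Fin q) (Fin q) ℝ) (α : ℝ)
    (z : SymmCoord q) : ℝ :=
  Real.exp (-(A * scaleByDiag z.1 (unitDiagMatrix z.2)).trace) * (∏ i, z.1 i) ^ (α - 1) *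
    (unitDiagMatrix z.2).det ^ (α - ((q : ℝ) + 1) / 2)

/-- For fixed diagonal `x`, passing from covariances `w` to correlations `c` has Jacobian
`∏_{i<j} √(xᵢ xⱼ) = |X|^((q-1)/2)`. -/
theorem lintegral_wishartWeight_fiber {q : ℕ} (A : Matrix (Fin q) (Fin q) ℝ) (α : ℝ)
    {x : Fin q → ℝ} (hx : x ∈ posOrthant (Fin q)) :
    ∫⁻ w : UpperIndex q → ℝ, wishartWeight A (α - ((q : ℝ) + 1) / 2) (symmMatrix (x, w)) =
      ∫⁻ c in correlationSet q, ENNReal.ofReal (corrWishart A α (x, c)) := by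
  set s : UpperIndex q → ℝ := fun p => √(x p.1.1) * √(x p.1.2) with hs
  have hspos : ∀ p, 0 < s p := fun p => mul_pos (Real.sqrt_pos.2 (hx _)) (Real.sqrt_pos.2 (hx _))
  have hdet : (diagonal s).det = ∏ p, s p := det_diagonal
  have hprod : 0 < ∏ p, s p := Finset.prod_pos fun p _ => hspos p
  have hX : 0 < ∏ i, x i := Finset.prod_pos fun i _ => hx i
  have hmeas : Measurable fun w : UpperIndex q → ℝ =>
      wishartWeight A (α - ((q : ℝ) + 1) / 2) (symmMatrix (x, w)) :=
    (measurable_wishartWeight A _).comp (measurable_const.prodMk measurable_id)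
  have hvol := Real.smul_map_diagonal_volume_pi (D := s) (by rw [hdet]; exact hprod.ne')
  have hLm : Measurable (toLin' (diagonal s)) :=
    (LinearMap.continuous_of_finiteDimensional _).measurable
  rw [hdet, abs_of_pos hprod] at hvol
  conv_lhs => rw [← hvol]
  rw [lintegral_smul_measure, lintegral_map hmeas hLm,
    smul_eq_mul, ← lintegral_const_mul' _ _ ENNReal.ofReal_ne_top,
    ← lintegral_indicator (isClosed_correlationSet q).measurableSet]
  have hjac : ∏ p, s p = (∏ i, x i) ^ (((q : ℝ) - 1) / 2) := by
    have h1 := prod_upperIndex_mul q fun i => √(x i)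
    have h2 : ∏ i, √(x i) = (∏ i, x i) ^ (1 / 2 : ℝ) := by
      rw [← Real.finsetProd_rpow _ _ fun i _ => (hx i).le]
      simp_rw [Real.sqrt_eq_rpow]
    rw [h2, ← Real.rpow_mul_natCast hX.le] at h1
    rw [show ((q : ℝ) - 1) / 2 = 1 / 2 * q - 1 / 2 by ring, Real.rpow_sub hX, ← h1,
      mul_div_cancel_right₀ _ (Real.rpow_pos_of_pos hX _).ne']
  refine lintegral_congr_ae ?_
  filter_upwards [ae_mem_correlationSet_iff q] with c hc
  have hlin : toLin' (diagonal s) c = fun p => s p * c p := by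
    ext p
    rw [toLin'_apply, mulVec_diagonal]
  rw [hlin, hs, ← scaleByDiag_eq_symmMatrix hx, wishartWeight]
  by_cases hC : (unitDiagMatrix c).PosDef
  · rw [if_pos ((posDef_scaleByDiag_iff hx _).2 hC), Set.indicator_of_mem (hc.2 hC),
      ← ENNReal.ofReal_mul hprod.le, corrWishart, det_scaleByDiag hx,
      Real.mul_rpow hX.le hC.det_pos.le, hjac]
    congr 1
    have : (∏ i, x i) ^ (α - 1) =
        (∏ i, x i) ^ (((q : ℝ) - 1) / 2) * (∏ i, x i) ^ (α - ((q : ℝ) + 1) / 2) := by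
      rw [← Real.rpow_add hX]
      congr 1
      ring
    rw [this]
    ring
  · rw [if_neg fun h => hC ((posDef_scaleByDiag_iff hx _).1 h),
      Set.indicator_of_notMem fun h => hC (hc.1 h), mul_zero]

theorem lintegral_corrWishart (q : ℕ) {A : Matrix (Fin q) (Fin q) ℝ} (hA : A.PosDef) {α : ℝ}
    (hα : (q : ℝ) - 1 < 2 * α) :
    ∫⁻ x in posOrthant (Fin q), ∫⁻ c in correlationSet q,
        ENNReal.ofReal (corrWishart A α (x, c)) =
      ENNReal.ofReal (multivariateGamma q α * A.det ^ (-α)) := by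
  rw [← lintegral_wishartWeight q hA hα, Measure.volume_eq_prod, lintegral_prod _
    (measurable_wishartWeight A _).aemeasurable,
    ← lintegral_indicator isOpen_posOrthant.measurableSet]
  refine lintegral_congr fun x => ?_
  by_cases hx : x ∈ posOrthant (Fin q)
  · rw [Set.indicator_of_mem hx, lintegral_wishartWeight_fiber A α hx]
  · rw [Set.indicator_of_notMem hx]
    symm
    refine lintegral_eq_zero_of_ae_eq_zero (Filter.Eventually.of_forall fun w => if_neg fun h => hx
      fun i => ?_)
    have := h.diag_pos (i := i)
    simpa [symmMatrix] using this

theorem continuous_scaleByDiag (q : ℕ) :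
    Continuous fun z : SymmCoord q => scaleByDiag z.1 (unitDiagMatrix z.2) := by
  have h1 : Continuous fun z : SymmCoord q => unitDiagMatrix z.2 :=
    (continuous_unitDiagMatrix q).comp continuous_snd
  have h3 : Continuous fun z : SymmCoord q => diagonal fun j => √(z.1 j) :=
    Continuous.matrix_diagonal (by fun_prop)
  exact (h3.mul h1).mul h3

theorem measurable_corrWishart {q : ℕ} (A : Matrix (Fin q) (Fin q) ℝ) (α : ℝ) :
    Measurable (corrWishart A α) := by
  refine Measurable.mul (Measurable.mul ?_ ?_) ?_
  · exact (Real.continuous_exp.comp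
      (continuous_const.mul (continuous_scaleByDiag q)).matrix_trace.neg).measurable
  · exact Measurable.pow_const (by fun_prop) _
  · exact ((continuous_unitDiagMatrix q).comp
      continuous_snd).matrix_det.measurable.pow_const _

theorem corrWishart_nonneg {q : ℕ} (A : Matrix (Fin q) (Fin q) ℝ) (α : ℝ) {x : Fin q → ℝ}
    (hx : x ∈ posOrthant (Fin q)) {c : UpperIndex q → ℝ} (hc : c ∈ correlationSet q) :
    0 ≤ corrWishart A α (x, c) :=
  mul_nonneg (mul_nonneg (Real.exp_pos _).le
    (Real.rpow_nonneg (Finset.prod_nonneg fun i _ => (hx i).le) _))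
    (Real.rpow_nonneg (PosSemidef.det_nonneg hc) _)

theorem integral_corrWishart (q : ℕ) {A : Matrix (Fin q) (Fin q) ℝ} (hA : A.PosDef) {α : ℝ}
    (hα : (q : ℝ) - 1 < 2 * α) :
    ∫ z, corrWishart A α z ∂((volume.restrict (posOrthant (Fin q))).prod
      (volume.restrict (correlationSet q))) = multivariateGamma q α * A.det ^ (-α) := by
  have hpos : 0 ≤ multivariateGamma q α * A.det ^ (-α) :=
    mul_nonneg (multivariateGamma_pos hα).le (Real.rpow_nonneg hA.det_pos.le _)
  rw [integral_eq_lintegral_of_nonneg_ae, lintegral_prod, lintegral_corrWishart q hA hα,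
    ENNReal.toReal_ofReal hpos]
  · exact (measurable_corrWishart A α).ennreal_ofReal.aemeasurable
  · rw [Measure.prod_restrict]
    filter_upwards [ae_restrict_mem (isOpen_posOrthant.measurableSet.prod
      (isClosed_correlationSet q).measurableSet)] with z hz
    exact corrWishart_nonneg A α hz.1 hz.2
  · exact (measurable_corrWishart A α).aestronglyMeasurable

theorem trace_scaleByDiag {q : ℕ} {x : Fin q → ℝ} (hx : x ∈ posOrthant (Fin q))
    (c : UpperIndex q → ℝ) : (scaleByDiag x (unitDiagMatrix c)).trace = ∑ i, x i := by
  rw [scaleByDiag_eq_symmMatrix hx]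
  simp [trace, symmMatrix]

/-- Integrability of `|C|^(α-(q+1)/2)`. In the finite Wishart integral with `A = 1`, the
trace does not depend on `C`, so this function splits off as a factor. -/
theorem integrableOn_det_rpow (q : ℕ) {α : ℝ} (hα : (q : ℝ) - 1 < 2 * α) :
    IntegrableOn (fun c => (unitDiagMatrix c).det ^ (α - ((q : ℝ) + 1) / 2))
      (correlationSet q) := by
  have hmeas : Measurable fun c : UpperIndex q → ℝ =>
      (unitDiagMatrix c).det ^ (α - ((q : ℝ) + 1) / 2) :=
    (continuous_unitDiagMatrix q).matrix_det.measurable.pow_const _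
  have h := lintegral_corrWishart q (PosDef.one (n := Fin q) (R := ℝ)) hα
  set J := ∫⁻ c in correlationSet q,
    ENNReal.ofReal ((unitDiagMatrix c).det ^ (α - ((q : ℝ) + 1) / 2)) with hJ
  let k : (Fin q → ℝ) → ℝ := fun x => Real.exp (-∑ i, x i) * (∏ i, x i) ^ (α - 1)
  have hkm : Measurable k := by
    refine Measurable.mul (by fun_prop) (Measurable.pow_const (by fun_prop) _)
  have hkpos : ∀ x ∈ posOrthant (Fin q), 0 < k x := fun x hx =>
    mul_pos (Real.exp_pos _) (Real.rpow_pos_of_pos (Finset.prod_pos fun i _ => hx i) _)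
  have h1 : ∫⁻ x in posOrthant (Fin q), ∫⁻ c in correlationSet q,
      ENNReal.ofReal (corrWishart 1 α (x, c)) =
      (∫⁻ x in posOrthant (Fin q), ENNReal.ofReal (k x)) * J := by
    rw [← lintegral_mul_const _ hkm.ennreal_ofReal]
    refine setLIntegral_congr_fun isOpen_posOrthant.measurableSet fun x hx => ?_
    rw [hJ, ← lintegral_const_mul _ hmeas.ennreal_ofReal]
    refine lintegral_congr fun c => ?_
    rw [← ENNReal.ofReal_mul (hkpos x hx).le, corrWishart, Matrix.one_mul, trace_scaleByDiag hx]
  rw [h1] at h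
  have h2 : ∫⁻ x in posOrthant (Fin q), ENNReal.ofReal (k x) ≠ 0 := by
    intro h0
    rw [lintegral_eq_zero_iff hkm.ennreal_ofReal] at h0
    have h3 : ∀ᵐ x ∂(volume.restrict (posOrthant (Fin q))), False := by
      filter_upwards [h0, ae_restrict_mem isOpen_posOrthant.measurableSet] with x hx hx'
      exact (ENNReal.ofReal_pos.2 (hkpos x hx')).ne' hx
    have h4 : volume.restrict (posOrthant (Fin q)) = 0 := by
      rw [← ae_eq_bot]
      exact Filter.eventually_false_iff_eq_bot.1 h3
    rw [Measure.restrict_eq_zero] at h4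
    exact isOpen_posOrthant.measure_ne_zero volume ⟨fun _ => 1, fun _ => one_pos⟩ h4
  have hJfin : J ≠ ⊤ := by
    intro htop
    rw [htop, ENNReal.mul_top h2] at h
    exact ENNReal.ofReal_ne_top h.symm
  refine ⟨hmeas.aestronglyMeasurable, ?_⟩
  rw [hasFiniteIntegral_iff_ofReal]
  · exact hJfin.lt_top
  · filter_upwards [ae_restrict_mem (isClosed_correlationSet q).measurableSet] with c hc
    exact Real.rpow_nonneg (PosSemidef.det_nonneg hc) _

/-- The entries of a correlation matrix are bounded by `1`, by positivity on `eᵢ ± eⱼ`. -/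
theorem isCompact_correlationSet (q : ℕ) : IsCompact (correlationSet q) := by
  refine Metric.isCompact_of_isClosed_isBounded (isClosed_correlationSet q)
    ((Metric.isBounded_closedBall (x := 0) (r := 1)).subset fun c hc => ?_)
  rw [mem_closedBall_zero_iff, pi_norm_le_iff_of_nonneg zero_le_one]
  rintro ⟨⟨i, j⟩, h⟩
  have hne : i ≠ j := ne_of_lt h
  have hq : ∀ s : ℝ, 0 ≤ 1 + 2 * (s * c ⟨(i, j), h⟩) + s * s := by
    intro s
    have h1 := PosSemidef.dotProduct_mulVec_nonneg hc (Pi.single i 1 + Pi.single j s)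
    have hij : unitDiagMatrix c i j = c ⟨(i, j), h⟩ := by
      have : i < j := h
      simp [unitDiagMatrix, this]
    have hji : unitDiagMatrix c j i = c ⟨(i, j), h⟩ := by
      have : i < j := h
      simp [unitDiagMatrix, this, this.not_gt]
    have hd : ∀ k, unitDiagMatrix c k k = 1 := fun k => by simp [unitDiagMatrix]
    simp only [star_trivial, mulVec_add, dotProduct_add, add_dotProduct, mulVec_single,
      single_dotProduct] at h1
    simp [hij, hji, hd] at h1
    linarith
  have h1 := hq 1
  have h2 := hq (-1)
  rw [Real.norm_eq_abs, abs_le]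
  constructor <;> linarith

/-! ### The mixture over correlation matrices -/

theorem corrWishart_add {q : ℕ} (A E : Matrix (Fin q) (Fin q) ℝ) (α : ℝ) (z : SymmCoord q) :
    corrWishart (A + E) α z =
      Real.exp (-(E * scaleByDiag z.1 (unitDiagMatrix z.2)).trace) * corrWishart A α z := by
  rw [corrWishart, corrWishart, Matrix.add_mul, trace_add, neg_add, Real.exp_add]
  ring

/-- A diagonal matrix pairs with `X^{1/2} C X^{1/2}` through the diagonal `x` only, so that adding
`diag(t)` to the Wishart parameter amounts to a Laplace transform in `x`. -/
theorem trace_diagonal_mul_scaleByDiag {q : ℕ} (s : Fin q → ℝ) {x : Fin q → ℝ}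
    (hx : x ∈ posOrthant (Fin q)) (c : UpperIndex q → ℝ) :
    (diagonal s * scaleByDiag x (unitDiagMatrix c)).trace = ∑ i, s i * x i := by
  rw [scaleByDiag_eq_symmMatrix hx]
  simp [trace, symmMatrix, diagonal_mul]

/-- The integral is nonzero, and the Bochner integral of a non-integrable function is zero. -/
theorem integrable_corrWishart (q : ℕ) {A : Matrix (Fin q) (Fin q) ℝ} (hA : A.PosDef) {α : ℝ}
    (hα : (q : ℝ) - 1 < 2 * α) :
    Integrable (corrWishart A α) ((volume.restrict (posOrthant (Fin q))).prod
      (volume.restrict (correlationSet q))) := by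
  refine not_imp_comm.1 integral_undef ?_
  rw [integral_corrWishart q hA hα]
  exact (mul_pos (multivariateGamma_pos hα) (Real.rpow_pos_of_pos hA.det_pos _)).ne'

open scoped Matrix.Norms.L2Operator in
theorem exists_norm_conj_scaleByDiag_le {m : Type*} [Fintype m] [DecidableEq m] {q : ℕ}
    (P : Matrix m (Fin q) ℝ) (P' : Matrix (Fin q) m ℝ) :
    ∃ N : ℝ, 0 ≤ N ∧ ∀ x ∈ posOrthant (Fin q), ∀ c ∈ correlationSet q,
      ‖P * scaleByDiag x (unitDiagMatrix c) * P'‖ ≤ N * ∑ i, x i := by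
  obtain ⟨M, hM⟩ := (isCompact_correlationSet q).exists_bound_of_continuousOn
    (continuous_unitDiagMatrix q).continuousOn
  refine ⟨‖P‖ * |M| * ‖P'‖, by positivity, fun x hx c hc => ?_⟩
  have hsum : 0 ≤ ∑ i, x i := Finset.sum_nonneg fun i _ => (hx i).le
  have hd : ‖(diagonal fun j => √(x j) : Matrix (Fin q) (Fin q) ℝ)‖ ≤ √(∑ i, x i) := by
    rw [l2_opNorm_diagonal, pi_norm_le_iff_of_nonneg (Real.sqrt_nonneg _)]
    intro i
    rw [Real.norm_of_nonneg (Real.sqrt_nonneg _)]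
    exact Real.sqrt_le_sqrt (Finset.single_le_sum (fun j _ => (hx j).le) (Finset.mem_univ i))
  calc ‖P * scaleByDiag x (unitDiagMatrix c) * P'‖
      ≤ ‖P‖ * ‖scaleByDiag x (unitDiagMatrix c)‖ * ‖P'‖ :=
        (l2_opNorm_mul _ _).trans (by gcongr; exact l2_opNorm_mul _ _)
    _ ≤ ‖P‖ * (√(∑ i, x i) * |M| * √(∑ i, x i)) * ‖P'‖ := by
        gcongr
        refine (l2_opNorm_mul _ _).trans ?_
        gcongr
        refine (l2_opNorm_mul _ _).trans ?_
        gcongr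
        exact (hM c hc).trans (le_abs_self M)
    _ = ‖P‖ * |M| * ‖P'‖ * (√(∑ i, x i) * √(∑ i, x i)) := by ring
    _ = _ := by rw [Real.mul_self_sqrt hsum]

/-- Continuity of an integral over a compact set against a fixed integrable weight. -/
theorem continuousOn_setIntegral_mul {X Y : Type*} [TopologicalSpace X] [FirstCountableTopology X]
    [LocallyCompactSpace X] [TopologicalSpace Y] [MeasurableSpace Y] [OpensMeasurableSpace Y]
    [SecondCountableTopology Y] {μ : Measure Y} {U : Set X} (hU : IsOpen U) {k : Set Y}
    (hk : IsCompact k) (hkm : MeasurableSet k) {H : X → Y → ℝ}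
    (hH : ContinuousOn (fun p : X × Y => H p.1 p.2) (U ×ˢ k)) {w : Y → ℝ}
    (hw : IntegrableOn w k μ) :
    ContinuousOn (fun x => ∫ y in k, H x y * w y ∂μ) U := by
  intro x₀ hx₀
  obtain ⟨V, hV, hVU, hVc⟩ := local_compact_nhds (hU.mem_nhds hx₀)
  obtain ⟨M, hM⟩ := (hVc.prod hk).exists_bound_of_continuousOn
    (hH.mono (Set.prod_mono hVU subset_rfl))
  refine (continuousAt_of_dominated (bound := fun y => M * ‖w y‖) ?_ ?_
    (hw.norm.const_mul M) ?_).continuousWithinAt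
  · filter_upwards [hV] with x hx
    refine AEStronglyMeasurable.mul ?_ hw.aestronglyMeasurable
    exact (hH.comp (f := fun y => (x, y)) (by fun_prop)
      fun y hy => ⟨hVU hx, hy⟩).aestronglyMeasurable hkm
  · filter_upwards [hV] with x hx
    filter_upwards [ae_restrict_mem hkm] with y hy
    rw [norm_mul]
    gcongr
    exact hM (x, y) ⟨hx, hy⟩
  · filter_upwards [ae_restrict_mem hkm] with y hy
    refine ContinuousAt.mul ?_ continuousAt_const
    refine (hH.comp (f := fun x => (x, y)) (by fun_prop)
      fun x hx => ⟨hx, hy⟩).continuousAt (hU.mem_nhds hx₀)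

section
variable {p₁ p₂ : ℕ}

/-- The integrand of the mixture: the density `G` at non-centrality `P X^{1/2} C X^{1/2} P'`
weighted by the Wishart density. -/
noncomputable def mixtureIntegrand (G : (Fin p₁ → ℝ) → Matrix (Fin p₁) (Fin p₁) ℝ → ℝ)
    (P : Matrix (Fin p₁) (Fin p₂) ℝ) (P' : Matrix (Fin p₂) (Fin p₁) ℝ)
    (B : Matrix (Fin p₂) (Fin p₂) ℝ) (α : ℝ) (x₁ : Fin p₁ → ℝ) (z : SymmCoord p₂) : ℝ :=
  G x₁ (P * scaleByDiag z.1 (unitDiagMatrix z.2) * P') * corrWishart B α z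

variable {G : (Fin p₁ → ℝ) → Matrix (Fin p₁) (Fin p₁) ℝ → ℝ}
  (P : Matrix (Fin p₁) (Fin p₂) ℝ) (P' : Matrix (Fin p₂) (Fin p₁) ℝ)
  (B : Matrix (Fin p₂) (Fin p₂) ℝ) {α : ℝ}

theorem continuousOn_mixture_density
    (hG : ContinuousOn (fun p : (Fin p₁ → ℝ) × Matrix (Fin p₁) (Fin p₁) ℝ => G p.1 p.2)
      (posOrthant (Fin p₁) ×ˢ Set.univ)) :
    ContinuousOn (fun p : (Fin p₁ → ℝ) × SymmCoord p₂ =>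
      G p.1 (P * scaleByDiag p.2.1 (unitDiagMatrix p.2.2) * P'))
      (posOrthant (Fin p₁) ×ˢ Set.univ) := by
  have h : Continuous fun z : SymmCoord p₂ => P * scaleByDiag z.1 (unitDiagMatrix z.2) * P' :=
    (continuous_const.matrix_mul (continuous_scaleByDiag p₂)).matrix_mul continuous_const
  exact hG.comp (f := fun p : (Fin p₁ → ℝ) × SymmCoord p₂ =>
    (p.1, P * scaleByDiag p.2.1 (unitDiagMatrix p.2.2) * P'))
    (continuous_fst.prodMk (h.comp continuous_snd)).continuousOn fun p hp => ⟨hp.1, trivial⟩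

/-- The factor of the mixture integrand that is continuous up to the boundary of the set of
correlation matrices. -/
theorem continuousOn_mixture_factor
    (hG : ContinuousOn (fun p : (Fin p₁ → ℝ) × Matrix (Fin p₁) (Fin p₁) ℝ => G p.1 p.2)
      (posOrthant (Fin p₁) ×ˢ Set.univ)) :
    ContinuousOn (fun p : ((Fin p₁ → ℝ) × (Fin p₂ → ℝ)) × (UpperIndex p₂ → ℝ) =>
      G p.1.1 (P * scaleByDiag p.1.2 (unitDiagMatrix p.2) * P') *
        (Real.exp (-(B * scaleByDiag p.1.2 (unitDiagMatrix p.2)).trace) *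
          (∏ i, p.1.2 i) ^ (α - 1)))
      ((posOrthant (Fin p₁) ×ˢ posOrthant (Fin p₂)) ×ˢ correlationSet p₂) := by
  refine ContinuousOn.mul ?_ (ContinuousOn.mul (Continuous.continuousOn ?_) ?_)
  · exact (continuousOn_mixture_density P P' hG).comp
      (f := fun p : ((Fin p₁ → ℝ) × (Fin p₂ → ℝ)) × (UpperIndex p₂ → ℝ) => (p.1.1, (p.1.2, p.2)))
      (by fun_prop) fun p hp => ⟨hp.1.1, trivial⟩
  · have h : Continuous fun p : ((Fin p₁ → ℝ) × (Fin p₂ → ℝ)) × (UpperIndex p₂ → ℝ) =>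
        scaleByDiag p.1.2 (unitDiagMatrix p.2) :=
      (continuous_scaleByDiag p₂).comp (f := fun p : ((Fin p₁ → ℝ) × (Fin p₂ → ℝ)) ×
        (UpperIndex p₂ → ℝ) => (p.1.2, p.2)) (by fun_prop)
    exact Real.continuous_exp.comp (continuous_const.matrix_mul h).matrix_trace.neg
  · refine ContinuousOn.rpow_const (by fun_prop) fun p hp => Or.inl ?_
    exact (Finset.prod_pos fun i _ => hp.1.2 i).ne'

theorem integrableOn_mixtureIntegrand
    (hG : ContinuousOn (fun p : (Fin p₁ → ℝ) × Matrix (Fin p₁) (Fin p₁) ℝ => G p.1 p.2)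
      (posOrthant (Fin p₁) ×ˢ Set.univ)) (hα : (p₂ : ℝ) - 1 < 2 * α)
    {x₁ : Fin p₁ → ℝ} (hx₁ : x₁ ∈ posOrthant (Fin p₁)) {x₂ : Fin p₂ → ℝ}
    (hx₂ : x₂ ∈ posOrthant (Fin p₂)) :
    IntegrableOn (fun c => mixtureIntegrand G P P' B α x₁ (x₂, c)) (correlationSet p₂) := by
  have h := (integrableOn_det_rpow p₂ hα).continuousOn_mul
    ((continuousOn_mixture_factor P P' B (α := α) hG).comp (f := fun c => ((x₁, x₂), c))
      (by fun_prop) fun c hc => ⟨⟨hx₁, hx₂⟩, hc⟩) (isCompact_correlationSet p₂)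
  refine h.congr_fun (fun c _ => ?_) (isClosed_correlationSet p₂).measurableSet
  simp only [mixtureIntegrand, corrWishart, Function.comp_apply]
  ring

theorem continuousOn_mixture
    (hG : ContinuousOn (fun p : (Fin p₁ → ℝ) × Matrix (Fin p₁) (Fin p₁) ℝ => G p.1 p.2)
      (posOrthant (Fin p₁) ×ˢ Set.univ)) (hα : (p₂ : ℝ) - 1 < 2 * α) :
    ContinuousOn (fun x : (Fin p₁ → ℝ) × (Fin p₂ → ℝ) =>
      ∫ c in correlationSet p₂, mixtureIntegrand G P P' B α x.1 (x.2, c))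
      (posOrthant (Fin p₁) ×ˢ posOrthant (Fin p₂)) := by
  have h := continuousOn_setIntegral_mul (isOpen_posOrthant.prod isOpen_posOrthant)
    (isCompact_correlationSet p₂) (isClosed_correlationSet p₂).measurableSet
    (H := fun (x : (Fin p₁ → ℝ) × (Fin p₂ → ℝ)) (c : UpperIndex p₂ → ℝ) =>
      G x.1 (P * scaleByDiag x.2 (unitDiagMatrix c) * P') *
        (Real.exp (-(B * scaleByDiag x.2 (unitDiagMatrix c)).trace) * (∏ i, x.2 i) ^ (α - 1)))
    (continuousOn_mixture_factor P P' B (α := α) hG) (integrableOn_det_rpow p₂ hα)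
  refine h.congr fun x _ => ?_
  refine integral_congr_ae (Filter.Eventually.of_forall fun c => ?_)
  simp only [mixtureIntegrand, corrWishart]
  ring

end

/-! ### Elimination of the second block -/

section
variable {m n : Type*} [Fintype m] [DecidableEq m] [Fintype n] [DecidableEq n]

theorem det_one_add_mul_diagonal_pos {S : Matrix m m ℝ} (hS : S.PosDef) {t : m → ℝ}
    (ht : ∀ i, 0 ≤ t i) : 0 < (1 + S * diagonal t).det := by
  have h : 1 + S * diagonal t = S * (S⁻¹ + diagonal t) := by
    rw [Matrix.mul_add, mul_nonsing_inv _ (isUnit_iff_ne_zero.2 hS.det_pos.ne')]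
  rw [h, det_mul]
  exact mul_pos hS.det_pos (hS.inv.add_posSemidef (PosSemidef.diagonal ht)).det_pos

/-- With `T = diag(t)` and `M = 1 + S T`, the matrix `T M⁻¹` is congruent by `M⁻¹` to
`Mᵀ T = T + T S T`. -/
theorem posSemidef_diagonal_mul_inv {S : Matrix m m ℝ} (hS : S.PosDef) {t : m → ℝ}
    (ht : ∀ i, 0 ≤ t i) : (diagonal t * (1 + S * diagonal t)⁻¹).PosSemidef := by
  have hu : IsUnit (1 + S * diagonal t).det :=
    isUnit_iff_ne_zero.2 (det_one_add_mul_diagonal_pos hS ht).ne'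
  have hT : (diagonal t)ᴴ = diagonal t := by simp
  have h1 : ((1 + S * diagonal t)ᴴ * diagonal t).PosSemidef := by
    have h2 := (PosSemidef.diagonal ht).add (hS.posSemidef.conjTranspose_mul_mul_same (diagonal t))
    rw [hT] at h2
    rwa [conjTranspose_add, conjTranspose_mul, hT, hS.1.eq, conjTranspose_one, Matrix.add_mul,
      Matrix.one_mul]
  have h3 := h1.conjTranspose_mul_mul_same (1 + S * diagonal t)⁻¹
  rwa [← Matrix.mul_assoc, ← conjTranspose_mul, mul_nonsing_inv _ hu, conjTranspose_one,
    Matrix.one_mul] at h3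

omit [Fintype m] [DecidableEq m] [Fintype n] [DecidableEq n] in
theorem posDef_toBlocks₂₂ {S : Matrix (m ⊕ n) (m ⊕ n) ℝ} (hS : S.PosDef) : S.toBlocks₂₂.PosDef :=
  hS.submatrix (e := Sum.inr) Sum.inr_injective

omit [Fintype m] [DecidableEq m] [Fintype n] [DecidableEq n] in
theorem transpose_toBlocks₁₂ {S : Matrix (m ⊕ n) (m ⊕ n) ℝ} (hS : S.PosDef) :
    S.toBlocks₁₂ᵀ = S.toBlocks₂₁ := by
  ext i j
  simpa [toBlocks₁₂, toBlocks₂₁] using (hS.1.apply (Sum.inr i) (Sum.inl j))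

omit [Fintype m] [DecidableEq m] in
/-- The factors on the two sides of `X^{1/2} C X^{1/2}` in the non-centrality matrix are transposes
of each other. -/
theorem transpose_regression {S : Matrix (m ⊕ n) (m ⊕ n) ℝ} (hS : S.PosDef) :
    (S.toBlocks₁₂ * S.toBlocks₂₂⁻¹)ᵀ = S.toBlocks₂₂⁻¹ * S.toBlocks₂₁ := by
  have h : (S.toBlocks₂₂⁻¹)ᵀ = S.toBlocks₂₂⁻¹ := (posDef_toBlocks₂₂ hS).inv.1
  rw [transpose_mul, transpose_toBlocks₁₂ hS, h]

theorem posDef_schurComplement {S : Matrix (m ⊕ n) (m ⊕ n) ℝ} (hS : S.PosDef) :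
    (schurComplement S).PosDef := by
  have hD := posDef_toBlocks₂₂ hS
  have := hD.isUnit.invertible
  have h12 : S.toBlocks₁₂ᴴ = S.toBlocks₂₁ := transpose_toBlocks₁₂ hS
  have hpsd : (schurComplement S).PosSemidef := by
    have h := (PosDef.fromBlocks₂₂ S.toBlocks₁₁ S.toBlocks₁₂ hD).1
      (by rw [h12, fromBlocks_toBlocks]; exact hS.posSemidef)
    rwa [h12] at h
  refine hpsd.posDef_iff_det_ne_zero.2 fun h0 => hS.det_pos.ne' ?_
  rw [← fromBlocks_toBlocks S, det_fromBlocks₂₂, invOf_eq_nonsing_inv]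
  exact mul_eq_zero_of_right _ h0

/-- Elimination of the second block: the determinant in the transform of `Γ(α, S)` splits into
the one for the Schur complement and one of Wishart type. -/
theorem det_one_add_mul_diagonal {S : Matrix (m ⊕ n) (m ⊕ n) ℝ} (hS : S.PosDef) {t₁ : m → ℝ}
    (t₂ : n → ℝ) (ht₁ : ∀ i, 0 ≤ t₁ i) :
    (1 + S * diagonal (Sum.elim t₁ t₂)).det =
      (1 + schurComplement S * diagonal t₁).det * (S.toBlocks₂₂.det *
        (S.toBlocks₂₂⁻¹ + (diagonal t₂ + (S.toBlocks₁₂ * S.toBlocks₂₂⁻¹)ᵀ *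
          (diagonal t₁ * (1 + schurComplement S * diagonal t₁)⁻¹) *
            (S.toBlocks₁₂ * S.toBlocks₂₂⁻¹))).det) := by
  have hu := isUnit_iff_ne_zero.2 (posDef_toBlocks₂₂ hS).det_pos.ne'
  have hM0 := isUnit_iff_ne_zero.2
    (det_one_add_mul_diagonal_pos (posDef_schurComplement hS) ht₁).ne'
  rw [transpose_regression hS]
  have hS' : S = fromBlocks S.toBlocks₁₁ S.toBlocks₁₂ S.toBlocks₂₁ S.toBlocks₂₂ :=
    (fromBlocks_toBlocks S).symm
  have hsc : schurComplement S =
    S.toBlocks₁₁ - S.toBlocks₁₂ * S.toBlocks₂₂⁻¹ * S.toBlocks₂₁ := rfl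
  set Q := schurComplement S
  set A := S.toBlocks₁₁
  set B := S.toBlocks₁₂
  set C := S.toBlocks₂₁
  set D := S.toBlocks₂₂
  -- left multiplication by a unipotent block matrix turns the first diagonal block into that of
  -- the Schur complement
  have hM : fromBlocks 1 (-(B * D⁻¹)) 0 1 * (1 + S * diagonal (Sum.elim t₁ t₂)) =
      fromBlocks (1 + Q * diagonal t₁) (-(B * D⁻¹)) (C * diagonal t₁) (1 + D * diagonal t₂) := by
    rw [hS', ← fromBlocks_diagonal, ← fromBlocks_one, fromBlocks_multiply, fromBlocks_add,
      fromBlocks_multiply, hsc]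
    congr 1
    · simp [Matrix.add_mul, Matrix.mul_assoc, sub_eq_add_neg, add_assoc]
    · have h : B * D⁻¹ * (D * diagonal t₂) = B * diagonal t₂ := by
        rw [← Matrix.mul_assoc, nonsing_inv_mul_cancel_right _ _ hu]
      simp [Matrix.mul_add, h]
    · simp
    · simp
  have hdet := congrArg det hM
  have hinv := (1 + Q * diagonal t₁).invertibleOfIsUnitDet hM0
  rw [det_mul, det_fromBlocks_zero₂₁, det_one, det_one, one_mul, one_mul, det_fromBlocks₁₁,
    invOf_eq_nonsing_inv] at hdet
  rw [hdet, ← det_mul]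
  congr 2
  have h1 : ∀ X : Matrix n n ℝ, D * (D⁻¹ * X) = X := fun X => mul_nonsing_inv_cancel_left _ _ hu
  simp only [Matrix.mul_add, Matrix.mul_assoc, h1, mul_nonsing_inv _ hu, Matrix.mul_neg,
    sub_neg_eq_add, add_assoc]

end

/-! ### The Laplace transform of the mixture -/

section
open scoped Matrix.Norms.L2Operator

variable {p₁ p₂ : ℕ} {G : (Fin p₁ → ℝ) → Matrix (Fin p₁) (Fin p₁) ℝ → ℝ} {K : (Fin p₁ → ℝ) → ℝ}
  {κ α : ℝ} {R : Matrix (Fin p₁) (Fin p₁) ℝ} {B : Matrix (Fin p₂) (Fin p₂) ℝ}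

/-- The Laplace transform of the mixture as an integral over `x₁`, `x₂` and the correlations. The
integral over `x₁` turns the non-central density into `etr(-T₁ (1 + R T₁)⁻¹ P M Pᵀ)` with
`M = X^{1/2} C X^{1/2}`, which together with `e^(-t₂ · x₂)` only shifts the parameter `B` of the
Wishart density. The bound on `G` makes the integral converge absolutely once `t₂` is large. -/
theorem exists_laplace_mixtureIntegrand (hκ : 0 ≤ κ)
    (hG : ContinuousOn (fun p : (Fin p₁ → ℝ) × Matrix (Fin p₁) (Fin p₁) ℝ => G p.1 p.2)
      (posOrthant (Fin p₁) ×ˢ Set.univ)) (hK : IntegrableOn K (posOrthant (Fin p₁)))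
    (hbound : ∀ x ∈ posOrthant (Fin p₁), ∀ D, |G x D| ≤ K x * Real.exp (κ * ‖D‖))
    (hGd : ∀ D, IsGammaDensity α R D fun x => G x D) (hR : R.PosDef) (hB : B.PosDef)
    (hα : (p₂ : ℝ) - 1 < 2 * α) (P : Matrix (Fin p₁) (Fin p₂) ℝ) :
    ∃ s : ℝ, 0 ≤ s ∧ ∀ (t₁ : Fin p₁ → ℝ) (t₂ : Fin p₂ → ℝ), (∀ i, 0 ≤ t₁ i) → (∀ j, s ≤ t₂ j) →
      Integrable (fun p : (Fin p₁ → ℝ) × SymmCoord p₂ => Real.exp (-∑ i, t₁ i * p.1 i) *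
          Real.exp (-∑ j, t₂ j * p.2.1 j) * mixtureIntegrand G P Pᵀ B α p.1 p.2)
        ((volume.restrict (posOrthant (Fin p₁))).prod
          ((volume.restrict (posOrthant (Fin p₂))).prod (volume.restrict (correlationSet p₂)))) ∧
      ∫ p : (Fin p₁ → ℝ) × SymmCoord p₂, Real.exp (-∑ i, t₁ i * p.1 i) *
          Real.exp (-∑ j, t₂ j * p.2.1 j) * mixtureIntegrand G P Pᵀ B α p.1 p.2
        ∂((volume.restrict (posOrthant (Fin p₁))).prod
          ((volume.restrict (posOrthant (Fin p₂))).prod (volume.restrict (correlationSet p₂)))) =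
        (1 + R * diagonal t₁).det ^ (-α) * (multivariateGamma p₂ α *
          (B + (diagonal t₂ + Pᵀ * (diagonal t₁ * (1 + R * diagonal t₁)⁻¹) * P)).det ^ (-α)) := by
  obtain ⟨N, hN, hNb⟩ := exists_norm_conj_scaleByDiag_le P Pᵀ
  -- `exp (κ ‖P M Pᵀ‖) ≤ exp (κ N ∑ x₂ⱼ)` is absorbed by `exp (-t₂ · x₂)` for `t₂ ≥ κ N`
  refine ⟨κ * N, by positivity, fun t₁ t₂ ht₁ ht₂ => ?_⟩
  have ht₂' : ∀ j, 0 ≤ t₂ j := fun j => (mul_nonneg hκ hN).trans (ht₂ j)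
  have hm₁ : MeasurableSet (posOrthant (Fin p₁)) := isOpen_posOrthant.measurableSet
  have hm₂ : MeasurableSet (posOrthant (Fin p₂) ×ˢ correlationSet p₂) :=
    isOpen_posOrthant.measurableSet.prod (isClosed_correlationSet p₂).measurableSet
  have hν : (volume.restrict (posOrthant (Fin p₂))).prod (volume.restrict (correlationSet p₂)) =
      (volume.prod volume).restrict (posOrthant (Fin p₂) ×ˢ correlationSet p₂) :=
    Measure.prod_restrict _ _
  have hmem : ∀ᵐ z ∂((volume.restrict (posOrthant (Fin p₂))).prod
      (volume.restrict (correlationSet p₂))), z.1 ∈ posOrthant (Fin p₂) ∧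
        z.2 ∈ correlationSet p₂ := by
    rw [hν]
    exact ae_restrict_mem hm₂
  have hμ : (volume.restrict (posOrthant (Fin p₁))).prod
      ((volume.restrict (posOrthant (Fin p₂))).prod (volume.restrict (correlationSet p₂))) =
      (volume.prod (volume.prod volume)).restrict
        (posOrthant (Fin p₁) ×ˢ (posOrthant (Fin p₂) ×ˢ correlationSet p₂)) := by
    rw [hν, Measure.prod_restrict]
  have hint : Integrable (fun p : (Fin p₁ → ℝ) × SymmCoord p₂ => Real.exp (-∑ i, t₁ i * p.1 i) *
          Real.exp (-∑ j, t₂ j * p.2.1 j) * mixtureIntegrand G P Pᵀ B α p.1 p.2)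
        ((volume.restrict (posOrthant (Fin p₁))).prod
          ((volume.restrict (posOrthant (Fin p₂))).prod
            (volume.restrict (correlationSet p₂)))) := by
    have hA : (B + diagonal fun j => t₂ j - κ * N).PosDef :=
      hB.add_posSemidef (PosSemidef.diagonal fun j => sub_nonneg.2 (ht₂ j))
    refine (hK.mul_prod (integrable_corrWishart p₂ hA hα)).mono' ?_ ?_
    · refine AEStronglyMeasurable.mul (Continuous.aestronglyMeasurable (by fun_prop)) ?_
      refine AEStronglyMeasurable.mul ?_
        ((measurable_corrWishart B α).comp measurable_snd).aestronglyMeasurable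
      rw [hμ]
      exact ((continuousOn_mixture_density P Pᵀ hG).mono
        (Set.prod_mono_right (Set.subset_univ _))).aestronglyMeasurable (hm₁.prod hm₂)
    · rw [hμ]
      filter_upwards [ae_restrict_mem (hm₁.prod hm₂)] with p hp
      obtain ⟨h1, h2, h3⟩ := hp
      have hw := corrWishart_nonneg B α h2 h3
      have hK0 : 0 ≤ K p.1 := nonneg_of_mul_nonneg_left
        ((abs_nonneg _).trans (hbound p.1 h1 0)) (Real.exp_pos _)
      have he : Real.exp (-∑ i, t₁ i * p.1 i) ≤ 1 := Real.exp_le_one_iff.2 <|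
        neg_nonpos.2 <| Finset.sum_nonneg fun i _ => mul_nonneg (ht₁ i) (h1 i).le
      have hsum : ∑ j, (t₂ j - κ * N) * p.2.1 j =
          ∑ j, t₂ j * p.2.1 j - κ * (N * ∑ j, p.2.1 j) := by
        simp only [sub_mul, Finset.sum_sub_distrib, Finset.mul_sum, mul_assoc]
      rw [mixtureIntegrand, norm_mul, norm_mul, norm_mul, Real.norm_of_nonneg (Real.exp_nonneg _),
        Real.norm_of_nonneg (Real.exp_nonneg _), Real.norm_of_nonneg hw, Real.norm_eq_abs,
        corrWishart_add, trace_diagonal_mul_scaleByDiag _ h2, hsum]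
      calc _ ≤ 1 * Real.exp (-∑ j, t₂ j * p.2.1 j) *
            ((K p.1 * Real.exp (κ * (N * ∑ j, p.2.1 j))) * corrWishart B α p.2) := by
            gcongr
            refine (hbound p.1 h1 _).trans ?_
            gcongr
            exact hNb _ h2 _ h3
        _ = _ := by
          rw [neg_sub, sub_eq_add_neg, Real.exp_add]
          ring
  refine ⟨hint, ?_⟩
  have hE : (B + (diagonal t₂ + Pᵀ * (diagonal t₁ * (1 + R * diagonal t₁)⁻¹) * P)).PosDef := by
    refine hB.add_posSemidef ((PosSemidef.diagonal ht₂').add ?_)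
    exact (posSemidef_diagonal_mul_inv hR ht₁).conjTranspose_mul_mul_same P
  rw [integral_prod_symm _ hint, ← integral_corrWishart p₂ hE hα, ← integral_const_mul]
  refine integral_congr_ae ?_
  filter_upwards [hmem] with z hz
  have hL := ((hGd (P * scaleByDiag z.1 (unitDiagMatrix z.2) * Pᵀ)).2 t₁ ht₁).2
  rw [gammaTransform] at hL
  have htr : (diagonal t₁ * (1 + R * diagonal t₁)⁻¹ *
      (P * scaleByDiag z.1 (unitDiagMatrix z.2) * Pᵀ)).trace =
      (Pᵀ * (diagonal t₁ * (1 + R * diagonal t₁)⁻¹) * P *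
        scaleByDiag z.1 (unitDiagMatrix z.2)).trace := by
    rw [← Matrix.mul_assoc, trace_mul_comm]
    simp only [Matrix.mul_assoc]
  rw [htr] at hL
  rw [corrWishart_add, Matrix.add_mul, trace_add, trace_diagonal_mul_scaleByDiag _ hz.1, neg_add,
    Real.exp_add]
  calc _ = ∫ x in posOrthant (Fin p₁), (Real.exp (-∑ i, t₁ i * x i) *
        G x (P * scaleByDiag z.1 (unitDiagMatrix z.2) * Pᵀ)) *
          (Real.exp (-∑ j, t₂ j * z.1 j) * corrWishart B α z) := by
        refine integral_congr_ae (Filter.Eventually.of_forall fun x => ?_)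
        simp only [mixtureIntegrand]
        ring
    _ = _ := by
      rw [integral_mul_const, hL]
      ring

theorem integrable_sumPi {f : (Fin p₁ → ℝ) × (Fin p₂ → ℝ) → ℝ}
    (hf : Integrable f ((volume.restrict (posOrthant (Fin p₁))).prod
      (volume.restrict (posOrthant (Fin p₂))))) :
    IntegrableOn (fun x : Fin p₁ ⊕ Fin p₂ → ℝ => f (fun i => x (Sum.inl i), fun j => x (Sum.inr j)))
      (posOrthant (Fin p₁ ⊕ Fin p₂)) ∧
    ∫ x in posOrthant (Fin p₁ ⊕ Fin p₂), f (fun i => x (Sum.inl i), fun j => x (Sum.inr j)) =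
      ∫ z, f z ∂((volume.restrict (posOrthant (Fin p₁))).prod
        (volume.restrict (posOrthant (Fin p₂)))) := by
  have hmp := volume_measurePreserving_sumPiEquivProdPi fun _ : Fin p₁ ⊕ Fin p₂ => ℝ
  have hemb := (MeasurableEquiv.sumPiEquivProdPi
    fun _ : Fin p₁ ⊕ Fin p₂ => ℝ).measurableEmbedding
  have hpre : posOrthant (Fin p₁ ⊕ Fin p₂) =
      (MeasurableEquiv.sumPiEquivProdPi fun _ : Fin p₁ ⊕ Fin p₂ => ℝ) ⁻¹'
        (posOrthant (Fin p₁) ×ˢ posOrthant (Fin p₂)) := by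
    ext x
    simp [posOrthant, MeasurableEquiv.sumPiEquivProdPi]
  rw [Measure.prod_restrict] at hf ⊢
  rw [hpre]
  exact ⟨(hmp.integrableOn_comp_preimage hemb).2 hf, hmp.setIntegral_preimage_emb hemb f _⟩

/-- Fubini's theorem for the Laplace transform of an integral over the correlation matrices, the two
blocks of variables being joined into one point of the orthant. -/
theorem laplace_mixture (f : (Fin p₁ → ℝ) → SymmCoord p₂ → ℝ) (t₁ : Fin p₁ → ℝ) (t₂ : Fin p₂ → ℝ)
    (h : Integrable (fun p : (Fin p₁ → ℝ) × SymmCoord p₂ => Real.exp (-∑ i, t₁ i * p.1 i) *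
        Real.exp (-∑ j, t₂ j * p.2.1 j) * f p.1 p.2)
      ((volume.restrict (posOrthant (Fin p₁))).prod
        ((volume.restrict (posOrthant (Fin p₂))).prod (volume.restrict (correlationSet p₂))))) :
    IntegrableOn (fun x => Real.exp (-∑ i, Sum.elim t₁ t₂ i * x i) *
        ∫ c in correlationSet p₂, f (fun i => x (Sum.inl i)) (fun j => x (Sum.inr j), c))
      (posOrthant (Fin p₁ ⊕ Fin p₂)) ∧
    ∫ x in posOrthant (Fin p₁ ⊕ Fin p₂), Real.exp (-∑ i, Sum.elim t₁ t₂ i * x i) *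
        ∫ c in correlationSet p₂, f (fun i => x (Sum.inl i)) (fun j => x (Sum.inr j), c) =
      ∫ p : (Fin p₁ → ℝ) × SymmCoord p₂, Real.exp (-∑ i, t₁ i * p.1 i) *
          Real.exp (-∑ j, t₂ j * p.2.1 j) * f p.1 p.2
        ∂((volume.restrict (posOrthant (Fin p₁))).prod
          ((volume.restrict (posOrthant (Fin p₂))).prod
            (volume.restrict (correlationSet p₂)))) := by
  have hmp := measurePreserving_prodAssoc (volume.restrict (posOrthant (Fin p₁)))
    (volume.restrict (posOrthant (Fin p₂))) (volume.restrict (correlationSet p₂))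
  have hemb := (MeasurableEquiv.prodAssoc (α := Fin p₁ → ℝ) (β := Fin p₂ → ℝ)
    (γ := UpperIndex p₂ → ℝ)).measurableEmbedding
  have h' := (hmp.integrable_comp_emb hemb).2 h
  have hs := integrable_sumPi h'.integral_prod_left
  have heq : ∀ x : Fin p₁ ⊕ Fin p₂ → ℝ,
      (∫ c in correlationSet p₂, Real.exp (-∑ i, t₁ i * x (Sum.inl i)) *
        Real.exp (-∑ j, t₂ j * x (Sum.inr j)) *
          f (fun i => x (Sum.inl i)) (fun j => x (Sum.inr j), c)) =
      Real.exp (-∑ i, Sum.elim t₁ t₂ i * x i) *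
        ∫ c in correlationSet p₂, f (fun i => x (Sum.inl i)) (fun j => x (Sum.inr j), c) := by
    intro x
    rw [integral_const_mul, Fintype.sum_sum_type, neg_add, Real.exp_add]
    rfl
  simp only [← heq]
  exact ⟨hs.1, hs.2.trans ((integral_prod _ h').symm.trans (hmp.integral_comp hemb
    fun p : (Fin p₁ → ℝ) × SymmCoord p₂ => Real.exp (-∑ i, t₁ i * p.1 i) *
      Real.exp (-∑ j, t₂ j * p.2.1 j) * f p.1 p.2))⟩

end

/-! ### The mixture representation -/

/-- Since a density exists, the function picked by `Classical.epsilon` is one. -/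
theorem isGammaDensity_noncentralGammaDensity {ι : Type*} [Fintype ι] [DecidableEq ι]
    {S : Matrix ι ι ℝ} (hS : S.PosDef) {α : ℝ} (hα : 0 < α) (D : Matrix ι ι ℝ) :
    IsGammaDensity α S D (noncentralGammaDensity α S D) := by
  obtain ⟨G, -, -, -, -, -, -, h⟩ := exists_gammaDensity_family hS hα
  exact Classical.epsilon_spec ⟨_, h D⟩

theorem IsGammaDensity.eqOn {ι : Type*} [Fintype ι] [DecidableEq ι] {S D : Matrix ι ι ℝ} {α : ℝ}
    {f g : (ι → ℝ) → ℝ} (hf : IsGammaDensity α S D f) (hg : IsGammaDensity α S D g) :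
    Set.EqOn f g (posOrthant ι) :=
  eqOn_of_laplace_eq hf.1 hg.1 0 (fun t ht => (hf.2 t ht).1) (fun t ht => (hg.2 t ht).1)
    fun t ht => (hf.2 t ht).2.trans (hg.2 t ht).2.symm

theorem correlationIntegrand_eq_mixtureIntegrand {p₁ p₂ : ℕ}
    {S : Matrix (Fin p₁ ⊕ Fin p₂) (Fin p₁ ⊕ Fin p₂) ℝ} (hS : S.PosDef) {α : ℝ}
    {x : Fin p₁ ⊕ Fin p₂ → ℝ} (c : UpperIndex p₂ → ℝ)
    {G : (Fin p₁ → ℝ) → Matrix (Fin p₁) (Fin p₁) ℝ → ℝ}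
    (hG : ∀ D, noncentralGammaDensity α (schurComplement S) D (fun i => x (Sum.inl i)) =
      G (fun i => x (Sum.inl i)) D) :
    correlationIntegrand α S x (unitDiagMatrix c) =
      mixtureIntegrand G (S.toBlocks₁₂ * S.toBlocks₂₂⁻¹) (S.toBlocks₁₂ * S.toBlocks₂₂⁻¹)ᵀ
        S.toBlocks₂₂⁻¹ α (fun i => x (Sum.inl i)) (fun j => x (Sum.inr j), c) := by
  rw [correlationIntegrand, hG, transpose_regression hS, mixtureIntegrand, corrWishart,
    Matrix.mul_assoc _ S.toBlocks₂₂⁻¹ S.toBlocks₂₁]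
  ring

theorem theorem1 (p₁ p₂ : ℕ) (hp₁ : 0 < p₁) (hp₂ : 0 < p₂)
    (S : Matrix (Fin p₁ ⊕ Fin p₂) (Fin p₁ ⊕ Fin p₂) ℝ) (hS : S.PosDef)
    (α : ℝ) (hα : max ((p₁ : ℝ) - 1) ((p₂ : ℝ) - 1) < 2 * α) :
    -- both kinds of densities in the identity exist
    IsGammaDensity α S 0 (gammaDensity α S) ∧
    (∀ D : Matrix (Fin p₁) (Fin p₁) ℝ, D.PosSemidef →
      IsGammaDensity α (schurComplement S) D
        (noncentralGammaDensity α (schurComplement S) D)) ∧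
    -- the identity, at every point of the open orthant
    ∀ x ∈ posOrthant (Fin p₁ ⊕ Fin p₂),
      IntegrableOn (fun c => correlationIntegrand α S x (unitDiagMatrix c))
        (correlationSet p₂) ∧
      gammaDensity α S x =
        (multivariateGamma p₂ α)⁻¹ * S.toBlocks₂₂.det ^ (-α) *
          ∫ c in correlationSet p₂, correlationIntegrand α S x (unitDiagMatrix c) := by
  have hα₂ : (p₂ : ℝ) - 1 < 2 * α := (le_max_right _ _).trans_lt hα
  have hα0 : 0 < α := by
    have h1 : (1 : ℝ) ≤ p₁ := by exact_mod_cast hp₁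
    linarith [(le_max_left ((p₁ : ℝ) - 1) ((p₂ : ℝ) - 1)).trans_lt hα]
  have hR := posDef_schurComplement hS
  have hD := posDef_toBlocks₂₂ hS
  have hdens : IsGammaDensity α S 0 (gammaDensity α S) :=
    isGammaDensity_noncentralGammaDensity hS hα0 0
  refine ⟨hdens, fun D _ => isGammaDensity_noncentralGammaDensity hR hα0 D, ?_⟩
  obtain ⟨G, K, κ, hκ, hG, hK, hbound, hGd⟩ := exists_gammaDensity_family hR hα0
  set P := S.toBlocks₁₂ * S.toBlocks₂₂⁻¹ with hP
  obtain ⟨s, hs, hlap⟩ :=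
    exists_laplace_mixtureIntegrand hκ hG hK hbound hGd hR hD.inv hα₂ P
  set c₀ := (multivariateGamma p₂ α)⁻¹ * S.toBlocks₂₂.det ^ (-α) with hc₀
  let F : (Fin p₁ ⊕ Fin p₂ → ℝ) → ℝ := fun x => c₀ * ∫ c in correlationSet p₂,
    mixtureIntegrand G P Pᵀ S.toBlocks₂₂⁻¹ α (fun i => x (Sum.inl i)) (fun j => x (Sum.inr j), c)
  have hFc : ContinuousOn F (posOrthant (Fin p₁ ⊕ Fin p₂)) :=
    continuousOn_const.mul <| (continuousOn_mixture P Pᵀ S.toBlocks₂₂⁻¹ hG hα₂).comp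
      (f := fun x : Fin p₁ ⊕ Fin p₂ → ℝ => (fun i => x (Sum.inl i), fun j => x (Sum.inr j)))
      (by fun_prop) fun x hx => ⟨fun i => hx _, fun j => hx _⟩
  have hF : ∀ t : Fin p₁ ⊕ Fin p₂ → ℝ, (∀ i, Sum.elim (fun _ => (0 : ℝ)) (fun _ => s) i ≤ t i) →
      IntegrableOn (fun x => Real.exp (-∑ i, t i * x i) * F x) (posOrthant (Fin p₁ ⊕ Fin p₂)) ∧
      ∫ x in posOrthant (Fin p₁ ⊕ Fin p₂), Real.exp (-∑ i, t i * x i) * F x =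
        gammaTransform α S 0 t := by
    intro t ht
    obtain ⟨t₁, t₂, rfl⟩ : ∃ t₁ t₂, t = Sum.elim t₁ t₂ := ⟨_, _, (Sum.elim_comp_inl_inr t).symm⟩
    have ht₁ : ∀ i, 0 ≤ t₁ i := fun i => ht (Sum.inl i)
    have ht₂ : ∀ j, s ≤ t₂ j := fun j => ht (Sum.inr j)
    obtain ⟨h1, h2⟩ := hlap t₁ t₂ ht₁ ht₂
    obtain ⟨h3, h4⟩ := laplace_mixture _ t₁ t₂ h1
    have hE : (S.toBlocks₂₂⁻¹ + (diagonal t₂ +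
        Pᵀ * (diagonal t₁ * (1 + schurComplement S * diagonal t₁)⁻¹) * P)).PosDef := by
      refine hD.inv.add_posSemidef ((PosSemidef.diagonal fun j => hs.trans (ht₂ j)).add ?_)
      exact (posSemidef_diagonal_mul_inv hR ht₁).conjTranspose_mul_mul_same P
    have hcongr : ∀ x : Fin p₁ ⊕ Fin p₂ → ℝ,
        Real.exp (-∑ i, Sum.elim t₁ t₂ i * x i) * F x =
        c₀ * (Real.exp (-∑ i, Sum.elim t₁ t₂ i * x i) * ∫ c in correlationSet p₂,
          mixtureIntegrand G P Pᵀ S.toBlocks₂₂⁻¹ α (fun i => x (Sum.inl i))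
            (fun j => x (Sum.inr j), c)) := fun x => mul_left_comm _ _ _
    simp only [hcongr]
    refine ⟨h3.const_mul c₀, ?_⟩
    rw [integral_const_mul, h4, h2, gammaTransform, Matrix.mul_zero, trace_zero, neg_zero,
      Real.exp_zero, mul_one, det_one_add_mul_diagonal hS t₂ ht₁, ← hP,
      Real.mul_rpow (det_one_add_mul_diagonal_pos hR ht₁).le (mul_pos hD.det_pos hE.det_pos).le,
      Real.mul_rpow hD.det_pos.le hE.det_pos.le, hc₀]
    have := (multivariateGamma_pos hα₂).ne'
    field_simp
  -- comparison on `t₁ ≥ 0`, `t₂ ≥ s`, where both transforms are known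
  have hst : ∀ t : Fin p₁ ⊕ Fin p₂ → ℝ, (∀ i, Sum.elim (fun _ => (0 : ℝ)) (fun _ => s) i ≤ t i) →
      ∀ i, 0 ≤ t i := by
    rintro t ht (i | j)
    · exact ht (Sum.inl i)
    · exact hs.trans (ht (Sum.inr j))
  have hEq := eqOn_of_laplace_eq hdens.1 hFc (Sum.elim (fun _ => 0) fun _ => s)
    (fun t ht => (hdens.2 t (hst t ht)).1) (fun t ht => (hF t ht).1)
    fun t ht => (hdens.2 t (hst t ht)).2.trans (hF t ht).2.symm
  -- the densities in the integrand agree with the jointly continuous family `G` on the orthant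
  intro x hx
  have hx₁ : (fun i => x (Sum.inl i)) ∈ posOrthant (Fin p₁) := fun i => hx _
  have hx₂ : (fun j => x (Sum.inr j)) ∈ posOrthant (Fin p₂) := fun j => hx _
  simp only [correlationIntegrand_eq_mixtureIntegrand hS _ fun D =>
    (isGammaDensity_noncentralGammaDensity hR hα0 D).eqOn (hGd D) hx₁]
  exact ⟨integrableOn_mixtureIntegrand P Pᵀ _ hG hα₂ hx₁ hx₂, hEq hx⟩
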